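/- **Conventions.** An algorithm is a probabilistic Turing machine, modelled by a finite control working on finitely many stacks over a finite alphabet, each step being a push, a pop or a fair coin flip. For a set $X$ of inputs, $T_{\mathcal A}(X)$ is the supremum, over inputs in $X$ and over all outcomes of the coins, of the number of steps until $\mathcal A$ halts. Formulas and networks are given to the algorithms as words (variable indices in unary; networks layer by layer as the list of their weights and biases). Real outputs are finite binary expansions. Let $k,C\ge 1$ be integers. Let $\mathcal S_k(n)$ be the set of CNF formulas in the variables $x_1,\dots,x_n$ with at most $k$ literals per clause, and $\widetilde{\mathcal S}_k(n)$ the set of those with at most $Cn$ clauses. A decision algorithm for $k$SAT halts on every $\alpha\in\bigcup_n\mathcal S_k(n)$, decides with probability at least $2/3$ correctly whether $\alpha$ is satisfiable, and accepts an input that is not such a formula with probability at most $1/3$. Put $$\widetilde s_k:=\inf\{s>0 : \text{there is a decision algorithm } \mathcal B \text{ for } k\text{SAT with } T_{\mathcal B}(\widetilde{\mathcal S}_k(n))=\mathcal O(2^{sn}) \text{ as } n\to\infty\}.$$ For a set $\theta\subset\mathbb R$, let $\mathcal N(m,w,L,\theta)$ be the set of feed-forward networks with $m$ inputs, one output, at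 most $L$ layers, all layers (input and output included) having between $1$ and $w$ neurons, and all weights and biases in $\theta$. Write $\mathcal R_\Phi$ for the realization of $\Phi$ with a fixed activation function $\sigma:\mathbb R\to\mathbb R$, applied after every layer but the last. **Theorem.** Let $0<\eta<1/2$ and let $\theta_r\subset\mathbb R$ be finite. Suppose that $\Psi\in\mathcal N(1,w_r,L_r,\theta_r)$ realizes a continuous function $r=\mathcal R_\Psi:\mathbb R\to[0,1]$ with $r(x)=0$ for $x\le 1/2$ and $r(x)=1$ for $x\ge 1-\eta$. Let $\theta_{\rm CNF}\subset\mathbb R$ be any finite set that contains all numbers $jab+c$ with $j\in\mathbb Z$, $|j|\le k$, and $a,b,c\in\theta_r\cup\{-1,0,1\}$. Let $\delta>0$ and let $d:\mathbb N\to\mathbb N$ satisfy $d(n)\ge n$ for all $n$. For $n\ge 0$ put $$\mathcal K(n):=\Big\{\Phi\in\bigcup_{\ell=1}^{n}\mathcal N\big(2\ell,\;C\cdot 2n\cdot w_r k,\;3L_r-2,\;\theta_{\rm CNF}\big) : \mathcal R_\Phi \text{ maps } [0,1]^{2\ell} \text{ to } [0,1]\Big\}.$$ For $\Phi\in\mathcal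 K(n)\setminus\mathcal K(n-1)$ with $2\ell$ inputs let $M_\Phi\in\mathbb R^{2^{d(n)}\times 2^{d(n)}}$ be the matrix with entries $$(M_\Phi)_{ij}=\mathcal R_\Phi\big(b(i)_1,\dots,b(i)_\ell,b(j)_1,\dots,b(j)_\ell\big),\qquad 0\le i,j<2^{d(n)},$$ where $b(i)\in\{0,1\}^{d(n)}$ is the binary representation of $i$. Let $\mathcal A$ be a probabilistic algorithm such that, for all $n\ge1$ and all $\Phi\in\mathcal K(n)\setminus\mathcal K(n-1)$, with probability at least $2/3$, $$\Big|\mathcal A(\Phi)-\frac{|M_\Phi\mathbf 1|}{\|M_\Phi\|_2\,|\mathbf 1|}\Big|<\tfrac12\,2^{-(1/2+1-\widetilde s_k+\delta)n},$$ where $|\cdot|$ is the Euclidean norm, $\|\cdot\|_2$ the spectral norm, $\mathbf 1$ the all-ones vector, and the quotient is $0$ if $M_\Phi=0$. If $T_{\mathcal A}(\mathcal K(n))=\mathcal O(2^{tn})$ as $n\to\infty$ for some $t>0$, then $t\ge 2\widetilde s_k$. -/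

import Mathlib

open MeasureTheory Filter
open scoped ENNReal

noncomputable section

/-! ### Probabilistic machines

A probabilistic machine has a finite control and finitely many stacks over a finite alphabet (a tape
of a Turing machine is a pair of stacks, so this is the multitape probabilistic Turing machine, up
to a constant factor in the running time). In one step it pushes one symbol, pops one symbol and
branches on it, or flips a fair coin and branches on the outcome. -/

/-- Instructions of a machine with stacks `K`, stack alphabet `Γ` and control states `Λ`. -/
inductive Instr (K Γ Λ : Type) : Type
  /-- Push `a` on stack `k`, then go to `next`. -/
  | push (k : K) (a : Γ) (next : Λ) : Instr K Γ Λ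
  /-- Pop stack `k` and branch on the removed symbol (`none` if the stack was empty). -/
  | pop (k : K) (next : Option Γ → Λ) : Instr K Γ Λ
  /-- Flip a fair coin and branch on the outcome. -/
  | flip (next : Bool → Λ) : Instr K Γ Λ
  /-- Stop. -/
  | halt : Instr K Γ Λ

/-- Probabilistic machines that read words over `ι` and write words over `ο`. -/
structure ProbMachine (ι ο : Type) where
  /-- the stacks -/
  K : Type
  /-- the stack alphabet -/
  Γ : Type
  /-- the control states -/
  Λ : Type
  [decK : DecidableEq K]
  [finK : Fintype K]
  [finΓ : Fintype Γ]
  [finΛ : Fintype Λ]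
  /-- the stack that holds the input at the start -/
  inStack : K
  /-- the stack that holds the output at the end -/
  outStack : K
  /-- how input symbols are written on the input stack -/
  inSym : ι → Γ
  /-- how symbols on the output stack are read -/
  outSym : Γ → ο
  /-- the initial state -/
  start : Λ
  /-- the program -/
  prog : Λ → Instr K Γ Λ

namespace ProbMachine

variable {ι ο : Type}

attribute [instance] ProbMachine.decK ProbMachine.finK ProbMachine.finΓ ProbMachine.finΛ

/-- A configuration: control state, contents of the stacks (top first), number of coins used. -/
structure Cfg (M : ProbMachine ι ο) where
  /-- current control state -/
  state : M.Λ
  /-- contents of the stacks -/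
  stk : M.K → List M.Γ
  /-- number of coin flips made so far -/
  coins : ℕ

/-- One step; `ω i` is the outcome of the `i`-th coin flip. A halted configuration stays put. -/
def step (M : ProbMachine ι ο) (ω : ℕ → Bool) (c : M.Cfg) : M.Cfg :=
  match M.prog c.state with
  | .push k a next => ⟨next, Function.update c.stk k (a :: c.stk k), c.coins⟩
  | .pop k next => ⟨next (c.stk k).head?, Function.update c.stk k (c.stk k).tail, c.coins⟩
  | .flip next => ⟨next (ω c.coins), c.stk, c.coins + 1⟩
  | .halt => c

/-- The initial configuration: the input on the input stack, all other stacks empty. -/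
def init (M : ProbMachine ι ο) (x : List ι) : M.Cfg :=
  ⟨M.start, Function.update (fun _ => []) M.inStack (x.map M.inSym), 0⟩

/-- The configuration after `t` steps on input `x` with coin flips `ω`. -/
def run (M : ProbMachine ι ο) (x : List ι) (ω : ℕ → Bool) (t : ℕ) : M.Cfg :=
  (M.step ω)^[t] (M.init x)

/-- The configuration `c` is a halting configuration. -/
def Halted (M : ProbMachine ι ο) (c : M.Cfg) : Prop := M.prog c.state = Instr.halt

/-- On input `x` and coin flips `ω` the machine halts with output `y`. -/
def HasOutput (M : ProbMachine ι ο) (x : List ι) (ω : ℕ → Bool) (y : List ο) : Prop :=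
  ∃ t, M.Halted (M.run x ω t) ∧ ((M.run x ω t).stk M.outStack).map M.outSym = y

/-- The number of steps until the machine halts (`⊤` if it does not). -/
def time (M : ProbMachine ι ο) (x : List ι) (ω : ℕ → Bool) : ℕ∞ :=
  ⨅ (t : ℕ) (_ : M.Halted (M.run x ω t)), (t : ℕ∞)

/-- The worst-case running time on a set of inputs. -/
def worstTime (M : ProbMachine ι ο) (X : Set (List ι)) : ℕ∞ :=
  ⨆ x ∈ X, ⨆ ω : ℕ → Bool, M.time x ω

/-- The worst-case running time on `X n` is `O(2 ^ (s * n))` as `n → ∞`. -/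
def RunsInExpTime (M : ProbMachine ι ο) (X : ℕ → Set (List ι)) (s : ℝ) : Prop :=
  ∃ c : ℝ, ∀ᶠ n : ℕ in atTop,
    ((M.worstTime (X n) : ℕ∞) : ℝ≥0∞) ≤ ENNReal.ofReal (c * (2 : ℝ) ^ (s * (n : ℝ)))

end ProbMachine

/-- The law of a sequence of independent fair coin flips. -/
def coinMeasure : Measure (ℕ → Bool) :=
  Measure.infinitePi fun _ : ℕ => (PMF.uniformOfFintype Bool).toMeasure

/-! ### Satisfiability -/

/-- A literal `(i, true)` is the variable `x_i`, and `(i, false)` is its negation; variables are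
numbered from `0`. A clause is a list of literals. -/
abbrev Clause := List (ℕ × Bool)

/-- A formula in conjunctive normal form is a list of clauses. -/
abbrev CNF := List Clause

/-- Some assignment makes a literal of each clause true. -/
def CNF.Satisfiable (α : CNF) : Prop :=
  ∃ x : ℕ → Bool, ∀ c ∈ α, ∃ l ∈ c, x l.1 = l.2

/-- Formulas in the variables `x_0, …, x_{n-1}` with at most `k` literals per clause. -/
def kCNF (k n : ℕ) : Set CNF :=
  {α | ∀ c ∈ α, c.length ≤ k ∧ ∀ l ∈ c, l.1 < n}

/-- Formulas in `kCNF k n` with at most `C * n` clauses. -/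
def sparseKCNF (k C n : ℕ) : Set CNF :=
  {α | α ∈ kCNF k n ∧ α.length ≤ C * n}

/-- The symbols used to write down formulas. -/
inductive CNFSym : Type
  | tick
  | literal (sign : Bool)
  | endClause

/-- The literal `(i, γ)` is written as `i` ticks followed by its sign. -/
def encodeLiteral (l : ℕ × Bool) : List CNFSym :=
  List.replicate l.1 CNFSym.tick ++ [CNFSym.literal l.2]

/-- A formula as a word. -/
def encodeCNF (α : CNF) : List CNFSym :=
  α.flatMap fun c => c.flatMap encodeLiteral ++ [CNFSym.endClause]

/-- `M` is a probabilistic decision algorithm for `k`SAT (output `1` for "satisfiable"): it halts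
on all `k`-CNF formulas, its answer on each of them is correct with probability at least `2/3`, and
a word that does not encode a `k`-CNF formula is accepted with probability at most `1/3`. -/
structure DecidesKSAT (k : ℕ) (M : ProbMachine CNFSym Bool) : Prop where
  halts : ∀ n, ∀ α ∈ kCNF k n, ∀ ω, ∃ y, M.HasOutput (encodeCNF α) ω y
  sat : ∀ n, ∀ α ∈ kCNF k n, α.Satisfiable →
    2 / 3 ≤ coinMeasure {ω | M.HasOutput (encodeCNF α) ω [true]}
  unsat : ∀ n, ∀ α ∈ kCNF k n, ¬ α.Satisfiable →
    2 / 3 ≤ coinMeasure {ω | M.HasOutput (encodeCNF α) ω [false]}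
  invalid : ∀ x : List CNFSym, (∀ n, ∀ α ∈ kCNF k n, encodeCNF α ≠ x) →
    coinMeasure {ω | M.HasOutput x ω [true]} ≤ 1 / 3

/-- The exponent of `k`SAT on formulas with at most `C * n` clauses: the infimum of all `s > 0`
such that `k`SAT has a decision algorithm that takes time `O(2 ^ (s * n))` on these formulas. -/
def sTilde (k C : ℕ) : ℝ :=
  sInf {s : ℝ | 0 < s ∧ ∃ M : ProbMachine CNFSym Bool, DecidesKSAT k M ∧
    M.RunsInExpTime (fun n => encodeCNF '' sparseKCNF k C n) s}

/-! ### Neural networks -/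

/-- Feed-forward networks with `m` inputs, one output and weights in `θ`, given by their weight
matrices and bias vectors, from the first layer to the last. -/
inductive Net (θ : Finset ℝ) : ℕ → Type
  /-- the last layer, which is affine -/
  | last {m : ℕ} (W : Fin m → θ) (b : θ) : Net θ m
  /-- a layer of `p` neurons, followed by the rest of the network -/
  | layer {m p : ℕ} (W : Matrix (Fin p) (Fin m) θ) (b : Fin p → θ) (rest : Net θ p) : Net θ m

namespace Net

variable {θ : Finset ℝ}

/-- The realization of a network with activation function `σ`. -/
def realize (σ : ℝ → ℝ) : {m : ℕ} → Net θ m → (Fin m → ℝ) → ℝ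
  | _, last W b, x => ∑ j, (W j : ℝ) * x j + (b : ℝ)
  | _, layer W b rest, x => rest.realize σ fun i => σ (∑ j, (W i j : ℝ) * x j + (b i : ℝ))

/-- The number of layers. -/
def depth : {m : ℕ} → Net θ m → ℕ
  | _, last _ _ => 1
  | _, layer _ _ rest => rest.depth + 1

/-- All layers, the input and the output layer included, have between `1` and `w` neurons. -/
def WidthLE (w : ℕ) : {m : ℕ} → Net θ m → Prop
  | m, last _ _ => (1 ≤ m ∧ m ≤ w) ∧ 1 ≤ w
  | m, layer _ _ rest => (1 ≤ m ∧ m ≤ w) ∧ rest.WidthLE w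

end Net

/-- Networks with `m` inputs, width at most `w`, depth at most `L` and weights in `θ`. -/
def netClass (m w L : ℕ) (θ : Finset ℝ) : Set (Net θ m) :=
  {Φ | Φ.WidthLE w ∧ Φ.depth ≤ L}

/-- The symbols used to write down networks with weights in `θ`. -/
inductive NetSym (θ : Finset ℝ) : Type
  | weight (a : θ)
  | endNeuron
  | endLayer

/-- A network as a word: layer by layer and neuron by neuron, the weights followed by the bias. -/
def encodeNet {θ : Finset ℝ} : {m : ℕ} → Net θ m → List (NetSym θ)
  | _, .last W b =>
      (List.ofFn fun j => NetSym.weight (W j)) ++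
        [NetSym.weight b, NetSym.endNeuron, NetSym.endLayer]
  | _, .layer W b rest =>
      (List.ofFn fun i => (List.ofFn fun j => NetSym.weight (W i j)) ++
        [NetSym.weight (b i), NetSym.endNeuron]).flatten ++ [NetSym.endLayer] ++ encodeNet rest

/-- The weights and biases that occur when copies of a network with weights in `θr` (together with
`-1`, `0`, `1`) are composed and added up to evaluate a `k`-CNF formula. -/
def cnfWeights (k : ℕ) (θr : Finset ℝ) : Set ℝ :=
  {x | ∃ j : ℤ, |j| ≤ (k : ℤ) ∧ ∃ a ∈ (θr : Set ℝ) ∪ {-1, 0, 1},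
    ∃ b ∈ (θr : Set ℝ) ∪ {-1, 0, 1}, ∃ c ∈ (θr : Set ℝ) ∪ {-1, 0, 1}, x = j * a * b + c}

/-- The networks with `2ℓ` inputs, `1 ≤ ℓ ≤ n`, of width at most `C * (2n) * wr * k` and depth at
most `3 * Lr - 2`, which map `[0,1]^(2ℓ)` to `[0,1]`. -/
def mvmClass (σ : ℝ → ℝ) (k C wr Lr : ℕ) (θ : Finset ℝ) (n : ℕ) : Set (Σ ℓ : ℕ, Net θ (2 * ℓ)) :=
  {Φ | 1 ≤ Φ.1 ∧ Φ.1 ≤ n ∧ Φ.2 ∈ netClass (2 * Φ.1) (C * (2 * n) * wr * k) (3 * Lr - 2) θ ∧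
    ∀ x : Fin (2 * Φ.1) → ℝ, (∀ i, x i ∈ Set.Icc (0 : ℝ) 1) →
      Φ.2.realize σ x ∈ Set.Icc (0 : ℝ) 1}

/-! ### Matrices encoded by networks -/

/-- The digit number `p` (from `0`, most significant digit first) of the binary representation of
`i < 2 ^ d` with `d` digits. -/
def binDigit (d i p : ℕ) : ℝ := if i.testBit (d - 1 - p) then 1 else 0

/-- The `2^d × 2^d` matrix of a network with `2ℓ` inputs, `ℓ ≤ d`: the entry `(i, j)` is the value
at the first `ℓ` binary digits of `i` followed by the first `ℓ` binary digits of `j`. -/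
def netMatrix {θ : Finset ℝ} (σ : ℝ → ℝ) (d : ℕ) {ℓ : ℕ} (Φ : Net θ (2 * ℓ)) :
    Matrix (Fin (2 ^ d)) (Fin (2 ^ d)) ℝ :=
  Matrix.of fun i j => Φ.realize σ fun p =>
    if (p : ℕ) < ℓ then binDigit d i p else binDigit d j ((p : ℕ) - ℓ)

/-- `|M 1| / (‖M‖₂ |1|)` with Euclidean norms, the spectral norm, and the all-ones vector `1`. It
is `0` for `M = 0`. -/
def mvmRatio {N : ℕ} (M : Matrix (Fin N) (Fin N) ℝ) : ℝ :=
  ‖WithLp.toLp 2 (M.mulVec 1)‖ /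
    (‖Matrix.toEuclideanCLM (𝕜 := ℝ) M‖ * ‖WithLp.toLp 2 (1 : Fin N → ℝ)‖)

/-! ### Approximation algorithms -/

/-- The symbols used to write down real numbers. -/
inductive NumSym : Type
  | minus
  | point
  | digit (b : Bool)

/-- A finite binary expansion as a word: sign, integer digits (most significant digit first),
point, fractional digits. -/
def numeral (neg : Bool) (ip fp : List Bool) : List NumSym :=
  (if neg then [NumSym.minus] else []) ++ ip.map NumSym.digit ++ [NumSym.point] ++
    fp.map NumSym.digit

/-- The number `0.b₁b₂…` in binary. -/
def fracValue : List Bool → ℝ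
  | [] => 0
  | b :: l => ((if b then 1 else 0) + fracValue l) / 2

/-- The real number written as `numeral neg ip fp`. -/
def numeralValue (neg : Bool) (ip fp : List Bool) : ℝ :=
  (if neg then -1 else 1) *
    (ip.foldl (fun v b => 2 * v + (if b then 1 else 0)) 0 + fracValue fp)

/-- With probability at least `2/3` the machine `A` halts on input `x` and outputs a number that
differs from `y` by less than `ε`. -/
def Approximates {ι : Type} (A : ProbMachine ι NumSym) (x : List ι) (y ε : ℝ) : Prop :=
  2 / 3 ≤ coinMeasure {ω | ∃ neg ip fp, A.HasOutput x ω (numeral neg ip fp) ∧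
    |numeralValue neg ip fp - y| < ε}

end

/-! The proof reduces `k`SAT to the approximation problem. A formula in the class with at most `C *
n` clauses becomes a network whose matrix has entries 0 and 1 and is nonzero exactly when the
formula is satisfiable. The variables are split evenly into row and column bits, so the network
belongs to an index `ℓ` close to `n / 2`. An algorithm of cost `2 ^ (t * ℓ)` on networks thus
decides satisfiability in time about `2 ^ (t * n / 2)`, and this gives `sTilde k C ≤ t / 2`.

The network. A clause is a sum of literals, where the negation of `x` counts as `1 - x`. At a 0-1
point this affine form is 0 if the clause fails and at least 1 otherwise, so `r` turns it into a
truth value. Applying `r` once more to one plus the sum over the clauses of `r(form) - r(1)` gives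
the truth value of the formula, because the argument is one minus the number of violated clauses
(`CNF.step_sum_items`). Pairing every clause with a constant block of opposite sign makes the signs
sum to zero. The output biases of the copies of `r` then cancel, and all weights of the merged
layers lie in `cnfWeights` (`Net.realize_parallel`, `Net.realize_ofForms`).

The gap. An unsatisfiable formula has ratio 0. For a satisfiable one, an entry depends only on the
first `ℓ` of the `d` digits of the column index, so every nonzero row has at least `2 ^ (d - ℓ)`
ones. The spectral norm is at most the Frobenius norm, and so the ratio is at least `2 ^ (-ℓ / 2)`
(`le_mvmRatio`, `mvmRatio_netMatrix`). Exhaustive search shows `sTilde k C ≤ 1 + δ`, whence the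
tolerance is at most half of this gap (`sTilde_le_one_add`, `rpow_tolerance_le`). Taking `ℓ = 2 * h`
makes the threshold `2 ^ -(h + 1)` a power of two, and comparing with it means looking for a digit 1
in a prefix of the output (`Code.verdict_spec`).

The width bound leaves room for the paired blocks only if `k ≥ 2`. For `k = 1` satisfiability is
decided in polynomial time, so the exponent is at most every positive number (`sTilde_one_le`).

Most of the length is the machine model. Machines are assembled from routines with exits, closed
under sequencing and loops, and every routine comes with a statement of its effect on named stacks
and a step bound. The machine of the reduction checks its input, writes the network in time
quadratic in the sizes involved (`Code.exists_runs_writeNet`), simulates the given machine on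
separate stacks with the same coins (`Code.path_call`), and reads the verdict off the output. -/

noncomputable section

/-! ### Routines: machines with exits, closed under sequencing and iteration -/

/-- The contents of the stacks, together with the number of coins used. -/
structure Memory (K Γ : Type) where
  stk : K → List Γ
  coins : ℕ

namespace Instr

variable {K Γ Λ Λ' : Type}

/-- Relabel the targets of an instruction. -/
def map (f : Λ → Λ') : Instr K Γ Λ → Instr K Γ Λ'
  | push k a n => push k a (f n)
  | pop k g => pop k fun o => f (g o)
  | flip g => flip fun b => f (g b)
  | halt => halt

/-- Execute one instruction; `none` if it is `halt`. -/
def exec [DecidableEq K] (ω : ℕ → Bool) : Instr K Γ Λ → Memory K Γ → Option (Λ × Memory K Γ)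
  | push k a n, m => some (n, ⟨Function.update m.stk k (a :: m.stk k), m.coins⟩)
  | pop k g, m => some (g (m.stk k).head?, ⟨Function.update m.stk k (m.stk k).tail, m.coins⟩)
  | flip g, m => some (g (ω m.coins), ⟨m.stk, m.coins + 1⟩)
  | halt, _ => none

theorem exec_map [DecidableEq K] (ω : ℕ → Bool) (f : Λ → Λ') (i : Instr K Γ Λ) (m : Memory K Γ)
    {l : Λ} {m' : Memory K Γ} (h : i.exec ω m = some (l, m')) :
    (i.map f).exec ω m = some (f l, m') := by
  cases i <;> simp_all [map, exec]

end Instr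

theorem ProbMachine.step_of_exec {ι ο : Type} {M : ProbMachine ι ο} {ω : ℕ → Bool}
    {l l' : M.Λ} {m m' : Memory M.K M.Γ} (h : (M.prog l).exec ω m = some (l', m')) :
    M.step ω ⟨l, m.stk, m.coins⟩ = ⟨l', m'.stk, m'.coins⟩ := by
  unfold ProbMachine.step
  dsimp only
  cases hp : M.prog l <;> rw [hp] at h <;>
    simp only [Instr.exec, Option.some.injEq, Prod.mk.injEq, reduceCtorEq] at h
  all_goals obtain ⟨rfl, rfl⟩ := h; rfl

/-- A program with finite control that leaves through an exit in `E`. -/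
structure Routine (K Γ E : Type) where
  Λ : Type
  [fin : Finite Λ]
  start : Λ
  prog : Λ → Instr K Γ (Λ ⊕ E)

namespace Routine

attribute [instance] Routine.fin

variable {K Γ E F S : Type}

/-- From state `l` and memory `m` the routine leaves through `e` with memory `m'` after exactly `t`
steps. -/
inductive Path [DecidableEq K] (p : Routine K Γ E) (ω : ℕ → Bool) :
    p.Λ → Memory K Γ → E → Memory K Γ → ℕ → Prop
  | exit {l m e m'} : (p.prog l).exec ω m = some (.inr e, m') → Path p ω l m e m' 1
  | next {l m l' m' e m'' t} : (p.prog l).exec ω m = some (.inl l', m') →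
      Path p ω l' m' e m'' t → Path p ω l m e m'' (t + 1)

/-- Push one symbol. -/
def push (k : K) (a : Γ) : Routine K Γ Unit where
  Λ := Unit
  start := ()
  prog _ := .push k a (.inr ())

/-- Pop one symbol and return it. -/
def pop (k : K) : Routine K Γ (Option Γ) where
  Λ := Unit
  start := ()
  prog _ := .pop k .inr

/-- Leave with `e` without changing the memory. -/
def ret [Inhabited K] [Inhabited Γ] (e : E) : Routine K Γ E where
  Λ := Bool
  start := false
  prog
    -- No instruction leaves the memory unchanged, so returning is a push undone by a pop. This
    -- costs two steps.
    | false => .push default default (.inl true)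
    | true => .pop default fun _ => .inr e

/-- Sequencing. -/
def bind [Finite E] (p : Routine K Γ E) (f : E → Routine K Γ F) : Routine K Γ F where
  Λ := p.Λ ⊕ Σ e, (f e).Λ
  start := .inl p.start
  prog
    | .inl l => (p.prog l).map
        (Sum.elim (fun l' => .inl (.inl l')) (fun e => .inl (.inr ⟨e, (f e).start⟩)))
    | .inr ⟨e, l⟩ => ((f e).prog l).map (Sum.elim (fun l' => .inl (.inr ⟨e, l'⟩)) .inr)

/-- Iteration: run `body` until it returns an element of `E`. -/
def loop [Finite S] (body : S → Routine K Γ (S ⊕ E)) (x : S) : Routine K Γ E where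
  Λ := Σ y, (body y).Λ
  start := ⟨x, (body x).start⟩
  prog
    | ⟨y, l⟩ => ((body y).prog l).map
        (Sum.elim (fun l' => .inl ⟨y, l'⟩)
          (Sum.elim (fun z => .inl ⟨z, (body z).start⟩) .inr))

variable [DecidableEq K] {ω : ℕ → Bool}

theorem path_push (k : K) (a : Γ) (m : Memory K Γ) :
    (push k a).Path ω () m () ⟨Function.update m.stk k (a :: m.stk k), m.coins⟩ 1 :=
  .exit rfl

theorem path_pop (k : K) (m : Memory K Γ) :
    (pop k).Path ω () m (m.stk k).head? ⟨Function.update m.stk k (m.stk k).tail, m.coins⟩ 1 :=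
  .exit rfl

theorem path_ret [Inhabited K] [Inhabited Γ] (e : E) (m : Memory K Γ) :
    (ret e : Routine K Γ E).Path ω false m e m 2 := by
  refine .next (l' := true) rfl (.exit ?_)
  simp [ret, Instr.exec]

theorem path_bind_right [Finite E] {p : Routine K Γ E} {f : E → Routine K Γ F} {e : E}
    {l m e' m' t} (h : (f e).Path ω l m e' m' t) :
    (p.bind f).Path ω (.inr ⟨e, l⟩) m e' m' t := by
  induction h with
  | exit h => exact .exit (Instr.exec_map ω _ _ _ h)
  | next h _ ih => exact .next (Instr.exec_map ω _ _ _ h) ih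

theorem path_bind [Finite E] {p : Routine K Γ E} {f : E → Routine K Γ F} {l m e m' t e' m'' t'}
    (h : p.Path ω l m e m' t) (h' : (f e).Path ω (f e).start m' e' m'' t') :
    (p.bind f).Path ω (.inl l) m e' m'' (t + t') := by
  induction h with
  | exit h => rw [Nat.add_comm]; exact .next (Instr.exec_map ω _ _ _ h) (path_bind_right h')
  | next h _ ih => rw [Nat.add_right_comm]; exact .next (Instr.exec_map ω _ _ _ h) (ih h')

theorem path_loop_exit [Finite S] {body : S → Routine K Γ (S ⊕ E)} {x y : S} {l m e m' t}
    (h : (body y).Path ω l m (.inr e) m' t) : (loop body x).Path ω ⟨y, l⟩ m e m' t := by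
  generalize hr : (Sum.inr e : S ⊕ E) = r at h
  induction h with
  | exit h => subst hr; exact .exit (Instr.exec_map ω _ _ _ h)
  | next h _ ih => exact .next (Instr.exec_map ω _ _ _ h) (ih hr)

theorem path_loop_again [Finite S] {body : S → Routine K Γ (S ⊕ E)} {x y z : S}
    {l m m' t e m'' t'} (h : (body y).Path ω l m (.inl z) m' t)
    (h' : (loop body x).Path ω ⟨z, (body z).start⟩ m' e m'' t') :
    (loop body x).Path ω ⟨y, l⟩ m e m'' (t + t') := by
  generalize hr : (Sum.inl z : S ⊕ E) = r at h
  induction h with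
  | exit h => subst hr; rw [Nat.add_comm]; exact .next (Instr.exec_map ω _ _ _ h) h'
  | next h _ ih => rw [Nat.add_right_comm]; exact .next (Instr.exec_map ω _ _ _ h) (ih h' hr)

/-- The initial value enters only the field `start`. Two loops with the same body therefore have the
same paths, which lets a loop be unrolled as a loop started at its next value. -/
theorem path_loop_start [Finite S] {body : S → Routine K Γ (S ⊕ E)} {x x' : S}
    {l m e m' t} (h : (loop body x).Path ω l m e m' t) : (loop body x').Path ω l m e m' t := by
  induction h with
  | exit h => exact .exit h
  | next h _ ih => exact .next h ih

/-- The machine that runs a routine and halts at its exits. -/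
def toMachine {ι ο : Type} [Fintype K] [Fintype Γ] [Finite E] (p : Routine K Γ E)
    (inStack outStack : K) (inSym : ι → Γ) (outSym : Γ → ο) : ProbMachine ι ο where
  K := K
  Γ := Γ
  Λ := p.Λ ⊕ E
  finΛ := Fintype.ofFinite _
  inStack := inStack
  outStack := outStack
  inSym := inSym
  outSym := outSym
  start := .inl p.start
  prog := Sum.elim p.prog fun _ => .halt

theorem toMachine_iterate {ι ο : Type} [Fintype K] [Fintype Γ] [Finite E] (p : Routine K Γ E)
    (inStack outStack : K) (inSym : ι → Γ) (outSym : Γ → ο) {l m e m' t}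
    (h : p.Path ω l m e m' t) :
    ((p.toMachine inStack outStack inSym outSym).step ω)^[t] ⟨.inl l, m.stk, m.coins⟩ =
      ⟨.inr e, m'.stk, m'.coins⟩ := by
  have key : ∀ (l : p.Λ) (m : Memory K Γ) (x : p.Λ ⊕ E) (m' : Memory K Γ),
      (p.prog l).exec ω m = some (x, m') →
      (p.toMachine inStack outStack inSym outSym).step ω ⟨.inl l, m.stk, m.coins⟩ =
        ⟨x, m'.stk, m'.coins⟩ := fun l m x m' h =>
    ProbMachine.step_of_exec (M := p.toMachine inStack outStack inSym outSym) (l := .inl l) h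
  induction h with
  | exit h => exact key _ _ _ _ h
  | next h _ ih => rw [Function.iterate_succ_apply, key _ _ _ _ h]; exact ih

end Routine

/-! ### Routines on named registers -/

/-- The names of the working stacks. -/
inductive Reg : Type
  | inp | bak | row | aux | cnt | blk | don | thr | net | ans
  deriving DecidableEq

instance : Fintype Reg :=
  ⟨{.inp, .bak, .row, .aux, .cnt, .blk, .don, .thr, .net, .ans}, fun x => by cases x <;> decide⟩

/-- Contents of the working stacks and of further stacks `KA`. -/
structure Store (KA Γ : Type) where
  ext : KA → List Γ
  inp : List Γ
  bak : List Γ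
  row : List Γ
  aux : List Γ
  cnt : List Γ
  blk : List Γ
  don : List Γ
  thr : List Γ
  net : List Γ
  ans : List Γ
  coins : ℕ

namespace Store

variable {KA Γ : Type}

/-- The contents of a register. -/
def get (s : Store KA Γ) : Reg → List Γ
  | .inp => s.inp
  | .bak => s.bak
  | .row => s.row
  | .aux => s.aux
  | .cnt => s.cnt
  | .blk => s.blk
  | .don => s.don
  | .thr => s.thr
  | .net => s.net
  | .ans => s.ans

/-- Overwrite a register. -/
def set (s : Store KA Γ) (k : Reg) (l : List Γ) : Store KA Γ :=
  match k with
  | .inp => { s with inp := l }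
  | .bak => { s with bak := l }
  | .row => { s with row := l }
  | .aux => { s with aux := l }
  | .cnt => { s with cnt := l }
  | .blk => { s with blk := l }
  | .don => { s with don := l }
  | .thr => { s with thr := l }
  | .net => { s with net := l }
  | .ans => { s with ans := l }

theorem get_set (s : Store KA Γ) (k k' : Reg) (l : List Γ) :
    (s.set k l).get k' = if k' = k then l else s.get k' := by
  cases k <;> cases k' <;> rfl

@[simp] theorem set_ext (s : Store KA Γ) (k : Reg) (l : List Γ) : (s.set k l).ext = s.ext := by
  cases k <;> rfl

@[simp] theorem set_coins (s : Store KA Γ) (k : Reg) (l : List Γ) :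
    (s.set k l).coins = s.coins := by
  cases k <;> rfl

/-- In the general transfer lemmas the registers are variables, so their updates do not reduce.
Comparing contents register by register leaves only case distinctions on names. -/
theorem eq_of_get {s s' : Store KA Γ} (h₁ : s.ext = s'.ext) (h₂ : s.coins = s'.coins)
    (h : ∀ k, s.get k = s'.get k) : s = s' := by
  cases s; cases s'
  obtain rfl := h₁
  obtain rfl := h₂
  have e := fun k => h k
  obtain rfl : _ = _ := e .inp
  obtain rfl : _ = _ := e .bak
  obtain rfl : _ = _ := e .row
  obtain rfl : _ = _ := e .aux
  obtain rfl : _ = _ := e .cnt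
  obtain rfl : _ = _ := e .blk
  obtain rfl : _ = _ := e .don
  obtain rfl : _ = _ := e .thr
  obtain rfl : _ = _ := e .net
  obtain rfl : _ = _ := e .ans
  rfl

/-- The store as a memory. -/
def toMemory (s : Store KA Γ) : Memory (KA ⊕ Reg) Γ := ⟨Sum.elim s.ext s.get, s.coins⟩

theorem toMemory_set [DecidableEq KA] (s : Store KA Γ) (k : Reg) (l : List Γ) :
    (s.set k l).toMemory = ⟨Function.update s.toMemory.stk (.inr k) l, s.toMemory.coins⟩ := by
  simp only [toMemory, set_coins, set_ext, Memory.mk.injEq, and_true]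
  funext x
  rcases x with x | x
  · simp
  · simp [Function.update_apply, get_set]

theorem toMemory_setExt [DecidableEq KA] (s : Store KA Γ) (k : KA) (l : List Γ) :
    ({ s with ext := Function.update s.ext k l } : Store KA Γ).toMemory =
      ⟨Function.update s.toMemory.stk (.inl k) l, s.toMemory.coins⟩ := by
  simp only [toMemory, Memory.mk.injEq, and_true]
  funext x
  rcases x with x | x
  · simp [Function.update_apply]
  · simp; rfl

end Store

instance : Inhabited CNFSym := ⟨.tick⟩

instance : Inhabited Reg := ⟨.aux⟩

instance : Finite CNFSym :=
  Finite.of_injective (β := Option (Option Bool))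
    (fun | .tick => none | .endClause => some none | .literal b => some (some b))
    (by rintro (_ | _ | _) (_ | _ | _) h <;> simp_all)

/-- Routines on the working stacks and on further stacks `KA`, with the symbols of formulas and
further symbols `X`. -/
abbrev Code (KA X E : Type) := Routine (KA ⊕ Reg) (CNFSym ⊕ X) E

namespace Code

variable {KA X E F S : Type} [DecidableEq KA]

instance : Inhabited (KA ⊕ Reg) := ⟨.inr default⟩

instance : Inhabited (CNFSym ⊕ X) := ⟨.inl default⟩

/-- The routine `p` started with `s` leaves through `e` with `s'` within `T` steps. -/
def Runs (p : Code KA X E) (ω : ℕ → Bool) (s : Store KA (CNFSym ⊕ X)) (e : E)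
    (s' : Store KA (CNFSym ⊕ X)) (T : ℕ) : Prop :=
  ∃ t ≤ T, p.Path ω p.start s.toMemory e s'.toMemory t

/-- Push on a register. -/
def push (k : Reg) (a : CNFSym ⊕ X) : Code KA X Unit := Routine.push (.inr k) a

/-- Pop a register. -/
def pop (k : Reg) : Code KA X (Option (CNFSym ⊕ X)) := Routine.pop (.inr k)

/-- Return a value. -/
def ret (e : E) : Code KA X E := Routine.ret e

/-- Sequencing. -/
def bind [Finite E] (p : Code KA X E) (f : E → Code KA X F) : Code KA X F := Routine.bind p f

/-- Sequencing, ignoring the value. -/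
def andThen (p : Code KA X Unit) (q : Code KA X F) : Code KA X F := p.bind fun _ => q

/-- Iteration. -/
def loop [Finite S] (body : S → Code KA X (S ⊕ E)) (x : S) : Code KA X E := Routine.loop body x

variable {ω : ℕ → Bool} {s s' s'' : Store KA (CNFSym ⊕ X)} {T T' : ℕ}

theorem Runs.congr {p : Code KA X E} {e e' : E} (h : Runs p ω s e s' T) (he : e = e')
    (hs : s' = s'') (hT : T ≤ T') : Runs p ω s e' s'' T' := by
  subst hs he
  obtain ⟨t, ht, h⟩ := h
  exact ⟨t, ht.trans hT, h⟩

theorem Runs.mono {p : Code KA X E} {e : E} (h : Runs p ω s e s' T) (hT : T ≤ T') :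
    Runs p ω s e s' T' := h.congr rfl rfl hT

theorem runs_push (k : Reg) (a : CNFSym ⊕ X) :
    Runs (push k a) ω s () (s.set k (a :: s.get k)) 1 := by
  refine ⟨1, le_rfl, ?_⟩
  rw [Store.toMemory_set]
  exact Routine.path_push _ _ _

theorem runs_pop (k : Reg) :
    Runs (pop k) ω s (s.get k).head? (s.set k (s.get k).tail) 1 := by
  refine ⟨1, le_rfl, ?_⟩
  rw [Store.toMemory_set]
  exact Routine.path_pop _ _

theorem runs_ret (e : E) : Runs (ret e) ω s e s 2 := ⟨2, le_rfl, Routine.path_ret e _⟩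

theorem Runs.bind [Finite E] {p : Code KA X E} {f : E → Code KA X F} {e : E} {e' : F}
    (h : Runs p ω s e s' T) (h' : Runs (f e) ω s' e' s'' T') :
    Runs (p.bind f) ω s e' s'' (T + T') := by
  obtain ⟨t, ht, h⟩ := h
  obtain ⟨t', ht', h'⟩ := h'
  exact ⟨t + t', add_le_add ht ht', Routine.path_bind h h'⟩

theorem Runs.andThen {p : Code KA X Unit} {q : Code KA X F} {e' : F}
    (h : Runs p ω s () s' T) (h' : Runs q ω s' e' s'' T') :
    Runs (p.andThen q) ω s e' s'' (T + T') := Runs.bind h h'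

theorem Runs.loop_exit [Finite S] {body : S → Code KA X (S ⊕ E)} {x : S} {e : E}
    (h : Runs (body x) ω s (.inr e) s' T) : Runs (loop body x) ω s e s' T := by
  obtain ⟨t, ht, h⟩ := h
  exact ⟨t, ht, Routine.path_loop_exit h⟩

theorem Runs.loop_again [Finite S] {body : S → Code KA X (S ⊕ E)} {x y : S} {e : E}
    (h : Runs (body x) ω s (.inl y) s' T) (h' : Runs (loop body y) ω s' e s'' T') :
    Runs (loop body x) ω s e s'' (T + T') := by
  obtain ⟨t, ht, h⟩ := h
  obtain ⟨t', ht', h'⟩ := h'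
  exact ⟨t + t', add_le_add ht ht', Routine.path_loop_again h (Routine.path_loop_start h')⟩

theorem runs_push_andThen {k : Reg} {a : CNFSym ⊕ X} {q : Code KA X F} {e : F}
    (h : Runs q ω (s.set k (a :: s.get k)) e s' T) : Runs ((push k a).andThen q) ω s e s' (T + 1) :=
  ((runs_push k a).andThen h).mono (Nat.add_comm _ _).le

theorem runs_pop_bind [Finite X] {k : Reg} {f : Option (CNFSym ⊕ X) → Code KA X F} {e : F}
    (h : Runs (f (s.get k).head?) ω (s.set k (s.get k).tail) e s' T) :
    Runs ((pop k).bind f) ω s e s' (T + 1) :=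
  ((runs_pop k).bind h).mono (Nat.add_comm _ _).le

/-- Append a word to the register `net`. -/
def emit : List (CNFSym ⊕ X) → Code KA X Unit
  | [] => ret ()
  | a :: w => (push .net a).andThen (emit w)

theorem runs_emit (w : List (CNFSym ⊕ X)) :
    Runs (emit w) ω s () (s.set .net (w.reverse ++ s.get .net)) (w.length + 2) := by
  induction w generalizing s with
  | nil => exact runs_ret ()
  | cons a w ih =>
    refine (runs_push_andThen ih).congr rfl ?_ (by simp)
    simp [Store.set, Store.get]

/-- Move the contents of `src` to `dst`, changing the symbols by `f`, and emit `g a` for every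
symbol `a` that is moved. -/
def transfer [Finite X] (src dst : Reg) (f : CNFSym ⊕ X → CNFSym ⊕ X)
    (g : CNFSym ⊕ X → List (CNFSym ⊕ X)) : Code KA X Unit :=
  loop (S := Unit) (fun _ => (pop src).bind fun o =>
    match o with
    | none => ret (.inr ())
    | some a => (push dst (f a)).andThen ((emit (g a)).andThen (ret (.inl ())))) ()

theorem runs_transfer [Finite X] {src dst : Reg} (f : CNFSym ⊕ X → CNFSym ⊕ X)
    (g : CNFSym ⊕ X → List (CNFSym ⊕ X)) (h₁ : src ≠ dst) (h₂ : src ≠ .net) (h₃ : dst ≠ .net)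
    (G : ℕ) (hG : ∀ a, (g a).length ≤ G) :
    Runs (transfer src dst f g) ω s ()
      (((s.set src []).set dst (((s.get src).map f).reverse ++ s.get dst)).set .net
        (((s.get src).flatMap g).reverse ++ s.get .net)) ((s.get src).length * (G + 6) + 3) := by
  generalize hl : s.get src = l
  induction l generalizing s with
  | nil =>
    refine Runs.loop_exit ((runs_pop_bind (T := 2) ?_).congr rfl rfl (by simp))
    rw [hl]
    refine (runs_ret _).congr rfl (Store.eq_of_get (by simp) (by simp) fun k => ?_) le_rfl
    simp only [Store.get_set, List.tail_nil]
    split_ifs <;> simp_all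
  | cons a l ih =>
    have h := ih (s := ((s.set src l).set dst (f a :: s.get dst)).set .net
      ((g a).reverse ++ s.get .net)) (by simp [Store.get_set, h₁, h₂])
    refine (Runs.loop_again (T := 1 + (1 + ((g a).length + 2 + 2))) ?_ h).congr rfl ?_ ?_
    · refine (runs_pop src).bind ?_
      rw [hl]
      refine (runs_push _ _).andThen ((runs_emit _).andThen ((runs_ret _).congr rfl ?_ le_rfl))
      refine Store.eq_of_get (by simp) (by simp) fun k => ?_
      simp only [Store.get_set, List.tail_cons]
      split_ifs <;> simp_all
    · refine Store.eq_of_get (by simp) (by simp) fun k => ?_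
      simp only [Store.get_set]
      split_ifs <;> simp_all
    · have := hG a
      simp only [List.length_cons]
      nlinarith

/-- Move the contents of `src` to `dst`. -/
def move [Finite X] (src dst : Reg) : Code KA X Unit := transfer src dst id fun _ => []

theorem runs_move [Finite X] {src dst : Reg} (h₁ : src ≠ dst) (h₂ : src ≠ .net)
    (h₃ : dst ≠ .net) :
    Runs (move src dst) ω s () ((s.set src []).set dst ((s.get src).reverse ++ s.get dst))
      ((s.get src).length * 6 + 3) := by
  refine (runs_transfer id (fun _ => []) h₁ h₂ h₃ 0 (by simp)).congr rfl ?_ le_rfl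
  refine Store.eq_of_get (by simp) (by simp) fun k => ?_
  simp only [Store.get_set]
  split_ifs <;> simp_all

/-- Emit `g a` for every symbol `a` of the register `k`. -/
def emitMap [Finite X] (k : Reg) (g : CNFSym ⊕ X → List (CNFSym ⊕ X)) : Code KA X Unit :=
  (transfer k .aux id g).andThen (move .aux k)

/-- Moving a stack reverses it. The second move undoes the reversal, so `k` is read without being
lost and only `net` changes. -/
theorem runs_emitMap [Finite X] {k : Reg} (g : CNFSym ⊕ X → List (CNFSym ⊕ X))
    (h₁ : k ≠ .aux) (h₂ : k ≠ .net) (hs : s.aux = []) (G : ℕ) (hG : ∀ a, (g a).length ≤ G) :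
    Runs (emitMap k g) ω s () (s.set .net (((s.get k).flatMap g).reverse ++ s.get .net))
      ((s.get k).length * (G + 12) + 6) := by
  have hs' : s.get .aux = [] := hs
  refine ((runs_transfer id g h₁ h₂ (by decide) G hG).andThen
    (runs_move h₁.symm (by decide) h₂)).congr rfl ?_ ?_
  · refine Store.eq_of_get (by simp) (by simp) fun k => ?_
    simp only [Store.get_set]
    split_ifs <;> simp_all
  · simp [Store.get_set, hs']
    nlinarith

/-! ### Scanning a formula -/

/-- Apply `f` to entry number `i` of a list that is continued by `a`s. -/
def touch {α : Type} (a : α) (f : α → α) : ℕ → List α → List α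
  | 0, r => f (r.headD a) :: r.tail
  | i + 1, r => r.headD a :: touch a f i r.tail

theorem length_touch {α : Type} (a : α) (f : α → α) (i : ℕ) (r : List α) :
    (touch a f i r).length = max r.length (i + 1) := by
  induction i generalizing r with
  | zero => cases r <;> simp [touch]
  | succ i ih => cases r <;> simp [touch, ih]

theorem getD_touch {α : Type} (a : α) (f : α → α) (i j : ℕ) (r : List α) :
    (touch a f i r).getD j a = if j = i then f (r.getD i a) else r.getD j a := by
  induction i generalizing r j with
  | zero => cases r <;> cases j <;> simp [touch]
  | succ i ih =>
    cases r <;> cases j <;> simp only [List.getD_eq_getElem?_getD] at ih <;> simp [touch, ih]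

/-- Read the input symbol by symbol and save it in `bak`. At a literal, the entry of `row` that
belongs to its variable is changed by `act`, and the control state by `upd`. At the end of a clause,
`fin` is executed. -/
def scan [Finite X] {Q : Type} [Finite Q] (a₀ : CNFSym ⊕ X)
    (act : Bool → CNFSym ⊕ X → CNFSym ⊕ X) (upd : Q → Bool → CNFSym ⊕ X → Q)
    (fin : Q → Code KA X Q) (q : Q) : Code KA X Q :=
  loop (fun q => (pop .inp).bind fun o =>
    match o with
    | none => ret (.inr q)
    | some a => (push .bak a).andThen <|
      match a with
      | .inl .tick => (pop .row).bind fun o => (push .aux (o.getD a₀)).andThen (ret (.inl q))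
      | .inl (.literal b) => (pop .row).bind fun o =>
          (push .row (act b (o.getD a₀))).andThen <|
            (move .aux .row).andThen (ret (.inl (upd q b (o.getD a₀))))
      | .inl .endClause => (fin q).bind fun q' => ret (.inl q')
      | .inr _ => ret (.inr q)) q

section Scan

variable [Finite X] {Q : Type} [Finite Q] {a₀ : CNFSym ⊕ X}
  {act : Bool → CNFSym ⊕ X → CNFSym ⊕ X} {upd : Q → Bool → CNFSym ⊕ X → Q}
  {fin : Q → Code KA X Q} {q q' : Q}

theorem runs_scan_nil (hs : s.inp = []) : Runs (scan a₀ act upd fin q) ω s q s 3 := by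
  refine Runs.loop_exit (runs_pop_bind (T := 2) ?_)
  have : s.get .inp = [] := hs
  rw [this]
  refine (runs_ret _).congr rfl ?_ le_rfl
  rw [List.tail_nil, ← hs]
  rfl

/-- A unary index is a walk along `row`: each tick moves one cell to `aux`, the sign then finds the
cell of its variable on top, and moving `aux` back restores the order. Cells already passed are
allowed at the start, so that induction on the number of ticks applies; the term in `s.aux.length`
pays for their way back. Past the end of `row` the walk reads `a₀`. -/
theorem runs_scan_literal_aux {i : ℕ} {b : Bool} {w : List (CNFSym ⊕ X)} {e : Q}
    (hs : s.inp = (encodeLiteral (i, b)).map .inl ++ w)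
    (h : Runs (scan a₀ act upd fin (upd q b (s.row.getD i a₀))) ω
      { s with
        inp := w
        bak := ((encodeLiteral (i, b)).map .inl).reverse ++ s.bak
        row := s.aux.reverse ++ touch a₀ (act b) i s.row
        aux := [] } e s' T) :
    Runs (scan a₀ act upd fin q) ω s e s' (T + 12 * (i + 1) + 6 * s.aux.length) := by
  induction i generalizing s with
  | zero =>
    have h1 : s.get .inp = .inl (.literal b) :: w := by
      simpa [encodeLiteral] using show s.get .inp = _ from hs
    refine (Runs.loop_again (T := 1 + (1 + (1 + (1 + ((s.aux.length * 6 + 3) + 2))))) ?_ h).mono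
      (by omega)
    refine (runs_pop _).bind ?_
    rw [h1]
    refine (runs_push _ _).andThen <| (runs_pop _).bind <| (runs_push _ _).andThen <|
      ((runs_move (by decide) (by decide) (by decide)).mono ?_).andThen <|
      (runs_ret _).congr ?_ ?_ le_rfl
    · rfl
    · simp only [Sum.inl.injEq]
      congr 1
      change s.row.head?.getD a₀ = _
      cases s.row <;> rfl
    · simp only [Store.set, Store.get, encodeLiteral, touch]
      cases s.row <;> simp
  | succ i ih =>
    have h1 : s.get .inp = .inl .tick :: ((encodeLiteral (i, b)).map .inl ++ w) := by
      simpa [encodeLiteral, List.replicate_succ] using show s.get .inp = _ from hs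
    let s₁ : Store KA (CNFSym ⊕ X) :=
      { s with
        inp := (encodeLiteral (i, b)).map .inl ++ w
        bak := .inl .tick :: s.bak
        row := s.row.tail
        aux := s.row.headD a₀ :: s.aux }
    have h2 := ih (s := s₁) rfl (by
      have e1 : s.row.tail.getD i a₀ = s.row.getD (i + 1) a₀ := by cases s.row <;> simp
      simp only [s₁, e1]
      convert h using 2
      · simp [encodeLiteral, List.replicate_succ]
      · simp [touch])
    refine (Runs.loop_again (T := 1 + (1 + (1 + (1 + 2)))) ?_ h2).mono (by simp [s₁]; omega)
    refine (runs_pop _).bind ?_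
    rw [h1]
    refine (runs_push _ _).andThen <| (runs_pop _).bind <| (runs_push _ _).andThen <|
      (runs_ret _).congr rfl ?_ le_rfl
    simp only [Store.set, Store.get, s₁]
    cases s.row <;> simp

/-- The effect of the literals of a clause on the control state. -/
def scanCtl (a₀ : CNFSym ⊕ X) (act : Bool → CNFSym ⊕ X → CNFSym ⊕ X)
    (upd : Q → Bool → CNFSym ⊕ X → Q) : Clause → Q → List (CNFSym ⊕ X) → Q
  | [], q, _ => q
  | l :: c, q, r => scanCtl a₀ act upd c (upd q l.2 (r.getD l.1 a₀)) (touch a₀ (act l.2) l.1 r)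

/-- The effect of the literals of a clause on `row`. -/
def scanRow (a₀ : CNFSym ⊕ X) (act : Bool → CNFSym ⊕ X → CNFSym ⊕ X) (c : Clause)
    (r : List (CNFSym ⊕ X)) : List (CNFSym ⊕ X) :=
  c.foldl (fun r l => touch a₀ (act l.2) l.1 r) r

/-- The runs of `fin` and of the rest of the scan are hypotheses, so the same lemma serves scans
that evaluate, count or write at the end of a clause. -/
theorem runs_scan_clause {c : Clause} {w : List (CNFSym ⊕ X)} {e : Q} {s₁ : Store KA (CNFSym ⊕ X)}
    {Tc : ℕ}
    (hs : s.inp = (c.flatMap encodeLiteral ++ [CNFSym.endClause]).map .inl ++ w) (ha : s.aux = [])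
    (hfin : Runs (fin (scanCtl a₀ act upd c q s.row)) ω
      { s with
        inp := w
        bak := ((c.flatMap encodeLiteral ++ [CNFSym.endClause]).map .inl).reverse ++ s.bak
        row := scanRow a₀ act c s.row } q' s₁ Tc)
    (h : Runs (scan a₀ act upd fin q') ω s₁ e s' T) :
    Runs (scan a₀ act upd fin q) ω s e s'
      (T + Tc + 12 * (c.flatMap encodeLiteral ++ [CNFSym.endClause]).length) := by
  induction c generalizing s q with
  | nil =>
    have h1 : s.get .inp = .inl .endClause :: w := by
      simpa using show s.get .inp = _ from hs
    refine (Runs.loop_again (T := 1 + (1 + (Tc + 2))) ?_ h).mono (by simp; omega)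
    refine (runs_pop _).bind ?_
    rw [h1]
    refine (runs_push _ _).andThen <| Runs.bind hfin (runs_ret _)
  | cons l c ih =>
    obtain ⟨i, b⟩ := l
    refine (runs_scan_literal_aux (i := i) (b := b)
      (w := (c.flatMap encodeLiteral ++ [CNFSym.endClause]).map .inl ++ w)
      (by simpa using hs) (ih rfl rfl ?_)).mono ?_
    · simpa [scanCtl, scanRow, ha] using hfin
    · simp [ha, encodeLiteral]; omega

end Scan

end Code

/-! ### Recognizing formulas -/

/-- The automaton that recognizes words of `k`-CNF formulas. The state holds the number of literals
in the current clause and whether ticks are pending; `none` is the error state. -/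
def clauseAutomaton (k : ℕ) : Option (Fin (k + 1) × Bool) → CNFSym → Option (Fin (k + 1) × Bool)
  | none, _ => none
  | some (j, _), .tick => some (j, true)
  | some (j, _), .literal _ => if h : j + 1 < k + 1 then some (⟨j + 1, h⟩, false) else none
  | some (_, t), .endClause => if t then none else some (0, false)

theorem foldl_clauseAutomaton_none (k : ℕ) (w : List CNFSym) :
    w.foldl (clauseAutomaton k) none = none := by
  induction w with
  | nil => rfl
  | cons a w ih => exact ih

/-- Generalized to runs that begin inside a clause, with `j` literals already read and `i` ticks
pending. The automaton remembers only whether `i` is positive, so the ticks are put back in front of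
`w`, and `c` is the part of the clause still to come. The first alternative is a word that ends at a
clause boundary. -/
theorem exists_of_clauseAutomaton (k : ℕ) (w : List CNFSym) (j : Fin (k + 1)) (i : ℕ)
    (h : w.foldl (clauseAutomaton k) (some (j, decide (0 < i))) = some (0, false)) :
    (w = [] ∧ (j : ℕ) = 0 ∧ i = 0) ∨
      ∃ (c : Clause) (α : CNF), c.length + j ≤ k ∧ (∀ c ∈ α, c.length ≤ k) ∧
        List.replicate i CNFSym.tick ++ w =
          (c.flatMap encodeLiteral ++ [CNFSym.endClause]) ++ encodeCNF α := by
  induction w generalizing j i with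
  | nil =>
    left
    simp only [List.foldl_nil, Option.some.injEq, Prod.mk.injEq, decide_eq_false_iff_not] at h
    exact ⟨rfl, by simp [h.1], by omega⟩
  | cons a w ih =>
    right
    rw [List.foldl_cons] at h
    rcases a with _ | b | _
    · rcases ih j (i + 1) (by simpa [clauseAutomaton] using h) with h | ⟨c, α, h1, h2, h3⟩
      · omega
      · refine ⟨c, α, h1, h2, ?_⟩
        rw [← h3, List.replicate_succ']
        simp
    · by_cases hj : (j : ℕ) + 1 < k + 1
      · rcases ih ⟨j + 1, hj⟩ 0 (by simpa [clauseAutomaton, hj] using h) with h | ⟨c, α, h1, h2, h3⟩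
        · simp at h
        · refine ⟨(i, b) :: c, α, ?_, h2, ?_⟩
          · simp only [List.length_cons] at h1 ⊢; omega
          · simp only [List.replicate_zero, List.nil_append] at h3
            simp [h3, encodeLiteral]
      · simp [clauseAutomaton, hj, foldl_clauseAutomaton_none] at h
    · rcases Nat.eq_zero_or_pos i with rfl | hi
      · rcases ih 0 0 (by simpa [clauseAutomaton] using h) with h | ⟨c, α, h1, h2, h3⟩
        · exact ⟨[], [], by simp; omega, by simp, by simp [h.1, encodeCNF]⟩
        · refine ⟨[], c :: α, by simp; omega, ?_, ?_⟩
          · simpa using ⟨by simpa using h1, h2⟩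
          · simp only [List.replicate_zero, List.nil_append] at h3
            simp [h3, encodeCNF]
      · simp [clauseAutomaton, hi, foldl_clauseAutomaton_none] at h

theorem clauseAutomaton_literals (k : ℕ) (c : Clause) (j : Fin (k + 1)) (hj : c.length + j ≤ k) :
    ∃ j', (c.flatMap encodeLiteral).foldl (clauseAutomaton k) (some (j, false)) =
      some (j', false) := by
  have ticks : ∀ (i : ℕ) (b : Bool), ∃ t,
      (List.replicate i CNFSym.tick).foldl (clauseAutomaton k) (some (j, b)) = some (j, t) := by
    intro i
    induction i with
    | zero => exact fun b => ⟨b, rfl⟩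
    | succ i ih => exact fun b => ih true
  induction c generalizing j with
  | nil => exact ⟨j, rfl⟩
  | cons l c ih =>
    obtain ⟨t, ht⟩ := ticks l.1 false
    have hj' : (j : ℕ) + 1 < k + 1 := by simp only [List.length_cons] at hj; omega
    simp only [List.flatMap_cons, encodeLiteral, List.foldl_append, ht, List.foldl_cons,
      List.foldl_nil, clauseAutomaton, hj', dif_pos]
    refine ih ⟨j + 1, hj'⟩ (by simp only [List.length_cons] at hj ⊢; omega) ?_
    intro i
    induction i with
    | zero => exact fun b => ⟨b, rfl⟩
    | succ i ih => exact fun b => ih true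

theorem clauseAutomaton_accepts_iff (k : ℕ) (w : List CNFSym) :
    w.foldl (clauseAutomaton k) (some (0, false)) = some (0, false) ↔
      ∃ α : CNF, (∀ c ∈ α, c.length ≤ k) ∧ encodeCNF α = w := by
  constructor
  · intro h
    rcases exists_of_clauseAutomaton k w 0 0 (by simpa using h) with h | ⟨c, α, h1, h2, h3⟩
    · exact ⟨[], by simp, by simp [h.1, encodeCNF]⟩
    · refine ⟨c :: α, ?_, ?_⟩
      · simpa using ⟨by simpa using h1, h2⟩
      · simp only [List.replicate_zero, List.nil_append] at h3
        simp [h3, encodeCNF]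
  · rintro ⟨α, h, rfl⟩
    induction α with
    | nil => rfl
    | cons c α ih =>
      obtain ⟨j, hj⟩ := clauseAutomaton_literals k c 0 (by simpa using h c (by simp))
      have := ih fun c hc => h c (by simp [hc])
      simp only [encodeCNF, List.flatMap_cons, List.foldl_append, hj] at this ⊢
      simpa [clauseAutomaton] using this

/-- A finite formula always has a bound on its indices. The automaton may therefore ignore them and
still recognize exactly the valid inputs. -/
theorem exists_mem_kCNF {k : ℕ} {α : CNF} (h : ∀ c ∈ α, c.length ≤ k) : ∃ n, α ∈ kCNF k n := by
  have h1 : ∀ L : List (ℕ × Bool), ∃ n, ∀ l ∈ L, l.1 < n := by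
    intro L
    induction L with
    | nil => exact ⟨0, by simp⟩
    | cons l L ih =>
      obtain ⟨n, hn⟩ := ih
      refine ⟨max n (l.1 + 1), ?_⟩
      simp only [List.mem_cons, forall_eq_or_imp]
      exact ⟨by omega, fun l hl => (hn l hl).trans_le (le_max_left _ _)⟩
  obtain ⟨n, hn⟩ := h1 α.flatten
  exact ⟨n, fun c hc => ⟨h c hc, fun l hl => hn l (List.mem_flatten.2 ⟨c, hc, hl⟩)⟩⟩

/-! ### Deciders: screening the input and answering -/

namespace Code

variable {KA X E F S : Type} [DecidableEq KA] [Finite X]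
  {ω : ℕ → Bool} {s s' s'' : Store KA (CNFSym ⊕ X)} {T T' : ℕ}

/-- Read the input, save it in `bak`, and decide whether the automaton accepts it from `q`. -/
def checkFrom (k : ℕ) (q : Option (Fin (k + 1) × Bool)) : Code KA X Bool :=
  loop (fun q : Option (Fin (k + 1) × Bool) => (pop .inp).bind fun o =>
    match o with
    | none => ret (.inr (decide (q = some (0, false))))
    | some a => (push .bak a).andThen <|
      match a with
      | .inl a => ret (.inl (clauseAutomaton k q a))
      | .inr _ => ret (.inr false)) q

theorem runs_checkFrom (k : ℕ) (q : Option (Fin (k + 1) × Bool)) (w : List CNFSym)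
    (hs : s.inp = w.map .inl) :
    Runs (checkFrom k q) ω s (decide (w.foldl (clauseAutomaton k) q = some (0, false)))
      { s with inp := [], bak := (w.map .inl).reverse ++ s.bak } (4 * w.length + 3) := by
  induction w generalizing s q with
  | nil =>
    refine Runs.loop_exit (runs_pop_bind (T := 2) ?_)
    have h1 : s.get .inp = [] := hs
    rw [h1]
    exact runs_ret _
  | cons a w ih =>
    have h1 : s.get .inp = .inl a :: w.map .inl := hs
    have h := ih (s := { s with inp := w.map .inl, bak := .inl a :: s.bak })
      (clauseAutomaton k q a) rfl
    refine (Runs.loop_again (T := 1 + (1 + 2)) ?_ h).congr rfl (by simp) (by simp; omega)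
    refine (runs_pop _).bind ?_
    rw [h1]
    exact (runs_push _ _).andThen (runs_ret _)

/-- The store at the start. -/
def initStore (KA : Type) {X : Type} (w : List CNFSym) : Store KA (CNFSym ⊕ X) :=
  ⟨fun _ => [], w.map .inl, [], [], [], [], [], [], [], [], [], 0⟩

/-- How answers are read. -/
def answer : CNFSym ⊕ X → Bool
  | .inl (.literal b) => b
  | _ => false

/-- Run `p` on words of `k`-CNF formulas and reject all other words. -/
def decideWith (k : ℕ) (p : Code KA X Bool) : Code KA X Unit :=
  (checkFrom k (some (0, false))).bind fun ok =>
    if ok then (move .bak .inp).andThen (p.bind fun b => push .ans (.inl (.literal b)))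
    else push .ans (.inl (.literal false))

/-- The machine that decides with `p`. -/
def decider [Fintype KA] (k : ℕ) (p : Code KA X Bool) : ProbMachine CNFSym Bool :=
  letI : Fintype (CNFSym ⊕ X) := Fintype.ofFinite _
  Routine.toMachine (decideWith k p) (.inr .inp) (.inr .ans) .inl answer

/-- With coins `ω` the routine `p` gives the answer `b` on the formula `α`. -/
def Yields (p : Code KA X Bool) (ω : ℕ → Bool) (α : CNF) (b : Bool) : Prop :=
  ∃ s' T, Runs p ω (initStore KA (encodeCNF α)) b s' T ∧ s'.ans = []

variable [Fintype KA] {k : ℕ} {p : Code KA X Bool}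

theorem decider_of_runs {w : List CNFSym} {b : Bool}
    (h : Runs (decideWith k p) ω (initStore KA w) () s' T) (hb : s'.ans = [.inl (.literal b)]) :
    (decider k p).HasOutput w ω [b] ∧ (decider k p).time w ω ≤ T := by
  let _ : Fintype (CNFSym ⊕ X) := Fintype.ofFinite _
  obtain ⟨t, ht, h⟩ := h
  have h1 := Routine.toMachine_iterate (ι := CNFSym) (ο := Bool) (decideWith k p)
    (.inr .inp) (.inr .ans) .inl answer h
  have h2 : (decider k p).run w ω t = ⟨.inr (), s'.toMemory.stk, s'.toMemory.coins⟩ := by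
    refine Eq.trans ?_ h1
    refine congrArg ((decider k p).step ω)^[t] ?_
    unfold ProbMachine.init
    congr 1
    funext x
    rcases x with x | x
    · rfl
    · cases x <;> rfl
  have h3 : (decider k p).Halted ((decider k p).run w ω t) := by rw [h2]; rfl
  refine ⟨⟨t, h3, ?_⟩, ?_⟩
  · rw [h2]
    change (s'.ans).map answer = [b]
    rw [hb]; rfl
  · exact (iInf₂_le t h3).trans (by exact_mod_cast ht)

theorem decider_of_valid {α : CNF} {b : Bool} (hα : ∀ c ∈ α, c.length ≤ k)
    (h : Runs p ω (initStore KA (encodeCNF α)) b s' T) (hs' : s'.ans = []) :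
    (decider k p).HasOutput (encodeCNF α) ω [b] ∧
      (decider k p).time (encodeCNF α) ω ≤ ((10 * (encodeCNF α).length + 7 + T : ℕ) : ℕ∞) := by
  refine decider_of_runs (((runs_checkFrom k _ (encodeCNF α) rfl).bind
    (T' := ((encodeCNF α).length * 6 + 3) + (T + 1)) ?_).mono (by omega))
    (s' := s'.set .ans (.inl (.literal b) :: s'.get .ans)) ?_
  · rw [decide_eq_true ((clauseAutomaton_accepts_iff k _).2 ⟨α, hα, rfl⟩), if_pos rfl]
    refine ((runs_move (by decide) (by decide) (by decide)).congr rfl ?_ ?_).andThen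
      (h.bind (runs_push _ _))
    · simp [Store.set, Store.get, initStore]
    · simp [Store.get, initStore]
  · change _ :: s'.ans = _
    rw [hs']

theorem decider_of_invalid {w : List CNFSym}
    (hw : ¬ ∃ α : CNF, (∀ c ∈ α, c.length ≤ k) ∧ encodeCNF α = w) :
    (decider k p).HasOutput w ω [false] := by
  refine (decider_of_runs ((runs_checkFrom k _ w rfl).bind (T' := 1) ?_)
    (s' := Store.set ⟨fun _ => [], [], (w.map .inl).reverse ++ [], [], [], [], [], [], [], [], [], 0⟩
      .ans [.inl (.literal false)]) rfl).1
  rw [decide_eq_false (mt (clauseAutomaton_accepts_iff k _).1 hw), if_neg (by simp)]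
  exact runs_push _ _

end Code

theorem ProbMachine.step_of_halted {ι ο : Type} {M : ProbMachine ι ο} {ω : ℕ → Bool} {c : M.Cfg}
    (h : M.Halted c) : M.step ω c = c := by
  unfold ProbMachine.Halted at h
  unfold ProbMachine.step
  rw [h]

/-- A halted configuration stays put, so all halting times show the same output stack. Hence a
certain rejection excludes acceptance. -/
theorem ProbMachine.HasOutput.unique {ι ο : Type} {M : ProbMachine ι ο} {x : List ι} {ω : ℕ → Bool}
    {y y' : List ο} (h : M.HasOutput x ω y) (h' : M.HasOutput x ω y') : y = y' := by
  have key : ∀ t t', t ≤ t' → M.Halted (M.run x ω t) → M.run x ω t' = M.run x ω t := by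
    intro t t' htt ht
    induction t', htt using Nat.le_induction with
    | base => rfl
    | succ n _ ih =>
      rw [← ih] at ht
      rw [← ih, ProbMachine.run, Function.iterate_succ_apply']
      exact ProbMachine.step_of_halted ht
  obtain ⟨t, ht, rfl⟩ := h
  obtain ⟨t', ht', rfl⟩ := h'
  rcases le_total t t' with htt | htt
  · rw [key t t' htt ht]
  · rw [key t' t htt ht']

namespace Code

variable {KA X : Type} [DecidableEq KA] [Finite X] [Fintype KA] {k : ℕ} {p : Code KA X Bool}

/-- A malformed word is rejected whatever the coins are, so it is accepted with probability 0. Only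
the behaviour of `p` on genuine formulas remains to be supplied. -/
theorem decidesKSAT_decider
    (halt : ∀ α : CNF, (∀ c ∈ α, c.length ≤ k) → ∀ ω, ∃ b, Yields p ω α b)
    (sat : ∀ α : CNF, (∀ c ∈ α, c.length ≤ k) → α.Satisfiable →
      2 / 3 ≤ coinMeasure {ω | Yields p ω α true})
    (unsat : ∀ α : CNF, (∀ c ∈ α, c.length ≤ k) → ¬ α.Satisfiable →
      2 / 3 ≤ coinMeasure {ω | Yields p ω α false}) :
    DecidesKSAT k (decider k p) where
  halts n α hα ω := by
    obtain ⟨b, s', T, h, hs'⟩ := halt α (fun c hc => (hα c hc).1) ω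
    exact ⟨_, (decider_of_valid (fun c hc => (hα c hc).1) h hs').1⟩
  sat n α hα hsat := by
    refine (sat α (fun c hc => (hα c hc).1) hsat).trans (measure_mono ?_)
    rintro ω ⟨s', T, h, hs'⟩
    exact (decider_of_valid (fun c hc => (hα c hc).1) h hs').1
  unsat n α hα hsat := by
    refine (unsat α (fun c hc => (hα c hc).1) hsat).trans (measure_mono ?_)
    rintro ω ⟨s', T, h, hs'⟩
    exact (decider_of_valid (fun c hc => (hα c hc).1) h hs').1
  invalid w hw := by
    have h0 : {ω | (decider k p).HasOutput w ω [true]} = ∅ := by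
      refine Set.eq_empty_of_forall_notMem fun ω hω => ?_
      have h : (decider k p).HasOutput w ω [false] := by
        refine decider_of_invalid ?_
        rintro ⟨α, h1, h2⟩
        obtain ⟨n, hn⟩ := exists_mem_kCNF h1
        exact hw n α hn h2
      simpa using hω.unique h
    rw [h0]
    simp

theorem two_thirds_le_coinMeasure_univ : 2 / 3 ≤ coinMeasure Set.univ := by
  have : IsProbabilityMeasure coinMeasure := by
    unfold coinMeasure
    infer_instance
  rw [measure_univ]
  exact ENNReal.div_le_of_le_mul (by norm_num)

theorem decidesKSAT_decider_of_forall
    (h : ∀ α : CNF, (∀ c ∈ α, c.length ≤ k) → ∀ ω, ∃ b,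
      Yields p ω α b ∧ (b = true ↔ α.Satisfiable)) :
    DecidesKSAT k (decider k p) := by
  refine decidesKSAT_decider (fun α hα ω => ?_) (fun α hα hs => ?_) fun α hα hs => ?_
  · obtain ⟨b, hb, -⟩ := h α hα ω
    exact ⟨b, hb⟩
  · refine two_thirds_le_coinMeasure_univ.trans (measure_mono fun ω _ => ?_)
    obtain ⟨b, hb, hb'⟩ := h α hα ω
    rwa [hb'.2 hs] at hb
  · refine two_thirds_le_coinMeasure_univ.trans (measure_mono fun ω _ => ?_)
    obtain ⟨b, hb, hb'⟩ := h α hα ω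
    rw [← hb', Bool.not_eq_true] at hs
    rwa [hs] at hb

/-- A time bound for all formulas gives a bound on the worst case. -/
theorem runsInExpTime_decider {C : ℕ} {u : ℝ} {B : ℕ → ℕ} {c : ℝ}
    (h : ∀ n, ∀ α ∈ sparseKCNF k C n, ∀ ω, ∃ b s' T,
      Runs p ω (initStore KA (encodeCNF α)) b s' T ∧ s'.ans = [] ∧
        10 * (encodeCNF α).length + 7 + T ≤ B n)
    (hB : ∀ᶠ n : ℕ in atTop, (B n : ℝ) ≤ c * (2 : ℝ) ^ (u * (n : ℝ))) :
    (decider k p).RunsInExpTime (fun n => encodeCNF '' sparseKCNF k C n) u := by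
  refine ⟨c, hB.mono fun n hn => ?_⟩
  have h1 : (decider k p).worstTime (encodeCNF '' sparseKCNF k C n) ≤ (B n : ℕ∞) := by
    refine iSup₂_le fun x hx => iSup_le fun ω => ?_
    obtain ⟨α, hα, rfl⟩ := hx
    obtain ⟨b, s', T, h1, h2, h3⟩ := h n α hα ω
    exact ((decider_of_valid (fun c hc => (hα.1 c hc).1) h1 h2).2).trans (by exact_mod_cast h3)
  calc (((decider k p).worstTime (encodeCNF '' sparseKCNF k C n) : ℕ∞) : ℝ≥0∞)
      ≤ ((B n : ℕ∞) : ℝ≥0∞) := by exact_mod_cast h1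
    _ = ENNReal.ofReal (B n : ℝ) := by simp
    _ ≤ _ := ENNReal.ofReal_le_ofReal hn

/-- An index below `n` costs at most `n` ticks and one sign, so sparse formulas have words of length
quadratic in `n`. -/
theorem length_encodeCNF_le {C n : ℕ} {α : CNF} (hα : α ∈ sparseKCNF k C n) :
    (encodeCNF α).length ≤ C * n * (k * (n + 1) + 1) := by
  have h1 : ∀ c : Clause, (∀ l ∈ c, l.1 < n) →
      (c.flatMap encodeLiteral).length ≤ c.length * (n + 1) := by
    intro c hc
    induction c with
    | nil => simp
    | cons l c ih =>
      have h2 := ih fun l hl => hc l (by simp [hl])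
      have h3 := hc l (by simp)
      simp only [List.flatMap_cons, List.length_append, List.length_cons, encodeLiteral,
        List.length_replicate, List.length_nil] at h2 ⊢
      nlinarith
  have h2 : ∀ α : CNF, α ∈ kCNF k n → (encodeCNF α).length ≤ α.length * (k * (n + 1) + 1) := by
    intro α hα
    induction α with
    | nil => simp [encodeCNF]
    | cons c α ih =>
      have h3 := ih fun c hc => hα c (by simp [hc])
      have h4 := hα c (by simp)
      have h5 := h1 c h4.2
      have h6 : c.length * (n + 1) ≤ k * (n + 1) := Nat.mul_le_mul_right _ h4.1
      simp only [encodeCNF, List.flatMap_cons, List.length_append, List.length_cons,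
        List.length_nil] at h3 h5 ⊢
      nlinarith
  exact (h2 α hα.1).trans (Nat.mul_le_mul_right _ hα.2)

end Code

/-! ### Scans in which the end of a clause changes only the control state -/

namespace Code

section ScanPure

variable {KA X : Type} [DecidableEq KA] [Finite X] {Q : Type} [Finite Q] {a₀ : CNFSym ⊕ X}
  {act : Bool → CNFSym ⊕ X → CNFSym ⊕ X} {upd : Q → Bool → CNFSym ⊕ X → Q} {φ : Q → Q}
  {ω : ℕ → Bool} {s : Store KA (CNFSym ⊕ X)}

/-- The control state after scanning a formula if `φ` is applied at the end of each clause. -/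
def scanState (a₀ : CNFSym ⊕ X) (act : Bool → CNFSym ⊕ X → CNFSym ⊕ X)
    (upd : Q → Bool → CNFSym ⊕ X → Q) (φ : Q → Q) : CNF → Q → List (CNFSym ⊕ X) → Q
  | [], q, _ => q
  | c :: α, q, r =>
    scanState a₀ act upd φ α (φ (scanCtl a₀ act upd c q r)) (scanRow a₀ act c r)

theorem runs_scan_pure (α : CNF) (q : Q) (hs : s.inp = (encodeCNF α).map .inl) (ha : s.aux = []) :
    Runs (scan a₀ act upd (fun q => ret (φ q)) q) ω s (scanState a₀ act upd φ α q s.row)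
      { s with
        inp := []
        bak := ((encodeCNF α).map .inl).reverse ++ s.bak
        row := α.foldl (fun r c => scanRow a₀ act c r) s.row } (14 * (encodeCNF α).length + 3) := by
  induction α generalizing s q with
  | nil =>
    refine (runs_scan_nil (by simpa [encodeCNF] using hs)).congr rfl ?_ (by simp)
    simp only [encodeCNF, List.flatMap_nil, List.map_nil] at hs
    cases s
    simpa [encodeCNF] using hs
  | cons c α ih =>
    have h := ih (φ (scanCtl a₀ act upd c q s.row)) (s := { s with
      inp := (encodeCNF α).map .inl
      bak := ((c.flatMap encodeLiteral ++ [CNFSym.endClause]).map .inl).reverse ++ s.bak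
      row := scanRow a₀ act c s.row }) rfl ha
    refine (runs_scan_clause (fin := fun q => ret (φ q)) (c := c) (w := (encodeCNF α).map .inl)
      (by simpa [encodeCNF] using hs) ha (runs_ret _) h).congr rfl ?_ ?_
    · simp [encodeCNF]
    · simp [encodeCNF]; omega

end ScanPure

/-! ### Formulas with at most one literal per clause -/

/-- Fix the value of an unset variable. -/
def fixCell (b : Bool) : CNFSym ⊕ Empty → CNFSym ⊕ Empty
  | .inl .tick => .inl (.literal b)
  | a => a

open Classical in
/-- Record whether the clause has a literal, and whether no contradiction has been found. -/
def noteLiteral (q : Bool × Bool) (b : Bool) (a : CNFSym ⊕ Empty) : Bool × Bool :=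
  (true, q.2 && decide (a = .inl .tick ∨ a = .inl (.literal b)))

/-- Decide formulas with at most one literal per clause. -/
def unitSat : Code Empty Empty Bool :=
  (scan (.inl .tick) fixCell noteLiteral (fun q => ret (false, q.2 && q.1)) (false, true)).bind
    fun q => ret q.2

/-- The invariant of `unitSat` after the clauses `P` have been read. -/
structure UnitInv (P : CNF) (ok : Bool) (r : List (CNFSym ⊕ Empty)) : Prop where
  cell : ∀ i, r.getD i (.inl .tick) = .inl .tick ∨
    ∃ b, r.getD i (.inl .tick) = .inl (.literal b) ∧ [(i, b)] ∈ P
  sat : ok = true → ∀ c ∈ P, ∃ i b, c = [(i, b)] ∧ r.getD i (.inl .tick) = .inl (.literal b)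
  unsat : ok = false → ¬ CNF.Satisfiable P

theorem satisfiable_mono {P Q : CNF} (h : CNF.Satisfiable Q) (hPQ : P ⊆ Q) :
    CNF.Satisfiable P := by
  obtain ⟨x, hx⟩ := h
  exact ⟨x, fun c hc => hx c (hPQ hc)⟩

/-- A unit clause forces its variable. An unset cell takes the forced value, and a cell with the
same value is left alone. A cell with the other value was set by a unit clause of `P`, as `cell`
records, and that clause contradicts the new one. An empty clause is caught by the first flag, which
is still `false` at its end. -/
theorem UnitInv.step {P : CNF} {ok : Bool} {r : List (CNFSym ⊕ Empty)} (h : UnitInv P ok r)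
    {c : Clause} (hc : c.length ≤ 1) :
    UnitInv (P ++ [c])
      ((scanCtl (.inl .tick) fixCell noteLiteral c (false, ok) r).2 &&
        (scanCtl (.inl .tick) fixCell noteLiteral c (false, ok) r).1)
      (scanRow (.inl .tick) fixCell c r) := by
  match c, hc with
  | [], _ =>
    refine ⟨fun i => ?_, by simp [scanCtl], fun _ => ?_⟩
    · rcases h.cell i with h | ⟨b, h1, h2⟩
      · exact .inl h
      · exact .inr ⟨b, h1, by simp [h2]⟩
    · rintro ⟨x, hx⟩
      simpa using hx [] (by simp)
  | [(i, b)], _ =>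
    have hg := getD_touch (Sum.inl .tick : CNFSym ⊕ Empty) (fixCell b) i (r := r)
    simp only [scanCtl, noteLiteral, scanRow, List.foldl_cons, List.foldl_nil, Bool.and_true]
    rcases h.cell i with hi | ⟨b', hi, hP⟩
    · simp only [hi, fixCell] at hg
      refine ⟨fun j => ?_, fun hok c hc => ?_, fun hok => ?_⟩
      · rw [hg]
        split_ifs with hj
        · exact .inr ⟨b, rfl, by simp [hj]⟩
        · rcases h.cell j with h | ⟨b, h1, h2⟩
          · exact .inl h
          · exact .inr ⟨b, h1, by simp [h2]⟩
      · rw [List.mem_append, List.mem_singleton] at hc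
        rcases hc with hc | rfl
        · obtain ⟨j, b', h1, h2⟩ := h.sat (by simpa only [hi, true_or, decide_true, Bool.and_true] using hok) c hc
          refine ⟨j, b', h1, ?_⟩
          rw [hg, if_neg]
          · exact h2
          · rintro rfl
            rw [hi] at h2
            simp at h2
        · exact ⟨i, b, rfl, by rw [hg, if_pos rfl]⟩
      · exact fun hs => h.unsat
          (by simpa only [hi, true_or, decide_true, Bool.and_true] using hok) (satisfiable_mono hs (by simp))
    · simp only [hi, fixCell] at hg
      have hg' : ∀ j, (touch (Sum.inl .tick : CNFSym ⊕ Empty) (fixCell b) i r).getD j (.inl .tick)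
          = r.getD j (.inl .tick) := by
        intro j
        rw [hg]
        split_ifs with hj
        · rw [hj, hi]
        · rfl
      refine ⟨fun j => ?_, fun hok c hc => ?_, fun hok => ?_⟩
      · rw [hg']
        rcases h.cell j with h | ⟨b, h1, h2⟩
        · exact .inl h
        · exact .inr ⟨b, h1, by simp [h2]⟩
      · simp only [hi, Bool.and_eq_true, decide_eq_true_eq] at hok
        rw [List.mem_append, List.mem_singleton] at hc
        rcases hc with hc | rfl
        · obtain ⟨j, b', h1, h2⟩ := h.sat hok.1 c hc
          exact ⟨j, b', h1, by rw [hg', h2]⟩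
        · exact ⟨i, b, rfl, by rw [hg', hi]; simpa using hok.2⟩
      · simp only [hi, Bool.and_eq_false_iff, decide_eq_false_iff_not] at hok
        rcases hok with hok | hok
        · exact fun hs => h.unsat hok (satisfiable_mono hs (by simp))
        · rintro ⟨x, hx⟩
          have h1 : x i = b' := by simpa using hx [(i, b')] (by simp [hP])
          have h2 : x i = b := by simpa using hx [(i, b)] (by simp)
          exact hok (by simp [← h1, ← h2])

theorem UnitInv.scan {P : CNF} {ok : Bool} {r : List (CNFSym ⊕ Empty)} (h : UnitInv P ok r)
    {α : CNF} (hα : ∀ c ∈ α, c.length ≤ 1) :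
    UnitInv (P ++ α)
      (scanState (.inl .tick) fixCell noteLiteral (fun q => (false, q.2 && q.1)) α (false, ok) r).2
      (α.foldl (fun r c => scanRow (.inl .tick) fixCell c r) r) := by
  induction α generalizing P ok r with
  | nil => simpa [scanState] using h
  | cons c α ih =>
    have := ih (h.step (hα c (by simp))) fun c hc => hα c (by simp [hc])
    simpa [scanState] using this

theorem UnitInv.iff {P : CNF} {ok : Bool} {r : List (CNFSym ⊕ Empty)} (h : UnitInv P ok r) :
    ok = true ↔ CNF.Satisfiable P := by
  classical
  refine ⟨fun hok => ⟨fun i => decide (r.getD i (.inl .tick) = .inl (.literal true)), ?_⟩, ?_⟩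
  · intro c hc
    obtain ⟨i, b, rfl, hi⟩ := h.sat hok c hc
    refine ⟨(i, b), by simp, ?_⟩
    simp only [hi]
    cases b <;> simp
  · intro hs
    by_contra hok
    exact h.unsat (by simpa using hok) hs

theorem runs_unitSat {α : CNF} (hα : ∀ c ∈ α, c.length ≤ 1) (ω : ℕ → Bool) :
    ∃ b s', Runs unitSat ω (initStore Empty (encodeCNF α)) b s' (14 * (encodeCNF α).length + 5) ∧
      s'.ans = [] ∧ (b = true ↔ α.Satisfiable) := by
  have hI : UnitInv [] true [] := ⟨by simp, by simp, by simp⟩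
  have h := runs_scan_pure (a₀ := .inl .tick) (act := fixCell) (upd := noteLiteral)
    (φ := fun q => (false, q.2 && q.1)) (ω := ω) (s := initStore Empty (encodeCNF α)) α
    (false, true) rfl rfl
  have h' := Runs.bind (f := fun q : Bool × Bool => ret q.2) h (runs_ret _)
  exact ⟨_, _, h', rfl, (hI.scan hα).iff⟩

end Code

/-! ### Growth -/

theorem eventually_mul_pow_le (a j : ℕ) {u : ℝ} (hu : 0 < u) :
    ∀ᶠ n : ℕ in atTop, (a : ℝ) * ((n : ℝ) + 1) ^ j ≤ (2 : ℝ) ^ (u * (n : ℝ)) := by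
  have h := (isLittleO_pow_const_const_pow_of_one_lt (R := ℝ) j
    (Real.one_lt_rpow one_lt_two hu)).bound
    -- This constant absorbs the factor `a` and the passage from `n + 1` to `2 * n`.
    (c := 1 / ((a + 1) * 2 ^ j)) (by positivity)
  filter_upwards [h, eventually_ge_atTop 1] with n hn hn1
  have h1 : (1 : ℝ) ≤ n := by exact_mod_cast hn1
  rw [Real.norm_of_nonneg (by positivity), Real.norm_of_nonneg (by positivity),
    ← Real.rpow_natCast (2 ^ u), ← Real.rpow_mul zero_le_two, div_mul_eq_mul_div, one_mul,
    le_div_iff₀ (by positivity)] at hn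
  calc (a : ℝ) * ((n : ℝ) + 1) ^ j ≤ (a + 1) * (2 * n) ^ j := by gcongr <;> linarith
    _ = (n : ℝ) ^ j * ((a + 1) * 2 ^ j) := by ring
    _ ≤ _ := hn

theorem sTilde_le {k C : ℕ} {u : ℝ} (hu : 0 < u) {M : ProbMachine CNFSym Bool}
    (h : DecidesKSAT k M) (h' : M.RunsInExpTime (fun n => encodeCNF '' sparseKCNF k C n) u) :
    sTilde k C ≤ u :=
  csInf_le ⟨0, fun _ hs => hs.1.le⟩ ⟨hu, M, h, h'⟩

/-- Formulas with at most one literal per clause are decided in polynomial time, so every positive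
exponent is admissible. The case needs its own treatment because the reduction by networks requires
`k ≥ 2`. -/
theorem sTilde_one_le (C : ℕ) {u : ℝ} (hu : 0 < u) : sTilde 1 C ≤ u := by
  refine sTilde_le hu (M := Code.decider 1 Code.unitSat)
    (Code.decidesKSAT_decider_of_forall fun α hα ω => ?_)
    (Code.runsInExpTime_decider (B := fun n => 24 * (C * n * (1 * (n + 1) + 1)) + 12) (c := 1)
      (fun n α hα ω => ?_) ?_)
  · obtain ⟨b, s', h1, h2, h3⟩ := Code.runs_unitSat hα ω
    exact ⟨b, ⟨s', _, h1, h2⟩, h3⟩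
  · obtain ⟨b, s', h1, h2, -⟩ := Code.runs_unitSat (fun c hc => (hα.1 c hc).1) ω
    exact ⟨b, s', _, h1, h2, by have := Code.length_encodeCNF_le hα; omega⟩
  · filter_upwards [eventually_mul_pow_le (48 * C + 12) 2 hu] with n hn
    refine le_trans ?_ (hn.trans (one_mul _).ge)
    have : 24 * (C * n * (1 * (n + 1) + 1)) + 12 ≤ (48 * C + 12) * (n + 1) ^ 2 := by nlinarith
    exact_mod_cast this

/-! ### Exhaustive search -/

/-- The number with the given binary digits, least significant digit first. -/
def bitsValue : List Bool → ℕ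
  | [] => 0
  | b :: l => b.toNat + 2 * bitsValue l

/-- Add one to a number with a fixed number of binary digits; `none` on overflow. -/
def incBits : List Bool → Option (List Bool)
  | [] => none
  | false :: l => some (true :: l)
  | true :: l => (incBits l).map (false :: ·)

/-- Missing digits count as `false`, as missing variables do. Padding changes neither the number nor
the assignment, and lists with equal values give equal assignments. -/
theorem testBit_bitsValue (l : List Bool) (i : ℕ) :
    (bitsValue l).testBit i = l.getD i false := by
  induction l generalizing i with
  | nil => simp [bitsValue]
  | cons b l ih =>
    cases i with
    | zero => cases b <;> simp [bitsValue, Nat.testBit_zero, Nat.add_mod]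
    | succ i =>
      have h : (b.toNat + 2 * bitsValue l) / 2 = bitsValue l := by
        cases b <;> grind
      rw [Nat.testBit_succ, bitsValue, h, ih]
      simp

theorem bitsValue_lt (l : List Bool) : bitsValue l < 2 ^ l.length := by
  induction l with
  | nil => simp [bitsValue]
  | cons b l ih =>
    have := b.toNat_lt
    simp only [bitsValue, List.length_cons, pow_succ]
    omega

theorem incBits_eq_none {l : List Bool} (h : incBits l = none) :
    bitsValue l + 1 = 2 ^ l.length := by
  induction l with
  | nil => rfl
  | cons b l ih =>
    cases b with
    | false => simp [incBits] at h
    | true =>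
      have := ih (by simpa [incBits] using h)
      simp only [bitsValue, List.length_cons, pow_succ, Bool.toNat_true]
      omega

theorem incBits_eq_some {l l' : List Bool} (h : incBits l = some l') :
    bitsValue l' = bitsValue l + 1 ∧ l'.length = l.length := by
  induction l generalizing l' with
  | nil => simp [incBits] at h
  | cons b l ih =>
    cases b with
    | false =>
      simp only [incBits, Option.some.injEq] at h
      subst h
      simp [bitsValue]; omega
    | true =>
      simp only [incBits, Option.map_eq_some_iff] at h
      obtain ⟨l₁, h1, rfl⟩ := h
      have := ih h1
      simp only [bitsValue, Bool.toNat_true, Bool.toNat_false, List.length_cons]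
      omega

namespace Code

/-- The symbol for a truth value. -/
def bit (b : Bool) : CNFSym ⊕ Empty := .inl (.literal b)

open Classical in
/-- Record whether the clause has a true literal. -/
def noteTrue (q : Bool × Bool) (b : Bool) (a : CNFSym ⊕ Empty) : Bool × Bool :=
  (q.1 || decide (a = bit b), q.2)

/-- Evaluate the formula under the assignment in `row`. -/
def evaluate : Code Empty Empty (Bool × Bool) :=
  scan (bit false) (fun _ => id) noteTrue (fun q => ret (false, q.2 && q.1)) (false, true)

/-- Go on to the next assignment in `row`. -/
def nextRow : Code Empty Empty Bool :=
  loop (S := Unit) (fun _ => (pop .row).bind fun o =>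
    match o with
    | none => ret (.inr false)
    | some (.inl (.literal false)) => (push .row (bit true)).andThen <|
        (move .aux .row).andThen (ret (.inr true))
    | some _ => (push .aux (bit false)).andThen (ret (.inl ()))) ()

/-- Try all assignments. -/
def search : Code Empty Empty Bool :=
  loop (S := Unit) (fun _ => evaluate.bind fun q => (move .bak .inp).andThen <|
    if q.2 then ret (.inr true) else
      nextRow.bind fun ok => if ok then ret (.inl ()) else ret (.inr false)) ()

variable {ω : ℕ → Bool} {s : Store Empty (CNFSym ⊕ Empty)}

theorem runs_nextRow_some {l l' : List Bool} (hs : s.row = l.map bit) (h : incBits l = some l') :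
    Runs nextRow ω s true { s with row := s.aux.reverse ++ l'.map bit, aux := [] }
      (10 * l.length + 6 * s.aux.length + 8) := by
  induction l generalizing s l' with
  | nil => simp [incBits] at h
  | cons b l ih =>
    have h1 : s.get .row = bit b :: l.map bit := hs
    cases b with
    | false =>
      simp only [incBits, Option.some.injEq] at h
      subst h
      refine Runs.loop_exit (Runs.mono (T := 1 + (1 + (s.aux.length * 6 + 3 + 2))) ?_
        (by simp; omega))
      refine (runs_pop _).bind ?_
      rw [h1]
      refine (runs_push _ _).andThen <| (runs_move (by decide) (by decide) (by decide)).andThen <|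
        (runs_ret _).congr rfl ?_ le_rfl
      simp [Store.set, Store.get]
    | true =>
      simp only [incBits, Option.map_eq_some_iff] at h
      obtain ⟨l₁, h2, rfl⟩ := h
      have h3 := ih (s := { s with row := l.map bit, aux := bit false :: s.aux }) rfl h2
      refine (Runs.loop_again (T := 1 + (1 + 2)) ?_ h3).congr rfl (by simp) (by simp; omega)
      refine (runs_pop _).bind ?_
      rw [h1]
      exact (runs_push _ _).andThen (runs_ret _)

theorem runs_nextRow_none {l : List Bool} (hs : s.row = l.map bit) (h : incBits l = none) :
    ∃ s', Runs nextRow ω s false s' (4 * l.length + 3) ∧ s'.ans = s.ans := by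
  induction l generalizing s with
  | nil =>
    have h1 : s.get .row = [] := hs
    refine ⟨s.set .row (s.get .row).tail,
      Runs.loop_exit (Runs.mono (T := 1 + 2) ((runs_pop _).bind ?_) (by simp)), rfl⟩
    rw [h1]
    exact runs_ret _
  | cons b l ih =>
    have h1 : s.get .row = bit b :: l.map bit := hs
    cases b with
    | false => simp [incBits] at h
    | true =>
      obtain ⟨s', h3, h4⟩ := ih (s := { s with row := l.map bit, aux := bit false :: s.aux }) rfl
        (by simpa [incBits] using h)
      refine ⟨s', (Runs.loop_again (T := 1 + (1 + 2)) ?_ h3).mono (by simp; omega), h4⟩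
      refine (runs_pop _).bind ?_
      rw [h1]
      exact (runs_push _ _).andThen (runs_ret _)

/-- The assignment `l`, with all further variables false, satisfies `α`. -/
def SatBy (l : List Bool) (α : CNF) : Prop := ∀ c ∈ α, ∃ x ∈ c, l.getD x.1 false = x.2

/-- Reading a cell that does not exist writes the default back, so evaluation pads the assignment
with `false` just far enough to cover the variables of the clause. The search thus finds out the
number of variables by itself, and the last bound keeps it from inspecting more than needed. -/
theorem exists_scanRow_id (c : Clause) (l : List Bool) :
    ∃ l' : List Bool, scanRow (bit false) (fun _ => id) c (l.map bit) = l'.map bit ∧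
      (∀ i, l'.getD i false = l.getD i false) ∧ l.length ≤ l'.length ∧
      (∀ x ∈ c, x.1 < l'.length) ∧
      ∀ n, l.length ≤ n → (∀ x ∈ c, x.1 < n) → l'.length ≤ n := by
  have hmap : ∀ (i : ℕ) (l : List Bool),
      touch (bit false) id i (l.map bit) = (touch false id i l).map bit := by
    intro i
    induction i with
    | zero => intro l; cases l <;> simp [touch]
    | succ i ih =>
      intro l
      cases l with
      | nil => simpa [touch] using ih []
      | cons b l => simpa [touch] using ih l
  induction c generalizing l with
  | nil => exact ⟨l, rfl, by simp, le_rfl, by simp, fun n h _ => h⟩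
  | cons x c ih =>
    obtain ⟨l', h1, h2, h3, h4, h5⟩ := ih (touch false id x.1 l)
    simp only [length_touch] at h3 h5
    refine ⟨l', ?_, fun i => ?_, by omega, ?_, fun n hn hc => ?_⟩
    · rw [← h1, ← hmap]; rfl
    · rw [h2, getD_touch]
      split_ifs with h
      · rw [h]; rfl
      · rfl
    · simp only [List.mem_cons, forall_eq_or_imp]
      exact ⟨by omega, h4⟩
    · simp only [List.mem_cons, forall_eq_or_imp] at hc
      exact h5 n (by omega) hc.2

open Classical in
theorem scanCtl_noteTrue (c : Clause) (l : List Bool) (q : Bool × Bool) :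
    scanCtl (bit false) (fun _ => id) noteTrue c q (l.map bit) =
      (q.1 || c.any fun x => l.getD x.1 false == x.2, q.2) := by
  have key : ∀ (r : List (CNFSym ⊕ Empty)) (q : Bool × Bool),
      (∀ i, r.getD i (bit false) = bit (l.getD i false)) →
      scanCtl (bit false) (fun _ => id) noteTrue c q r =
        (q.1 || c.any fun x => l.getD x.1 false == x.2, q.2) := by
    induction c with
    | nil => intro r q _; simp [scanCtl]
    | cons x c ih =>
      intro r q hr
      rw [scanCtl, ih]
      · rw [noteTrue, hr]
        have : decide (bit (l.getD x.1 false) = bit x.2) = (l.getD x.1 false == x.2) := by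
          cases l.getD x.1 false <;> cases x.2 <;> simp [bit]
        simp only [this, List.any_cons, Bool.or_assoc]
      · intro i
        rw [getD_touch]
        split_ifs with h
        · rw [h, ← hr]; rfl
        · exact hr i
  refine key _ q fun i => ?_
  simp only [List.getD_eq_getElem?_getD, List.getElem?_map]
  cases l[i]? <;> rfl

theorem scanState_noteTrue (α : CNF) (l : List Bool) (q : Bool) :
    ∃ l' : List Bool,
      α.foldl (fun r c => scanRow (bit false) (fun _ => id) c r) (l.map bit) = l'.map bit ∧
      (∀ i, l'.getD i false = l.getD i false) ∧ l.length ≤ l'.length ∧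
      (∀ c ∈ α, ∀ x ∈ c, x.1 < l'.length) ∧
      (∀ n, l.length ≤ n → (∀ c ∈ α, ∀ x ∈ c, x.1 < n) → l'.length ≤ n) ∧
      ((scanState (bit false) (fun _ => id) noteTrue (fun q => (false, q.2 && q.1)) α (false, q)
        (l.map bit)).2 = true ↔ q = true ∧ SatBy l α) := by
  induction α generalizing l q with
  | nil => exact ⟨l, rfl, by simp, le_rfl, by simp, fun n h _ => h, by simp [scanState, SatBy]⟩
  | cons c α ih =>
    obtain ⟨l₁, h1, h2, h3, h4, h5⟩ := exists_scanRow_id c l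
    obtain ⟨l', e1, e2, e3, e4, e5, e6⟩ := ih l₁ (q && c.any fun x => l.getD x.1 false == x.2)
    refine ⟨l', ?_, fun i => (e2 i).trans (h2 i), h3.trans e3, ?_, fun n hn hc => ?_, ?_⟩
    · rw [List.foldl_cons, h1, e1]
    · simp only [List.mem_cons, forall_eq_or_imp]
      exact ⟨fun x hx => (h4 x hx).trans_le e3, e4⟩
    · simp only [List.mem_cons, forall_eq_or_imp] at hc
      exact e5 n (h5 n hn hc.1) hc.2
    · rw [scanState, scanCtl_noteTrue, h1]
      simp only [Bool.false_or]
      rw [e6]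
      have : SatBy l₁ α ↔ SatBy l α := by simp only [SatBy, h2]
      rw [this]
      simp only [SatBy, List.mem_cons, forall_eq_or_imp, Bool.and_eq_true, List.any_eq_true,
        beq_iff_eq, and_assoc]

/-- Assignments are tried in the order of the numbers they represent. The bound `f` limits the
rounds left, and `hmin` says that no smaller number satisfies the formula. A round succeeds,
overflows, or raises the number by one. -/
theorem runs_search {α : CNF} {n : ℕ} (hα : ∀ c ∈ α, ∀ x ∈ c, x.1 < n) (f : ℕ) {l : List Bool}
    (hinp : s.inp = (encodeCNF α).map .inl) (hbak : s.bak = []) (haux : s.aux = [])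
    (hrow : s.row = l.map bit) (hl : l.length ≤ n) (hf : 2 ^ n ≤ bitsValue l + f)
    (hmin : ∀ l', SatBy l' α → bitsValue l ≤ bitsValue l') :
    ∃ b s', Runs search ω s b s' (f * (20 * (encodeCNF α).length + 10 * n + 20)) ∧
      s'.ans = s.ans ∧ (b = true ↔ α.Satisfiable) := by
  induction f generalizing s l with
  | zero =>
    have := bitsValue_lt l
    have := Nat.pow_le_pow_right (n := 2) (by norm_num) hl
    omega
  | succ f ih =>
    obtain ⟨l', e1, e2, e3, e4, e5, e6⟩ := scanState_noteTrue α l true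
    have hev := runs_scan_pure (a₀ := bit false) (act := fun _ => id) (upd := noteTrue)
      (φ := fun q => (false, q.2 && q.1)) (ω := ω) (s := s) α (false, true) hinp haux
    set q := scanState (bit false) (fun _ => id) noteTrue (fun q => (false, q.2 && q.1)) α
      (false, true) s.row with hq
    rw [← hrow] at e1 e6
    rw [← hq] at e6
    rw [e1] at hev
    have hl' : l'.length ≤ n := e5 n hl hα
    -- Evaluation only pads the assignment, so the number that measures progress is unchanged.
    have hval : bitsValue l' = bitsValue l :=
      Nat.eq_of_testBit_eq fun i => by rw [testBit_bitsValue, testBit_bitsValue, e2]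
    have hmove := runs_move (ω := ω) (src := .bak) (dst := .inp) (s := { s with
        inp := []
        bak := ((encodeCNF α).map .inl).reverse ++ s.bak
        row := l'.map bit }) (by decide) (by decide) (by decide)
    have hmove' : Runs (move .bak .inp) ω { s with
        inp := []
        bak := ((encodeCNF α).map .inl).reverse ++ s.bak
        row := l'.map bit } () { s with row := l'.map bit } (6 * (encodeCNF α).length + 3) := by
      refine hmove.congr rfl ?_ ?_
      · simp [Store.set, Store.get, hbak, hinp]
      · simp [Store.get, hbak]; omega
    rcases hq2 : q.2 with _ | _
    · have hns : ¬ SatBy l α := fun h => by simp [e6.2 ⟨rfl, h⟩] at hq2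
      rcases hinc : incBits l' with _ | l₁
      · obtain ⟨s', h1, h2⟩ := runs_nextRow_none (ω := ω) (s := { s with row := l'.map bit }) rfl
          hinc
        refine ⟨false, s', (Runs.loop_exit (hev.bind
          (hmove'.andThen (T' := 4 * n + 5) ?_))).mono ?_, h2, ?_⟩
        · rw [hq2, if_neg (by simp)]
          refine Runs.mono (T := 4 * l'.length + 3 + 2) ?_ (by omega)
          exact h1.bind (runs_ret _)
        · nlinarith
        · simp only [Bool.false_eq_true, false_iff]
          rintro ⟨x, hx⟩
          -- The satisfying assignment cut down to the cells of `row`, which cover all variables of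
          -- the formula. On overflow the current assignment is all ones, the largest number of this
          -- length, so `hmin` makes the two coincide, although the current one was just refuted.
          set l'' := (List.range l'.length).map x with hl''
          have hsat : SatBy l'' α := by
            intro c hc
            obtain ⟨y, hy, hxy⟩ := hx c hc
            exact ⟨y, hy, by simp [hl'', e4 c hc y hy, hxy]⟩
          have h3 := hmin _ hsat
          have h4 : bitsValue l'' < 2 ^ l'.length := (bitsValue_lt l'').trans_eq (by simp [hl''])
          have h5 := incBits_eq_none hinc
          refine hns fun c hc => ?_
          obtain ⟨y, hy, hxy⟩ := hsat c hc
          refine ⟨y, hy, ?_⟩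
          rw [← hxy, ← testBit_bitsValue, ← testBit_bitsValue]
          congr 1
          omega
      · obtain ⟨h1, h2⟩ := incBits_eq_some hinc
        have h3 := runs_nextRow_some (ω := ω) (s := { s with row := l'.map bit }) rfl hinc
        obtain ⟨b, s', h4, h5, h6⟩ := ih (s := { s with row := l₁.map bit }) (l := l₁) hinp hbak
          haux rfl (by omega) (by omega) (by
            intro l'' hsat
            have := hmin l'' hsat
            rcases this.lt_or_eq with h | h
            · omega
            · refine absurd (fun c hc => ?_) hns
              obtain ⟨y, hy, hxy⟩ := hsat c hc
              exact ⟨y, hy, by rw [← hxy, ← testBit_bitsValue, ← testBit_bitsValue, h]⟩)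
        refine ⟨b, s', (Runs.loop_again (hev.bind (hmove'.andThen (T' := 10 * n + 10) ?_)) h4).mono
          ?_, h5, h6⟩
        · rw [hq2, if_neg (by simp)]
          refine Runs.mono (T := 10 * l'.length + 6 * s.aux.length + 8 + 2) ?_
            (by simp [haux]; omega)
          refine h3.bind ((runs_ret _).congr rfl ?_ le_rfl)
          simp [haux]
        · nlinarith
    · refine ⟨true, { s with row := l'.map bit },
        (Runs.loop_exit (hev.bind (hmove'.andThen (T' := 2) ?_))).mono ?_, rfl, ?_⟩
      · rw [hq2, if_pos rfl]
        exact runs_ret _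
      · nlinarith
      · simp only [true_iff]
        exact ⟨fun i => l.getD i false, (e6.1 hq2).2⟩

theorem runs_search_init {α : CNF} {n : ℕ} (hα : ∀ c ∈ α, ∀ x ∈ c, x.1 < n) (ω : ℕ → Bool) :
    ∃ b s', Runs search ω (initStore Empty (encodeCNF α)) b s'
      (2 ^ n * (20 * (encodeCNF α).length + 10 * n + 20)) ∧
      s'.ans = [] ∧ (b = true ↔ α.Satisfiable) :=
  runs_search hα (2 ^ n) (l := []) rfl rfl rfl rfl (by simp) (by simp) (by simp [bitsValue])

end Code

/-- Exhaustive search takes `2 ^ n` times a polynomial. The bound is needed with `u = δ`, to see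
that the tolerance in the theorem is below the gap. -/
theorem sTilde_le_one_add (k C : ℕ) {u : ℝ} (hu : 0 < u) : sTilde k C ≤ 1 + u := by
  refine sTilde_le (by positivity) (M := Code.decider k Code.search)
    (Code.decidesKSAT_decider_of_forall fun α hα ω => ?_)
    (Code.runsInExpTime_decider
      (B := fun n => 10 * (C * n * (k * (n + 1) + 1)) + 7 +
        2 ^ n * (20 * (C * n * (k * (n + 1) + 1)) + 10 * n + 20)) (c := 1)
      (fun n α hα ω => ?_) ?_)
  · obtain ⟨n, hn⟩ := exists_mem_kCNF hα
    obtain ⟨b, s', h1, h2, h3⟩ := Code.runs_search_init (fun c hc => (hn c hc).2) ω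
    exact ⟨b, ⟨s', _, h1, h2⟩, h3⟩
  · obtain ⟨b, s', h1, h2, -⟩ := Code.runs_search_init (fun c hc => (hα.1 c hc).2) ω
    refine ⟨b, s', _, h1, h2, ?_⟩
    have := Code.length_encodeCNF_le hα
    gcongr
  · filter_upwards [eventually_mul_pow_le (30 * (C * (k + 1)) + 40) 2 hu] with n hn
    have h1 : 10 * (C * n * (k * (n + 1) + 1)) + 7 +
        2 ^ n * (20 * (C * n * (k * (n + 1) + 1)) + 10 * n + 20) ≤
        2 ^ n * ((30 * (C * (k + 1)) + 40) * (n + 1) ^ 2) := by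
      have h2 : C * n * (k * (n + 1) + 1) ≤ C * (k + 1) * (n + 1) ^ 2 := by
        calc C * n * (k * (n + 1) + 1) ≤ C * (n + 1) * (k * (n + 1) + (n + 1)) := by gcongr <;> omega
          _ = _ := by ring
      have h3 : 1 ≤ 2 ^ n := Nat.one_le_two_pow
      have h4 : n ≤ (n + 1) ^ 2 := by nlinarith
      have h5 : 1 ≤ (n + 1) ^ 2 := by nlinarith
      generalize (n + 1) ^ 2 = N at *
      generalize C * n * (k * (n + 1) + 1) = A at *
      have h6 : 10 * A + 7 ≤ 2 ^ n * (10 * A + 7) := Nat.le_mul_of_pos_left _ h3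
      calc _ ≤ 2 ^ n * (10 * A + 7) + 2 ^ n * (20 * A + 10 * n + 20) := by gcongr
        _ = 2 ^ n * (30 * A + 10 * n + 27) := by ring
        _ ≤ _ := by gcongr; nlinarith
    rw [one_mul, add_mul, Real.rpow_add two_pos, one_mul, Real.rpow_natCast]
    calc _ ≤ ((2 ^ n * ((30 * (C * (k + 1)) + 40) * (n + 1) ^ 2) : ℕ) : ℝ) := by exact_mod_cast h1
      _ = 2 ^ n * (((30 * (C * (k + 1)) + 40 : ℕ) : ℝ) * ((n : ℝ) + 1) ^ 2) := by push_cast; ring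
      _ ≤ _ := by gcongr

/-! ### The network of a formula -/

section ListLemmas

variable {α β : Type}

theorem List.flatten_ofFn_get (l : List α) (g : α → List β) :
    (List.ofFn fun c : Fin l.length => g (l.get c)).flatten = l.flatMap g := by
  have h : (List.ofFn fun c : Fin l.length => g (l.get c)) = l.map g :=
    List.ext_getElem (by simp) (by simp)
  rw [h, List.flatMap_def]

theorem List.flatten_ofFn_val (n : ℕ) (g : ℕ → List β) :
    (List.ofFn fun c : Fin n => g c).flatten = (List.range n).flatMap g := by
  have h : (List.ofFn fun c : Fin n => g c) = (List.range n).map g :=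
    List.ext_getElem (by simp) (by simp)
  rw [h, List.flatMap_def]

theorem List.flatten_ofFn_map {n : ℕ} (f : Fin n → α) (g : α → List β) :
    (List.ofFn fun c => g (f c)).flatten = (List.ofFn f).flatMap g := by
  rw [List.flatMap_def, List.map_ofFn]; rfl

/-- The neurons of parallel copies are indexed by one `Fin (m * n)`: the quotient is the copy, the
remainder the neuron in it. In this order a layer is written copy by copy. -/
theorem List.ofFn_divNat_modNat {m n : ℕ} (f : Fin m → Fin n → α) :
    (List.ofFn fun z : Fin (m * n) => f z.divNat z.modNat) =
      (List.ofFn fun c => List.ofFn fun i => f c i).flatten := by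
  rw [List.ofFn_mul]
  congr 1
  refine congrArg List.ofFn (funext fun c => congrArg List.ofFn (funext fun i => ?_))
  have hn : 0 < n := i.pos
  congr 1
  · ext
    simp only [Fin.coe_divNat]
    rw [Nat.add_comm, Nat.add_mul_div_right _ _ hn, Nat.div_eq_of_lt i.2, Nat.zero_add]
  · ext
    simp [Fin.modNat, Nat.mod_eq_of_lt i.2]

theorem List.ofFn_ite_eq {n : ℕ} (c : Fin n) (x y : α) :
    (List.ofFn fun c' : Fin n => if c = c' then x else y) =
      List.replicate c y ++ [x] ++ List.replicate (n - 1 - c) y := by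
  refine List.ext_getElem (by simp; omega) fun i h1 h2 => ?_
  simp only [List.getElem_ofFn, List.getElem_append, List.getElem_replicate, List.length_append,
    List.length_replicate, List.length_singleton, List.getElem_singleton, Fin.ext_iff]
  split_ifs <;> first | rfl | omega

end ListLemmas

/-- The element `x` of `θ`. -/
def toWeight (θ : Finset ℝ) [Inhabited θ] (x : ℝ) : θ := if h : x ∈ θ then ⟨x, h⟩ else default

theorem coe_toWeight {θ : Finset ℝ} [Inhabited θ] {x : ℝ} (h : x ∈ θ) : (toWeight θ x : ℝ) = x := by
  simp [toWeight, h]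

/-- The sign of a block. -/
def blockSign (b : Bool) : ℝ := if b then 1 else -1

namespace Net

variable {θr : Finset ℝ} (θ : Finset ℝ) [Inhabited θ]

/-- A network with weights in `θr` as a network with weights in `θ`. -/
def lift : {m : ℕ} → Net θr m → Net θ m
  | _, .last W b => .last (fun j => toWeight θ (W j)) (toWeight θ b)
  | _, .layer W b rest =>
      layer (.of fun i j => toWeight θ (W i j)) (fun i => toWeight θ (b i)) rest.lift

/-- Run `B` copies of a network side by side, add up the results with signs, and feed one plus the
sum into the network with first layer `W₁`, `b₁`, and further layers `tail`. -/
def parallel {B p : ℕ} (sg : Fin B → Bool) (W₁ : Matrix (Fin p) (Fin 1) θr) (b₁ : Fin p → θr)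
    (tail : Net θr p) : {q : ℕ} → Net θr q → Net θ (B * q)
  -- The bias of the copies is dropped, since it cancels when the signs sum to zero. The affine
  -- output of the copies is multiplied into the first layer of the outer network, and the added one
  -- turns into the summand `W₁ i 0` of the bias.
  | _, .last W _ =>
      .layer (.of fun i z => toWeight θ (blockSign (sg z.divNat) * W₁ i 0 * W z.modNat))
        (fun i => toWeight θ (W₁ i 0 + b₁ i)) (tail.lift θ)
  | _, .layer (p := p') W b rest =>
      .layer (p := B * p')
        (.of fun y z => if y.divNat = z.divNat then toWeight θ (W y.modNat z.modNat) else toWeight θ 0)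
        (fun y => toWeight θ (b y.modNat)) (parallel sg W₁ b₁ tail rest)

/-- Affine forms with integer coefficients. -/
abbrev Form (m : ℕ) := (Fin m → ℤ) × ℤ

/-- The value of an affine form. -/
def Form.eval {m : ℕ} (f : Form m) (x : Fin m → ℝ) : ℝ := ∑ v, (f.1 v : ℝ) * x v + f.2

/-- Apply a network to one plus the signed sum of its values at affine forms. -/
def ofForms {m p : ℕ} (items : List (Bool × Form m)) (W₁ : Matrix (Fin p) (Fin 1) θr)
    (b₁ : Fin p → θr) (rest : Net θr p) : Net θ m :=
  .layer (p := items.length * p)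
    (.of fun y v => toWeight θ ((items.get y.divNat).2.1 v * W₁ y.modNat 0))
    (fun y => toWeight θ ((items.get y.divNat).2.2 * W₁ y.modNat 0 + b₁ y.modNat))
    (parallel θ (fun c => (items.get c).1) W₁ b₁ rest rest)

variable {θ}

/-! ### Values, depth and width of the parallel network -/

section Realize

variable {σ : ℝ → ℝ} {k : ℕ}

omit [Inhabited θ] in
theorem mem_of_cnfWeights (hθ : cnfWeights k θr ⊆ (θ : Set ℝ)) {j : ℤ} (hj : |j| ≤ (k : ℤ))
    {a b c : ℝ} (ha : a ∈ (θr : Set ℝ) ∪ {-1, 0, 1}) (hb : b ∈ (θr : Set ℝ) ∪ {-1, 0, 1})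
    (hc : c ∈ (θr : Set ℝ) ∪ {-1, 0, 1}) : j * a * b + c ∈ θ :=
  hθ ⟨j, hj, a, ha, b, hb, c, hc, rfl⟩

omit [Inhabited θ] in
theorem mem_of_mem (hθ : cnfWeights k θr ⊆ (θ : Set ℝ)) (a : θr) : (a : ℝ) ∈ θ := by
  simpa using mem_of_cnfWeights hθ (j := 0) (by simp) (a := 0) (b := 0) (by simp) (by simp)
    (.inl a.2)

omit [Inhabited θ] in
theorem zero_mem_of (hθ : cnfWeights k θr ⊆ (θ : Set ℝ)) : (0 : ℝ) ∈ θ := by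
  simpa using mem_of_cnfWeights hθ (j := 0) (by simp) (a := 0) (b := 0) (c := 0) (by simp)
    (by simp) (by simp)

omit [Inhabited θ] in
theorem realize_layer {m p : ℕ} (W : Matrix (Fin p) (Fin m) θ) (b : Fin p → θ) (rest : Net θ p)
    (x : Fin m → ℝ) : (layer W b rest).realize σ x =
      rest.realize σ fun i => σ (∑ j, (W i j : ℝ) * x j + (b i : ℝ)) := rfl

theorem realize_lift (hθ : cnfWeights k θr ⊆ (θ : Set ℝ)) {m : ℕ} (Φ : Net θr m) (x : Fin m → ℝ) :
    (Φ.lift θ).realize σ x = Φ.realize σ x := by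
  induction Φ with
  | last W b => simp [lift, realize, coe_toWeight (mem_of_mem hθ _)]
  | layer W b rest ih => simp [lift, realize, coe_toWeight (mem_of_mem hθ _), ih]

theorem sum_divNat_modNat {B q : ℕ} (f : Fin B → Fin q → ℝ) :
    ∑ z : Fin (B * q), f z.divNat z.modNat = ∑ c, ∑ j, f c j := by
  rw [← Fintype.sum_prod_type' f]
  exact finProdFinEquiv.symm.sum_comp fun x : Fin B × Fin q => f x.1 x.2

/-- In the hidden layers the zero blocks keep the copies apart. In the merged layer `hsg` cancels
the common output bias of the copies, so each weight is a signed product of two elements of `θr` and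
each bias a sum of two. This is what `cnfWeights` provides. -/
theorem realize_parallel (hθ : cnfWeights k θr ⊆ (θ : Set ℝ)) (hk : 1 ≤ k) {B p : ℕ}
    (sg : Fin B → Bool) (hsg : ∑ c, blockSign (sg c) = 0)
    (W₁ : Matrix (Fin p) (Fin 1) θr) (b₁ : Fin p → θr) (tail : Net θr p) {q : ℕ} (Φ : Net θr q)
    (x : Fin B → Fin q → ℝ) :
    (parallel θ sg W₁ b₁ tail Φ).realize σ (fun z => x z.divNat z.modNat) =
      (Net.layer W₁ b₁ tail).realize σ
        (fun _ => 1 + ∑ c, blockSign (sg c) * Φ.realize σ (x c)) := by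
  induction Φ with
  | last W b =>
    have hw : ∀ (s : Bool) (a b : θr), blockSign s * (a : ℝ) * b ∈ θ := by
      intro s a b
      have hk' : (1 : ℤ) ≤ k := by exact_mod_cast hk
      cases s
      · simpa [blockSign] using mem_of_cnfWeights hθ (j := -1) (by simpa using hk') (c := 0)
          (.inl a.2) (.inl b.2) (by simp)
      · simpa [blockSign] using mem_of_cnfWeights hθ (j := 1) (by simpa using hk') (c := 0)
          (.inl a.2) (.inl b.2) (by simp)
    have hb : ∀ a b : θr, (a : ℝ) + b ∈ θ := by
      intro a b
      have hk' : (1 : ℤ) ≤ k := by exact_mod_cast hk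
      simpa using mem_of_cnfWeights hθ (j := 1) (by simpa using hk') (b := 1)
        (.inl a.2) (by simp) (.inl b.2)
    refine (realize_layer _ _ _ _).trans ?_
    refine Eq.trans (realize_lift hθ _ _) ?_
    refine congrArg (tail.realize σ) (funext fun i => congrArg σ ?_)
    have h : ∀ z : Fin (B * _), ((toWeight θ (blockSign (sg z.divNat) * W₁ i 0 * W z.modNat) : θ) : ℝ)
        * x z.divNat z.modNat =
        (fun c j => blockSign (sg c) * (W₁ i 0 : ℝ) * W j * x c j) z.divNat z.modNat := by
      intro z
      rw [coe_toWeight (hw _ _ _)]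
    refine (congrArg₂ (· + ·) ((Finset.sum_congr rfl fun z _ => h z).trans
      (sum_divNat_modNat fun c j => blockSign (sg c) * (W₁ i 0 : ℝ) * W j * x c j))
      (coe_toWeight (hb _ _))).trans ?_
    simp only [Finset.univ_unique, Finset.sum_singleton]
    generalize ((W₁ i 0 : θr) : ℝ) = w
    have e : ∑ c, blockSign (sg c) * (∑ j, (W j : ℝ) * x c j + b) =
        ∑ c, blockSign (sg c) * ∑ j, (W j : ℝ) * x c j := by
      simp only [mul_add, Finset.sum_add_distrib, ← Finset.sum_mul, hsg, zero_mul, add_zero]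
    have e' : ∑ c, ∑ j, blockSign (sg c) * w * W j * x c j =
        w * ∑ c, blockSign (sg c) * ∑ j, (W j : ℝ) * x c j := by
      simp only [Finset.mul_sum]
      exact Finset.sum_congr rfl fun c _ => Finset.sum_congr rfl fun j _ => by ring
    change _ = w * (1 + ∑ c, blockSign (sg c) * (∑ j, (W j : ℝ) * x c j + b)) + _
    rw [e, e']
    ring
  | layer W b rest ih =>
    refine (realize_layer _ _ _ _).trans (Eq.trans ?_
      (ih fun c i => σ (∑ j, (W i j : ℝ) * x c j + (b i : ℝ))))
    refine congrArg (realize σ _) (funext fun y => congrArg σ ?_)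
    have h : ∀ z : Fin (B * _), ((if y.divNat = z.divNat then toWeight θ (W y.modNat z.modNat)
        else toWeight θ 0 : θ) : ℝ) * x z.divNat z.modNat =
        (fun c j => if y.divNat = c then (W y.modNat j : ℝ) * x c j else 0) z.divNat z.modNat := by
      intro z
      dsimp only
      split_ifs
      · rw [coe_toWeight (mem_of_mem hθ _)]
      · rw [coe_toWeight (zero_mem_of hθ), zero_mul]
    refine congrArg₂ (· + ·) (((Finset.sum_congr rfl fun z _ => h z).trans
      (sum_divNat_modNat fun c j => if y.divNat = c then (W y.modNat j : ℝ) * x c j else 0)).trans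
        ?_) (coe_toWeight (mem_of_mem hθ _))
    simp only [Finset.sum_ite_irrel, Finset.sum_const_zero, Finset.sum_ite_eq, Finset.mem_univ,
      if_true]

/-- The affine forms get no layer of their own: they are composed with the affine part of the first
layer of each copy. The weights become `j * a` and the biases `j * a + b` with `|j| ≤ k`. -/
theorem realize_ofForms (hθ : cnfWeights k θr ⊆ (θ : Set ℝ)) (hk : 1 ≤ k) {m p : ℕ}
    (items : List (Bool × Form m))
    (hitems : ∀ f ∈ items, (∀ v, |f.2.1 v| ≤ (k : ℤ)) ∧ |f.2.2| ≤ (k : ℤ))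
    (hsg : (items.map fun f => blockSign f.1).sum = 0)
    (W₁ : Matrix (Fin p) (Fin 1) θr) (b₁ : Fin p → θr) (rest : Net θr p) (x : Fin m → ℝ) :
    (ofForms θ items W₁ b₁ rest).realize σ x =
      (Net.layer W₁ b₁ rest).realize σ fun _ => 1 + (items.map fun f =>
        blockSign f.1 * (Net.layer W₁ b₁ rest).realize σ fun _ => f.2.eval x).sum := by
  have hsum : ∀ g : Bool × Form m → ℝ, (items.map g).sum = ∑ c, g (items.get c) := by
    intro g
    rw [← List.sum_ofFn]
    exact congrArg List.sum (List.ext_getElem (by simp) (by simp))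
  rw [hsum] at hsg ⊢
  refine (realize_layer _ _ _ _).trans (Eq.trans ?_ (realize_parallel hθ hk
    (fun c => (items.get c).1) hsg W₁ b₁ rest rest fun c i =>
      σ (∑ j, (W₁ i j : ℝ) * (items.get c).2.eval x + (b₁ i : ℝ))))
  · refine congrArg (realize σ _) (funext fun y => congrArg σ ?_)
    have hw : ∀ (j : ℤ) (a : θr), |j| ≤ (k : ℤ) → (j : ℝ) * a ∈ θ := by
      intro j a hj
      simpa using mem_of_cnfWeights hθ hj (b := 1) (c := 0) (.inl a.2) (by simp) (by simp)
    have hb : ∀ (j : ℤ) (a b : θr), |j| ≤ (k : ℤ) → (j : ℝ) * a + b ∈ θ := by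
      intro j a b hj
      simpa using mem_of_cnfWeights hθ hj (b := 1) (.inl a.2) (by simp) (.inl b.2)
    have hmem := hitems _ (List.get_mem items y.divNat)
    have h : ∀ v, ((toWeight θ ((items.get y.divNat).2.1 v * W₁ y.modNat 0) : θ) : ℝ) * x v =
        W₁ y.modNat 0 * ((items.get y.divNat).2.1 v * x v) := by
      intro v
      rw [coe_toWeight (hw _ _ (hmem.1 v))]
      ring
    refine (congrArg₂ (· + ·) ((Finset.sum_congr rfl fun v _ => h v).trans
      (Finset.mul_sum _ _ _).symm) (coe_toWeight (hb _ _ _ hmem.2))).trans ?_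
    rw [Finset.univ_unique (α := Fin 1), Finset.sum_singleton, Form.eval]
    change _ = (W₁ y.modNat 0 : ℝ) * _ + _
    ring

theorem depth_lift {m : ℕ} (Φ : Net θr m) : (Φ.lift θ).depth = Φ.depth := by
  induction Φ with
  | last W b => rfl
  | layer W b rest ih => exact congrArg (· + 1) ih

theorem depth_parallel {B p q : ℕ} (sg : Fin B → Bool) (W₁ : Matrix (Fin p) (Fin 1) θr)
    (b₁ : Fin p → θr) (tail : Net θr p) (Φ : Net θr q) :
    (parallel θ sg W₁ b₁ tail Φ).depth = Φ.depth + tail.depth := by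
  induction Φ with
  | last W b => simp [parallel, depth, depth_lift]; omega
  | layer W b rest ih => simp [parallel, depth, ih]; omega

/-- Inner and outer network both have `rest.depth + 1` layers, and the last inner layer is fused
with the first outer one. -/
theorem depth_ofForms {m p : ℕ} (items : List (Bool × Form m)) (W₁ : Matrix (Fin p) (Fin 1) θr)
    (b₁ : Fin p → θr) (rest : Net θr p) :
    (ofForms θ items W₁ b₁ rest).depth = 2 * rest.depth + 1 := by
  simp [ofForms, depth, depth_parallel]; omega

theorem widthLE_lift {m w w' : ℕ} {Φ : Net θr m} (h : Φ.WidthLE w) (hw : w ≤ w') :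
    (Φ.lift θ).WidthLE w' := by
  induction Φ with
  | last W b => exact ⟨⟨h.1.1, h.1.2.trans hw⟩, h.2.trans hw⟩
  | layer W b rest ih => exact ⟨⟨h.1.1, h.1.2.trans hw⟩, ih h.2⟩

theorem widthLE_parallel {B p q w w' : ℕ} (sg : Fin B → Bool) (W₁ : Matrix (Fin p) (Fin 1) θr)
    (b₁ : Fin p → θr) {tail : Net θr p} {Φ : Net θr q} (hB : 1 ≤ B) (hw : B * w ≤ w')
    (ht : tail.WidthLE w) (hΦ : Φ.WidthLE w) : (parallel θ sg W₁ b₁ tail Φ).WidthLE w' := by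
  have hw' : w ≤ w' := (Nat.le_mul_of_pos_left w hB).trans hw
  induction Φ with
  | last W b =>
    exact ⟨⟨Nat.mul_pos hB hΦ.1.1, (Nat.mul_le_mul_left B hΦ.1.2).trans hw⟩, widthLE_lift ht hw'⟩
  | layer W b rest ih =>
    exact ⟨⟨Nat.mul_pos hB hΦ.1.1, (Nat.mul_le_mul_left B hΦ.1.2).trans hw⟩, ih hΦ.2⟩

theorem widthLE_ofForms {m p w w' : ℕ} {items : List (Bool × Form m)}
    (W₁ : Matrix (Fin p) (Fin 1) θr) (b₁ : Fin p → θr) {rest : Net θr p}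
    (hm : 1 ≤ m) (hm' : m ≤ w') (hB : 1 ≤ items.length) (hw : items.length * w ≤ w')
    (h : rest.WidthLE w) : (ofForms θ items W₁ b₁ rest).WidthLE w' :=
  ⟨⟨hm, hm'⟩, widthLE_parallel _ W₁ b₁ hB hw h h⟩

end Realize

/-! ### The words of the layers of the parallel network -/

section Encode

/-- The word of a block diagonal layer with `B` equal blocks, given by the words of the rows and of
the biases; `Z` is the word of a row of a zero block. -/
def blockWord {α : Type} (B : ℕ) (Z : List α) (rows : List (List α × List α)) : List α :=
  (List.range B).flatMap fun c => rows.flatMap fun R =>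
    (List.replicate c Z).flatten ++ R.1 ++ (List.replicate (B - 1 - c) Z).flatten ++ R.2

/-- The rows and biases of a layer as words. -/
def layerRows {p q : ℕ} (W : Matrix (Fin p) (Fin q) θr) (b : Fin p → θr) :
    List (List (NetSym θ) × List (NetSym θ)) :=
  List.ofFn fun i => (List.ofFn fun j => NetSym.weight (toWeight θ (W i j)),
    [NetSym.weight (toWeight θ (b i)), NetSym.endNeuron])

/-- In a row of copy `c` the block of weights stands after `c` zero blocks and before `B - 1 - c`
zero blocks. In this form a machine can write the layer with two unary counters. -/
theorem encodeNet_parallel_layer {B p q p' : ℕ} (sg : Fin B → Bool)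
    (W₁ : Matrix (Fin p) (Fin 1) θr) (b₁ : Fin p → θr) (tail : Net θr p)
    (W : Matrix (Fin p') (Fin q) θr) (b : Fin p' → θr) (rest : Net θr p') :
    encodeNet (parallel θ sg W₁ b₁ tail (.layer W b rest)) =
      blockWord B (List.replicate q (NetSym.weight (toWeight θ 0))) (layerRows W b) ++
        [NetSym.endLayer] ++ encodeNet (parallel θ sg W₁ b₁ tail rest) := by
  refine congrArg (· ++ [NetSym.endLayer] ++ encodeNet (parallel θ sg W₁ b₁ tail rest)) ?_
  refine (congrArg List.flatten (List.ofFn_divNat_modNat fun (c : Fin B) (i : Fin p') =>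
    (List.ofFn fun z : Fin (B * q) => NetSym.weight (if c = z.divNat then
      toWeight θ (W i z.modNat) else toWeight θ 0)) ++
      [NetSym.weight (toWeight θ (b i)), NetSym.endNeuron])).trans ?_
  rw [List.flatten_flatten, List.map_ofFn, blockWord, ← List.flatten_ofFn_val]
  refine congrArg List.flatten (congrArg List.ofFn (funext fun c => ?_))
  rw [layerRows, ← List.flatten_ofFn_map]
  refine congrArg List.flatten (congrArg List.ofFn (funext fun i => ?_))
  have h := List.ofFn_divNat_modNat fun (c' : Fin B) (j : Fin q) =>
    (NetSym.weight (if c = c' then toWeight θ (W i j) else toWeight θ 0) : NetSym θ)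
  have h' : (fun c' : Fin B => List.ofFn fun j : Fin q =>
      (NetSym.weight (if c = c' then toWeight θ (W i j) else toWeight θ 0) : NetSym θ)) =
      fun c' => if c = c' then List.ofFn fun j => NetSym.weight (toWeight θ (W i j)) else
        List.replicate q (NetSym.weight (toWeight θ 0)) := by
    funext c'
    split_ifs
    · rfl
    · exact List.ofFn_const _ _
  rw [h, h', List.ofFn_ite_eq]
  simp

theorem encodeNet_parallel_last {m p q : ℕ} (items : List (Bool × Form m))
    (W₁ : Matrix (Fin p) (Fin 1) θr) (b₁ : Fin p → θr) (tail : Net θr p)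
    (W : Fin q → θr) (b : θr) :
    encodeNet (parallel θ (fun c => (items.get c).1) W₁ b₁ tail (.last W b)) =
      ((List.ofFn fun i => ((items.map Prod.fst).flatMap fun s =>
        List.ofFn fun j => NetSym.weight (toWeight θ (blockSign s * W₁ i 0 * W j))) ++
          [NetSym.weight (toWeight θ (W₁ i 0 + b₁ i)), NetSym.endNeuron]).flatten) ++
        [NetSym.endLayer] ++ encodeNet (tail.lift θ) := by
  refine congrArg (· ++ [NetSym.endLayer] ++ encodeNet (tail.lift θ)) ?_
  refine congrArg List.flatten (congrArg List.ofFn (funext fun i => ?_))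
  refine congrArg (· ++ [NetSym.weight (toWeight θ (W₁ i 0 + b₁ i)), NetSym.endNeuron]) ?_
  refine (List.ofFn_divNat_modNat fun (c : Fin items.length) (j : Fin q) =>
    (NetSym.weight (toWeight θ (blockSign (items.get c).1 * W₁ i 0 * W j)) : NetSym θ)).trans ?_
  rw [List.flatMap_map]
  exact List.flatten_ofFn_get items fun it =>
    List.ofFn fun j => NetSym.weight (toWeight θ (blockSign it.1 * W₁ i 0 * W j))

/-- The word of the neurons that evaluate the first layer of a network at an affine form. -/
def formWord {m p : ℕ} (W₁ : Matrix (Fin p) (Fin 1) θr) (b₁ : Fin p → θr) (f : Form m) :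
    List (NetSym θ) :=
  (List.ofFn fun i => (List.ofFn fun v => NetSym.weight (toWeight θ (f.1 v * W₁ i 0))) ++
    [NetSym.weight (toWeight θ (f.2 * W₁ i 0 + b₁ i)), NetSym.endNeuron]).flatten

theorem encodeNet_ofForms {m p : ℕ} (items : List (Bool × Form m))
    (W₁ : Matrix (Fin p) (Fin 1) θr) (b₁ : Fin p → θr) (rest : Net θr p) :
    encodeNet (ofForms θ items W₁ b₁ rest) =
      (items.flatMap fun f => formWord W₁ b₁ f.2) ++ [NetSym.endLayer] ++
        encodeNet (parallel θ (fun c => (items.get c).1) W₁ b₁ rest rest) := by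
  refine congrArg (· ++ [NetSym.endLayer] ++
    encodeNet (parallel θ (fun c => (items.get c).1) W₁ b₁ rest rest)) ?_
  refine (congrArg List.flatten (List.ofFn_divNat_modNat fun (c : Fin items.length) (i : Fin p) =>
    (List.ofFn fun v => NetSym.weight (toWeight θ ((items.get c).2.1 v * W₁ i 0))) ++
      [NetSym.weight (toWeight θ ((items.get c).2.2 * W₁ i 0 + b₁ i)), NetSym.endNeuron])).trans ?_
  rw [List.flatten_flatten, List.map_ofFn]
  exact List.flatten_ofFn_get items fun it => formWord W₁ b₁ it.2

end Encode

end Net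

/-! ### The matrix of a network with values `0` and `1` -/

/-- The spectral norm is at most the Frobenius norm, by the Cauchy–Schwarz inequality in every row.
-/
theorem norm_toEuclideanCLM_le {N : ℕ} (M : Matrix (Fin N) (Fin N) ℝ) :
    ‖Matrix.toEuclideanCLM (𝕜 := ℝ) M‖ ≤ √(∑ i, ∑ j, M i j ^ 2) := by
  refine ContinuousLinearMap.opNorm_le_bound _ (Real.sqrt_nonneg _) fun x => ?_
  rw [EuclideanSpace.norm_eq, EuclideanSpace.norm_eq, ← Real.sqrt_mul (by positivity)]
  refine Real.sqrt_le_sqrt ?_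
  rw [Finset.sum_mul]
  refine Finset.sum_le_sum fun i _ => ?_
  simp only [Real.norm_eq_abs, sq_abs]
  exact Finset.sum_mul_sq_le_sq_mul_sq Finset.univ (fun j => M i j) fun j => x j

/-- A nonzero matrix with entries `0` and `1` in which every nonzero row has at least `R` ones. -/
theorem le_mvmRatio {N : ℕ} (M : Matrix (Fin N) (Fin N) ℝ) {R : ℝ}
    (h01 : ∀ i j, M i j = 0 ∨ M i j = 1) (hM : ∃ i j, M i j = 1) (hR : 0 ≤ R)
    (hrow : ∀ i j, M i j = 1 → R ≤ ∑ j, M i j) :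
    √(R / N) ≤ mvmRatio M := by
  obtain ⟨i₀, j₀, h₀⟩ := hM
  have hN : (0 : ℝ) < N := by exact_mod_cast i₀.pos
  have hnn : ∀ i j, 0 ≤ M i j := fun i j => by rcases h01 i j with h | h <;> simp [h]
  set S := ∑ i, ∑ j, M i j with hS
  have hS0 : 0 < S := by
    refine Finset.sum_pos' (fun i _ => Finset.sum_nonneg fun j _ => hnn i j)
      ⟨i₀, Finset.mem_univ _, Finset.sum_pos' (fun j _ => hnn _ j) ⟨j₀, Finset.mem_univ _, ?_⟩⟩
    rw [h₀]; norm_num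
  -- For entries 0 and 1 the squared Frobenius norm is the number of ones.
  have hsq : ∑ i, ∑ j, M i j ^ 2 = S :=
    Finset.sum_congr rfl fun i _ => Finset.sum_congr rfl fun j _ => by
      rcases h01 i j with h | h <;> simp [h]
  have h1 : ‖WithLp.toLp 2 (1 : Fin N → ℝ)‖ = √N := by simp [EuclideanSpace.norm_eq]
  -- A nonzero row has sum at least `R`, so the square of its sum is at least `R` times the sum.
  -- Zero rows contribute nothing to either side.
  have h2 : √(R * S) ≤ ‖WithLp.toLp 2 (M.mulVec 1)‖ := by
    rw [EuclideanSpace.norm_eq]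
    refine Real.sqrt_le_sqrt ?_
    rw [hS, Finset.mul_sum]
    refine Finset.sum_le_sum fun i _ => ?_
    have e : M.mulVec 1 i = ∑ j, M i j := by simp [Matrix.mulVec, dotProduct]
    simp only [Real.norm_eq_abs, sq_abs, e]
    by_cases h : ∃ j, M i j = 1
    · obtain ⟨j, hj⟩ := h
      rw [sq]
      exact mul_le_mul_of_nonneg_right (hrow i j hj) (Finset.sum_nonneg fun j _ => hnn i j)
    · push Not at h
      have : ∀ j, M i j = 0 := fun j => (h01 i j).resolve_right (h j)
      simp [this]
  have h3 : ‖Matrix.toEuclideanCLM (𝕜 := ℝ) M‖ ≤ √S := hsq ▸ norm_toEuclideanCLM_le M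
  have h4 : 0 < ‖Matrix.toEuclideanCLM (𝕜 := ℝ) M‖ := by
    rw [norm_pos_iff]
    intro h
    have : M = 0 := by simpa using h
    simp [this] at h₀
  rw [mvmRatio, h1, le_div_iff₀ (mul_pos h4 (Real.sqrt_pos.2 hN))]
  calc √(R / N) * (‖Matrix.toEuclideanCLM (𝕜 := ℝ) M‖ * √N) ≤ √(R / N) * (√S * √N) := by gcongr
    _ = √(R * S) := by
      rw [← Real.sqrt_mul hS0.le, ← Real.sqrt_mul (by positivity)]
      congr 1
      field_simp
    _ ≤ _ := h2

theorem exists_testBit (d : ℕ) (f : ℕ → Bool) : ∃ i < 2 ^ d, ∀ q < d, i.testBit q = f q := by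
  refine ⟨Nat.ofBits fun q : Fin d => f q, Nat.ofBits_lt_two_pow _, fun q hq => ?_⟩
  rw [Nat.testBit_ofBits_lt _ _ hq]

/-- The inputs with entries `0` and `1` at which a network with `2ℓ` inputs is evaluated. -/
theorem mvmRatio_netMatrix {θ : Finset ℝ} {σ : ℝ → ℝ} {ℓ d : ℕ} (hd : ℓ ≤ d)
    (Φ : Net θ (2 * ℓ)) (P : (ℕ → Bool) → Prop)
    (hP : ∀ x : ℕ → Bool, P x → Φ.realize σ (fun p => if x p then 1 else 0) = 1)
    (hP' : ∀ x : ℕ → Bool, ¬ P x → Φ.realize σ (fun p => if x p then 1 else 0) = 0) :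
    ((¬ ∃ x, P x) → mvmRatio (netMatrix σ d Φ) = 0) ∧
      ((∃ x, P x) → √((2 : ℝ) ^ ℓ)⁻¹ ≤ mvmRatio (netMatrix σ d Φ)) := by
  let bits : ℕ → ℕ → ℕ → Bool := fun i j p =>
    if p < ℓ then i.testBit (d - 1 - p) else j.testBit (d - 1 - (p - ℓ))
  have hM : ∀ i j, netMatrix σ d Φ i j =
      Φ.realize σ (fun p => if bits i j p then 1 else 0) := by
    intro i j
    simp only [netMatrix, Matrix.of_apply]
    congr 1
    funext p
    simp only [binDigit, bits]
    split_ifs <;> rfl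
  have h01 : ∀ i j, netMatrix σ d Φ i j = 0 ∨ netMatrix σ d Φ i j = 1 := by
    intro i j
    rw [hM]
    by_cases h : P (bits i j)
    · exact .inr (hP _ h)
    · exact .inl (hP' _ h)
  constructor
  · intro h
    push Not at h
    have : netMatrix σ d Φ = 0 := by
      ext i j
      rw [hM, hP' _ (h _)]
      rfl
    simp [mvmRatio, this]
  · rintro ⟨x, hx⟩
    -- `testBit` counts from the least significant digit while the network reads from the most
    -- significant one, hence the reversal.
    obtain ⟨i, hi, hi'⟩ := exists_testBit d fun q => x (d - 1 - q)
    obtain ⟨j, hj, hj'⟩ := exists_testBit d fun q => x (ℓ + (d - 1 - q))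
    have hone : ∃ i j, netMatrix σ d Φ i j = 1 := by
      refine ⟨⟨i, hi⟩, ⟨j, hj⟩, ?_⟩
      rw [hM]
      refine Eq.trans ?_ (hP x hx)
      congr 1
      funext p
      have hp := p.2
      have : bits i j p = x p := by
        simp only [bits]
        split_ifs with h
        · rw [hi' _ (by omega)]; congr 1; omega
        · rw [hj' _ (by omega)]; congr 1; omega
      rw [this]
    -- Only the first `ℓ` digits of the column index are read, so a row is constant on the `2 ^ (d -
    -- ℓ)` columns that share them; `g` lists these columns by their last `d - ℓ` digits. Divided by
    -- the size `2 ^ d`, this number is `2 ^ -ℓ`.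
    have hrow : ∀ i j, netMatrix σ d Φ i j = 1 →
        (2 : ℝ) ^ (d - ℓ) ≤ ∑ j, netMatrix σ d Φ i j := by
      intro i j hij
      have hpow : 2 ^ d = 2 ^ (d - ℓ) * 2 ^ ℓ := by rw [← pow_add]; congr 1; omega
      have hlt : ∀ u < 2 ^ (d - ℓ), 2 ^ (d - ℓ) * ((j : ℕ) / 2 ^ (d - ℓ)) + u < 2 ^ d := by
        intro u hu
        have h1 : (j : ℕ) / 2 ^ (d - ℓ) < 2 ^ ℓ := Nat.div_lt_of_lt_mul (hpow ▸ j.2)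
        refine lt_of_lt_of_eq ?_ hpow.symm
        nlinarith
      let g : Fin (2 ^ (d - ℓ)) → Fin (2 ^ d) := fun u => ⟨_, hlt u u.2⟩
      have hg : Function.Injective g := by
        intro u v huv
        simp only [g, Fin.mk.injEq] at huv
        ext; omega
      have hgval : ∀ u, netMatrix σ d Φ i (g u) = 1 := by
        intro u
        rw [← hij, hM, hM]
        congr 1
        funext p
        have hp := p.2
        have : bits i (g u) p = bits i j p := by
          simp only [bits, g]
          split_ifs with h
          · rfl
          · have e : d - 1 - ((p : ℕ) - ℓ) = (d - ℓ) + (ℓ - 1 - ((p : ℕ) - ℓ)) := by omega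
            rw [e, Nat.add_comm (d - ℓ), ← Nat.testBit_div_two_pow, ← Nat.testBit_div_two_pow,
              Nat.mul_add_div (by positivity), Nat.div_eq_of_lt u.2, Nat.add_zero]
        rw [this]
      calc (2 : ℝ) ^ (d - ℓ) = ∑ u, netMatrix σ d Φ i (g u) := by simp [hgval]
        _ = ∑ j ∈ Finset.univ.map ⟨g, hg⟩, netMatrix σ d Φ i j := by simp
        _ ≤ _ := Finset.sum_le_sum_of_subset_of_nonneg (Finset.subset_univ _) fun j _ _ => by
          rcases h01 i j with h | h <;> simp [h]
    refine le_trans (Real.sqrt_le_sqrt (le_of_eq ?_)) (le_mvmRatio _ h01 hone (by positivity) hrow)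
    push_cast
    rw [eq_div_iff (by positivity), inv_mul_eq_iff_eq_mul₀ (by positivity), ← pow_add]
    congr 1; omega

/-! ### Formulas as signed lists of affine forms -/

/-- The coefficient of the variable `v` in the sum of the literals of a clause. -/
def Clause.coef (c : Clause) (v : ℕ) : ℤ :=
  (c.map fun l => if l.1 = v then (if l.2 then 1 else -1) else 0).sum

/-- The number of negative literals of a clause. -/
def Clause.negs (c : Clause) : ℤ := (c.map fun l => if l.2 then 0 else 1).sum

/-- The sum of the literals of a clause, where the negation of `x` is `1 - x`. -/
def Clause.form (m : ℕ) (c : Clause) : Net.Form m := (fun v => c.coef v, c.negs)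

/-- The constant form `1`. -/
def Net.Form.one (m : ℕ) : Net.Form m := (fun _ => 0, 1)

/-- The signed forms of a formula. -/
def CNF.items (m : ℕ) (α : CNF) : List (Bool × Net.Form m) :=
  -- This pair contributes zero. It keeps the number of blocks positive for the empty formula, as
  -- every layer must have a neuron.
  [(true, .one m), (false, .one m)] ++
    α.flatMap fun c => [(true, Clause.form m c), (false, .one m)]

/-- A clause may repeat a variable, and each occurrence changes the coefficient by at most one. -/
theorem Clause.abs_coef_le (c : Clause) (v : ℕ) : |c.coef v| ≤ c.length := by
  induction c with
  | nil => simp [Clause.coef]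
  | cons l c ih =>
    simp only [Clause.coef, List.map_cons, List.sum_cons, List.length_cons, Nat.cast_add,
      Nat.cast_one] at ih ⊢
    rw [abs_le] at ih ⊢
    split_ifs <;> constructor <;> linarith [ih.1, ih.2]

theorem Clause.abs_negs_le (c : Clause) : |c.negs| ≤ c.length := by
  induction c with
  | nil => simp [Clause.negs]
  | cons l c ih =>
    simp only [Clause.negs, List.map_cons, List.sum_cons, List.length_cons, Nat.cast_add,
      Nat.cast_one] at ih ⊢
    rw [abs_le] at ih ⊢
    split_ifs <;> constructor <;> linarith [ih.1, ih.2]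

theorem Net.Form.eval_one (m : ℕ) (x : Fin m → ℝ) : (Net.Form.one m).eval x = 1 := by
  simp [Net.Form.eval, Net.Form.one]

theorem Clause.eval_form {m : ℕ} {c : Clause} (hc : ∀ l ∈ c, l.1 < m) (x : ℕ → Bool) :
    (Clause.form m c).eval (fun v => if x v then 1 else 0) =
      (c.map fun l => if x l.1 = l.2 then (1 : ℝ) else 0).sum := by
  induction c with
  | nil => simp [Net.Form.eval, Clause.form, Clause.coef, Clause.negs]
  | cons l c ih =>
    have ih' := ih fun l hl => hc l (by simp [hl])
    have hl := hc l (by simp)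
    simp only [Net.Form.eval, Clause.form, Clause.coef, Clause.negs] at ih'
    simp only [Net.Form.eval, Clause.form, Clause.coef, Clause.negs, List.map_cons, List.sum_cons,
      ← ih']
    push_cast
    simp only [add_mul, Finset.sum_add_distrib]
    have e : ∑ v : Fin m, (if l.1 = (v : ℕ) then (if l.2 = true then (1 : ℝ) else -1) else 0) *
        (if x v = true then 1 else 0) =
        (if l.2 = true then (1 : ℝ) else -1) * (if x l.1 = true then 1 else 0) := by
      rw [Finset.sum_eq_single ⟨l.1, hl⟩]
      · simp
      · intro v _ hv
        rw [if_neg, zero_mul]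
        intro h
        exact hv (Fin.ext h.symm)
      · simp
    rw [e]
    have e' : (if l.2 = true then (1 : ℝ) else -1) * (if x l.1 = true then 1 else 0) +
        (if l.2 = true then 0 else 1) = if x l.1 = l.2 then 1 else 0 := by
      cases l.2 <;> cases x l.1 <;> simp
    rw [← e']
    ring

theorem Clause.eval_form_eq_zero {m : ℕ} {c : Clause} (hc : ∀ l ∈ c, l.1 < m) (x : ℕ → Bool)
    (h : ¬ ∃ l ∈ c, x l.1 = l.2) : (Clause.form m c).eval (fun v => if x v then 1 else 0) = 0 := by
  push Not at h
  rw [Clause.eval_form hc]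
  refine List.sum_eq_zero ?_
  simp only [List.mem_map, forall_exists_index, and_imp]
  rintro _ l hl rfl
  rw [if_neg (h l hl)]

theorem Clause.one_le_eval_form {m : ℕ} {c : Clause} (hc : ∀ l ∈ c, l.1 < m) (x : ℕ → Bool)
    (h : ∃ l ∈ c, x l.1 = l.2) : 1 ≤ (Clause.form m c).eval (fun v => if x v then 1 else 0) := by
  obtain ⟨l, hl, h⟩ := h
  rw [Clause.eval_form hc]
  refine List.single_le_sum ?_ _ (List.mem_map.2 ⟨l, hl, if_pos h⟩)
  simp only [List.mem_map, forall_exists_index, and_imp]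
  rintro _ l hl rfl
  split_ifs <;> norm_num

/-- The opposite sign of the constant block turns each clause into a difference. With `g` constant
the sum of the signs is seen to vanish. -/
theorem CNF.sum_items {m : ℕ} (α : CNF) (g : Net.Form m → ℝ) :
    ((CNF.items m α).map fun f => blockSign f.1 * g f.2).sum =
      (α.map fun c => g (Clause.form m c) - g (.one m)).sum := by
  have h : ∀ α : CNF, ((α.flatMap fun c => [(true, Clause.form m c), (false, .one m)]).map
      fun f : Bool × Net.Form m => blockSign f.1 * g f.2).sum =
      (α.map fun c => g (Clause.form m c) - g (.one m)).sum := by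
    intro α
    induction α with
    | nil => simp
    | cons c α ih =>
      simp only [List.flatMap_cons, List.map_append, List.sum_append, ih, List.map_cons,
        List.sum_cons, List.map_nil, List.sum_nil]
      simp only [blockSign, if_true, Bool.false_eq_true, if_false]
      ring
  rw [CNF.items, List.map_append, List.sum_append, h]
  simp [blockSign]

theorem CNF.sum_sign_items (m : ℕ) (α : CNF) :
    ((CNF.items m α).map fun f => blockSign f.1).sum = 0 := by
  simpa using CNF.sum_items (m := m) α fun _ => 1

theorem CNF.length_items (m : ℕ) (α : CNF) : (CNF.items m α).length = 2 * (α.length + 1) := by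
  have h : ∀ α : CNF, (α.flatMap fun c => [(true, Clause.form m c), (false, Net.Form.one m)]).length
      = 2 * α.length := by
    intro α
    induction α with
    | nil => simp
    | cons c α ih => simp only [List.flatMap_cons, List.length_append, ih, List.length_cons,
        List.length_nil]; ring
  simp only [CNF.items, List.length_append, h, List.length_cons, List.length_nil]
  ring

theorem CNF.items_le {k m : ℕ} (hk : 1 ≤ k) {α : CNF} (hα : ∀ c ∈ α, c.length ≤ k) :
    ∀ f ∈ CNF.items m α, (∀ v, |f.2.1 v| ≤ (k : ℤ)) ∧ |f.2.2| ≤ (k : ℤ) := by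
  have h1 : (∀ v, |(Net.Form.one m).1 v| ≤ (k : ℤ)) ∧ |(Net.Form.one m).2| ≤ (k : ℤ) := by
    simp [Net.Form.one]; exact_mod_cast hk
  intro f hf
  simp only [CNF.items, List.cons_append, List.nil_append, List.mem_cons, List.mem_flatMap,
    List.not_mem_nil, or_false] at hf
  rcases hf with rfl | rfl | ⟨c, hc, rfl | rfl⟩
  · exact h1
  · exact h1
  · have h2 : (c.length : ℤ) ≤ k := by exact_mod_cast hα c hc
    exact ⟨fun v => (Clause.abs_coef_le c v).trans h2, (Clause.abs_negs_le c).trans h2⟩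
  · exact h1

/-- A step function applied to the signed sum of its values at the forms of a formula evaluates the
formula. -/
theorem CNF.step_sum_items {m : ℕ} {α : CNF} (hα : ∀ c ∈ α, ∀ l ∈ c, l.1 < m) {r : ℝ → ℝ}
    (h0 : ∀ x, x ≤ 0 → r x = 0) (h1 : ∀ x, 1 ≤ x → r x = 1) (x : ℕ → Bool) :
    r (1 + ((CNF.items m α).map fun f =>
      blockSign f.1 * r (f.2.eval fun v => if x v then 1 else 0)).sum) =
      if ∀ c ∈ α, ∃ l ∈ c, x l.1 = l.2 then 1 else 0 := by
  rw [CNF.sum_items α fun f => r (f.eval fun v => if x v then 1 else 0)]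
  simp only [Net.Form.eval_one, h1 1 le_rfl]
  -- At a 0-1 point all values of `r` on the forms are 0 or 1, so the outer argument is one minus
  -- the number of violated clauses. It equals 1 or is at most 0, and the shape of `r` in between
  -- does not matter.
  have ht : ∀ c ∈ α, (∃ l ∈ c, x l.1 = l.2) →
      r ((Clause.form m c).eval fun v => if x v then 1 else 0) = 1 := fun c hc h =>
    h1 _ (Clause.one_le_eval_form (hα c hc) x h)
  have hf : ∀ c ∈ α, (¬ ∃ l ∈ c, x l.1 = l.2) →
      r ((Clause.form m c).eval fun v => if x v then 1 else 0) = 0 := fun c hc h =>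
    h0 _ (Clause.eval_form_eq_zero (hα c hc) x h).le
  split_ifs with h
  · refine h1 _ ?_
    rw [List.sum_eq_zero]
    · simp
    · simp only [List.mem_map, forall_exists_index, and_imp]
      rintro _ c hc rfl
      rw [ht c hc (h c hc), sub_self]
  · push Not at h
    obtain ⟨c, hc, h⟩ := h
    refine h0 _ ?_
    have key : 1 ≤ ((α.map fun c =>
        1 - r ((Clause.form m c).eval fun v => if x v then 1 else 0))).sum := by
      refine List.single_le_sum ?_ _ (List.mem_map.2 ⟨c, hc, ?_⟩)
      · simp only [List.mem_map, forall_exists_index, and_imp]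
        rintro _ c hc rfl
        by_cases h : ∃ l ∈ c, x l.1 = l.2
        · rw [ht c hc h, sub_self]
        · rw [hf c hc h]; norm_num
      · rw [hf c hc (by push Not; exact h), sub_zero]
    have neg : ∀ g : Clause → ℝ, (α.map fun c => g c - 1).sum = - (α.map fun c => 1 - g c).sum := by
      intro g
      clear * -
      induction α with
      | nil => simp
      | cons c α ih => simp only [List.map_cons, List.sum_cons, ih]; ring
    rw [neg]
    linarith

/-! ### Writing the network of a formula -/

/-- Integers of absolute value at most `k`. -/
abbrev Cell (k : ℕ) := Set.Icc (-(k : ℤ)) k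

/-- The element of `Cell k` closest to `j`. -/
def Cell.clamp (k : ℕ) (j : ℤ) : Cell k :=
  ⟨max (-(k : ℤ)) (min j k), le_max_left _ _, max_le (by omega) (min_le_right _ _)⟩

theorem Cell.coe_clamp {k : ℕ} {j : ℤ} (hj : |j| ≤ (k : ℤ)) : (Cell.clamp k j : ℤ) = j := by
  rw [abs_le] at hj
  simp only [Cell.clamp]
  omega

namespace Code

variable {KA X E F S : Type} [DecidableEq KA] [Finite X] {ω : ℕ → Bool}
  {s s' s'' : Store KA (CNFSym ⊕ X)} {T T' : ℕ}

/-- For each entry `(g, w)` of the list, emit `g a` for all symbols `a` of the register `k`, and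
then `w`. -/
def emitRows (k : Reg) : List ((CNFSym ⊕ X → List (CNFSym ⊕ X)) × List (CNFSym ⊕ X)) →
    Code KA X Unit
  | [] => ret ()
  | R :: L => (emitMap k R.1).andThen ((emit R.2).andThen (emitRows k L))

theorem runs_emitRows {k : Reg} (h₁ : k ≠ .aux) (h₂ : k ≠ .net) (hs : s.aux = []) (G : ℕ)
    (L : List ((CNFSym ⊕ X → List (CNFSym ⊕ X)) × List (CNFSym ⊕ X)))
    (hG : ∀ R ∈ L, (∀ a, (R.1 a).length ≤ G) ∧ R.2.length ≤ G) :
    Runs (emitRows k L) ω s ()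
      (s.set .net ((L.flatMap fun R => (s.get k).flatMap R.1 ++ R.2).reverse ++ s.get .net))
      (L.length * ((s.get k).length * (G + 12) + G + 8) + 2) := by
  induction L generalizing s with
  | nil => exact (runs_ret _).congr rfl rfl (by simp)
  | cons R L ih =>
    have hR := hG R (by simp)
    refine ((runs_emitMap R.1 h₁ h₂ hs G hR.1).andThen ((runs_emit R.2).andThen
      (ih (by exact hs) fun R hR => hG R (by simp [hR])))).congr rfl ?_ ?_
    · refine Store.eq_of_get (by simp) (by simp) fun k' => ?_
      simp only [Store.get_set, h₂, if_false]
      split_ifs <;> simp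
    · simp only [Store.get_set, h₂, if_false, List.length_cons]
      nlinarith [hR.2]

/-- The rows of a block diagonal layer that belong to the current block. -/
def emitBlock (Z : List (CNFSym ⊕ X)) : List (List (CNFSym ⊕ X) × List (CNFSym ⊕ X)) →
    Code KA X Unit
  | [] => ret ()
  | R :: L => (emitMap .don fun _ => Z).andThen <| (emit R.1).andThen <|
      (emitMap .blk fun _ => Z).andThen <| (emit R.2).andThen <| emitBlock Z L

theorem runs_emitBlock (hs : s.aux = []) (G : ℕ) (Z : List (CNFSym ⊕ X)) (hZ : Z.length ≤ G)
    (L : List (List (CNFSym ⊕ X) × List (CNFSym ⊕ X)))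
    (hG : ∀ R ∈ L, R.1.length ≤ G ∧ R.2.length ≤ G) :
    Runs (emitBlock Z L) ω s ()
      { s with net := (L.flatMap fun R => (List.replicate s.don.length Z).flatten ++ R.1 ++
          (List.replicate s.blk.length Z).flatten ++ R.2).reverse ++ s.net }
      (L.length * ((s.don.length + s.blk.length) * (G + 12) + 2 * G + 16) + 2) := by
  have hmap : ∀ l : List (CNFSym ⊕ X),
      (l.flatMap fun _ => Z) = (List.replicate l.length Z).flatten := by
    intro l
    rw [List.flatMap_def, List.map_const']
  induction L generalizing s with
  | nil => exact (runs_ret _).congr rfl rfl (by simp)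
  | cons R L ih =>
    have hR := hG R (by simp)
    refine Runs.congr (T := s.don.length * (G + 12) + 6 + (R.1.length + 2 +
      (s.blk.length * (G + 12) + 6 + (R.2.length + 2 +
        (L.length * ((s.don.length + s.blk.length) * (G + 12) + 2 * G + 16) + 2)))))
      ((runs_emitMap (fun _ => Z) (by decide) (by decide) hs G fun _ => hZ).andThen <|
        (runs_emit R.1).andThen <|
        (runs_emitMap (fun _ => Z) (by decide) (by decide) (by exact hs) G fun _ => hZ).andThen <|
        (runs_emit R.2).andThen <| ih (by exact hs) fun R hR => hG R (by simp [hR])) rfl ?_ ?_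
    · simp [Store.set, Store.get, hmap]
    · simp only [List.length_cons]
      nlinarith [hR.1, hR.2]

/-- A block diagonal layer with as many blocks as there are symbols in `blk`. -/
def emitBlocks (Z : List (CNFSym ⊕ X)) (L : List (List (CNFSym ⊕ X) × List (CNFSym ⊕ X))) :
    Code KA X Unit :=
  (loop (S := Unit) (fun _ => (pop .blk).bind fun o =>
    match o with
    | none => ret (.inr ())
    | some a => (emitBlock Z L).andThen ((push .don a).andThen (ret (.inl ())))) ()).andThen
    (move .don .blk)

theorem runs_emitBlocks (hs : s.aux = []) (hdon : s.don = []) (G : ℕ) (Z : List (CNFSym ⊕ X))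
    (hZ : Z.length ≤ G) (L : List (List (CNFSym ⊕ X) × List (CNFSym ⊕ X)))
    (hG : ∀ R ∈ L, R.1.length ≤ G ∧ R.2.length ≤ G) :
    Runs (emitBlocks Z L) ω s ()
      { s with net := (Net.blockWord s.blk.length Z L).reverse ++ s.net }
      ((s.blk.length + 1) *
        (L.length * (s.blk.length * (G + 12) + 2 * G + 16) + 12)) := by
  -- Generalized to a nonempty `don`: the blocks already written count the zero blocks to the left
  -- of the current one, and those left in `blk` count the zero blocks to its right.
  have key : ∀ (l : List (CNFSym ⊕ X)) (s : Store KA (CNFSym ⊕ X)), s.blk = l → s.aux = [] →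
      Runs (loop (S := Unit) (fun _ => (pop .blk).bind fun o =>
        match o with
        | none => ret (.inr ())
        | some a => (emitBlock Z L).andThen ((push .don a).andThen (ret (.inl ())))) ()) ω s ()
        { s with
          blk := []
          don := l.reverse ++ s.don
          net := ((List.range l.length).flatMap fun c => L.flatMap fun R =>
            (List.replicate (s.don.length + c) Z).flatten ++ R.1 ++
              (List.replicate (l.length - 1 - c) Z).flatten ++ R.2).reverse ++ s.net }
        (l.length * (L.length * ((s.don.length + l.length) * (G + 12) + 2 * G + 16) + 6) + 3) := by
    intro l
    induction l with
    | nil =>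
      intro s hl _
      have h1 : s.get .blk = [] := hl
      refine Runs.loop_exit (Runs.mono (T := 1 + 2) ((runs_pop _).bind ?_) (by simp))
      rw [h1]
      exact runs_ret _
    | cons a l ih =>
      intro s hl haux
      have h1 : s.get .blk = a :: l := hl
      have h2 := runs_emitBlock (ω := ω) (s := { s with blk := l }) haux G Z hZ L hG
      have h3 := ih { s with
        blk := l
        don := a :: s.don
        net := (L.flatMap fun R => (List.replicate s.don.length Z).flatten ++ R.1 ++
          (List.replicate l.length Z).flatten ++ R.2).reverse ++ s.net } rfl haux
      refine Runs.congr (Runs.loop_again (T := 1 +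
        (L.length * ((s.don.length + l.length) * (G + 12) + 2 * G + 16) + 2 + (1 + 2))) ?_ h3) rfl
        ?_ ?_
      · refine (runs_pop _).bind ?_
        rw [h1]
        exact h2.andThen ((runs_push _ _).andThen (runs_ret _))
      · simp only [List.length_cons, List.range_succ_eq_map, List.flatMap_cons, List.flatMap_map]
        congr 1
        · simp
        · simp only [List.reverse_append, List.append_assoc, Nat.add_zero, Nat.sub_zero,
            Nat.add_sub_cancel]
          congr 3
          funext c
          have e1 : s.don.length + 1 + c = s.don.length + c.succ := by omega
          have e2 : l.length - 1 - c = l.length - c.succ := by omega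
          rw [e1, e2]
      · simp only [List.length_cons]
        have : L.length * ((s.don.length + l.length) * (G + 12) + 2 * G + 16) ≤
          L.length * ((s.don.length + (l.length + 1)) * (G + 12) + 2 * G + 16) := by gcongr; omega
        have e : s.don.length + 1 + l.length = s.don.length + (l.length + 1) := by omega
        rw [e]
        generalize L.length * ((s.don.length + (l.length + 1)) * (G + 12) + 2 * G + 16) = A at *
        nlinarith
  refine Runs.congr ((key s.blk s rfl hs).andThen
    (runs_move (by decide) (by decide) (by decide))) rfl ?_ ?_
  · simp [Store.set, Store.get, hdon, Net.blockWord]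
  · simp only [Store.get, hdon, List.append_nil, List.length_reverse, List.length_nil, zero_add]
    generalize L.length * (s.blk.length * (G + 12) + 2 * G + 16) = A at *
    nlinarith

end Code

namespace Code

/-! ### Writing the parallel copies -/

section Parallel

variable {KA X : Type} [DecidableEq KA] [Finite X] {ω : ℕ → Bool} {θr θ : Finset ℝ}
  [Inhabited θ]

/-- The word that belongs to a block of the given sign. -/
def signWord (em : NetSym θ → CNFSym ⊕ X) {q : ℕ} (w : ℝ) (W : Fin q → θr) :
    CNFSym ⊕ X → List (CNFSym ⊕ X)
  | .inl (.literal s) => List.ofFn fun j => em (.weight (toWeight θ (blockSign s * w * W j)))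
  | _ => []

/-- Write the network `Net.parallel`, with signs in `blk`. -/
def parallelCode (em : NetSym θ → CNFSym ⊕ X) {p : ℕ} (W₁ : Matrix (Fin p) (Fin 1) θr)
    (b₁ : Fin p → θr) (tail : Net θr p) : {q : ℕ} → Net θr q → Code KA X Unit
  | _, .last W _ =>
      (emitRows .blk (List.ofFn fun i => (signWord em (W₁ i 0) W,
        [em (.weight (toWeight θ (W₁ i 0 + b₁ i))), em .endNeuron]))).andThen
        (emit (em .endLayer :: (encodeNet (tail.lift θ)).map em))
  | q, .layer W b rest =>
      (emitBlocks ((List.replicate q (NetSym.weight (toWeight θ 0))).map em)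
        ((Net.layerRows W b).map fun R => (R.1.map em, R.2.map em))).andThen <|
      (emit [em .endLayer]).andThen (parallelCode em W₁ b₁ tail rest)

theorem map_blockWord {α β : Type} (f : α → β) (B : ℕ) (Z : List α)
    (L : List (List α × List α)) :
    (Net.blockWord B Z L).map f =
      Net.blockWord B (Z.map f) (L.map fun R => (R.1.map f, R.2.map f)) := by
  simp only [Net.blockWord, List.map_flatMap, List.flatMap_map, List.map_append, List.map_flatten,
    List.map_replicate]

/-- The network for `r` is wired into the control, so `a` does not depend on the formula. Only the
number of blocks varies, and a block diagonal layer with `B` blocks has `B ^ 2` pieces of constant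
cost. -/
theorem exists_runs_parallelCode (em : NetSym θ → CNFSym ⊕ X) {p : ℕ}
    (W₁ : Matrix (Fin p) (Fin 1) θr) (b₁ : Fin p → θr) (tail : Net θr p) {q : ℕ} (Φ : Net θr q) :
    ∃ a : ℕ, ∀ {m : ℕ} (items : List (Bool × Net.Form m)) (ω : ℕ → Bool)
      (s : Store KA (CNFSym ⊕ X)), s.aux = [] → s.don = [] →
      s.blk = items.map (fun f => .inl (.literal f.1)) →
      Runs (parallelCode em W₁ b₁ tail Φ) ω s ()
        { s with net := ((encodeNet (Net.parallel θ (fun c => (items.get c).1) W₁ b₁ tail Φ)).map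
          em).reverse ++ s.net } (a * (items.length + 1) ^ 2) := by
  induction Φ with
  | @last q W b =>
    set E := (encodeNet (tail.lift θ)).map em with hE
    refine ⟨p * (q + 16) + p * (q + 12) + E.length + 10, fun items ω s hs hdon hblk => ?_⟩
    have h1 := runs_emitRows (ω := ω) (s := s) (k := .blk) (by decide) (by decide) hs (q + 2)
      (List.ofFn fun i => (signWord em (W₁ i 0) W,
        [em (.weight (toWeight θ (W₁ i 0 + b₁ i))), em .endNeuron])) (by
        simp only [List.mem_ofFn, forall_exists_index, forall_apply_eq_imp_iff]
        refine fun i => ⟨fun a => ?_, by simp⟩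
        unfold signWord
        split <;> simp)
    have hget : s.get .blk = items.map fun f => .inl (.literal f.1) := hblk
    refine Runs.congr (h1.andThen (runs_emit _)) rfl ?_ ?_
    · rw [Net.encodeNet_parallel_last, hget]
      simp only [Store.set, Store.get]
      congr 1
      rw [← List.append_assoc, ← List.reverse_append]
      congr 2
      simp only [List.map_append, List.map_flatten, List.map_ofFn, ← hE, List.map_cons,
        List.append_assoc, List.cons_append, List.nil_append]
      congr 1
      rw [← List.flatten_ofFn_map]
      congr 1
      refine congrArg List.ofFn (funext fun i => ?_)
      simp only [Function.comp, List.map_append, List.map_flatMap, List.flatMap_map, List.map_cons,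
        List.map_nil, List.map_ofFn, signWord]
      rfl
    · rw [hget]
      simp only [List.length_ofFn, List.length_map, List.length_cons, ← hE]
      have e1 : 1 ≤ items.length + 1 := by omega
      have e2 : items.length + 1 ≤ (items.length + 1) ^ 2 := by nlinarith
      generalize (items.length + 1) ^ 2 = N at *
      have e3 : p * (items.length * (q + 2 + 12) + (q + 2) + 8) ≤
          (p * (q + 16) + p * (q + 12)) * N := by
        calc _ ≤ p * (N * (q + 16) + N * (q + 12)) := by
              have a1 : items.length * (q + 2 + 12) ≤ N * (q + 16) :=
                Nat.mul_le_mul (by omega) (by omega)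
              have a2 : 1 * (q + 12) ≤ N * (q + 12) := Nat.mul_le_mul_right _ (by omega)
              exact Nat.mul_le_mul_left _ (by omega)
          _ = _ := by ring
      nlinarith
  | @layer q p' W b rest ih =>
    obtain ⟨a, ih⟩ := ih
    refine ⟨p' * (q + 14) + p' * (2 * q + 20) + 16 + a, fun items ω s hs hdon hblk => ?_⟩
    have h1 := runs_emitBlocks (ω := ω) (s := s) hs hdon (q + 2)
      ((List.replicate q (NetSym.weight (toWeight θ 0))).map em) (by simp)
      ((Net.layerRows W b).map fun R => (R.1.map em, R.2.map em)) (by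
        simp only [Net.layerRows, List.map_ofFn, List.mem_ofFn, forall_exists_index,
          forall_apply_eq_imp_iff]
        intro i
        simp)
    refine Runs.congr (h1.andThen ((runs_emit _).andThen (ih items ω _ hs hdon hblk))) rfl ?_ ?_
    · rw [Net.encodeNet_parallel_layer]
      simp only [Store.set, Store.get, hblk, List.length_map, List.map_append, map_blockWord,
        List.reverse_append, List.append_assoc, List.map_cons, List.map_nil]
    · simp only [hblk, List.length_map, Net.layerRows, List.length_ofFn, List.length_cons,
        List.length_nil]
      have e1 : 1 ≤ items.length + 1 := by omega
      have e2 : items.length + 1 ≤ (items.length + 1) ^ 2 := by nlinarith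
      have e3 : (items.length + 1) * (p' * (items.length * (q + 2 + 12) + 2 * (q + 2) + 16) + 12) ≤
          (p' * (q + 14) + p' * (2 * q + 20) + 12) * (items.length + 1) ^ 2 := by
        calc _ ≤ (items.length + 1) * (p' * ((items.length + 1) * (q + 14) +
              (items.length + 1) * (2 * q + 20)) + 12 * (items.length + 1)) := by
              have a1 : items.length * (q + 2 + 12) ≤ (items.length + 1) * (q + 14) :=
                Nat.mul_le_mul (by omega) (by omega)
              have a2 : 1 * (2 * q + 20) ≤ (items.length + 1) * (2 * q + 20) :=
                Nat.mul_le_mul_right _ (by omega)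
              exact Nat.mul_le_mul_left _
                (Nat.add_le_add (Nat.mul_le_mul_left _ (by omega)) (by omega))
          _ = _ := by ring
      nlinarith

end Parallel

/-! ### Writing the first layer clause by clause -/

section Forms

variable {KA Y : Type} [DecidableEq KA] [Finite Y] {ω : ℕ → Bool} {θr θ : Finset ℝ}
  [Inhabited θ] {k : ℕ}

/-- The symbol for a coefficient. -/
def cell (j : ℤ) : CNFSym ⊕ (Cell k ⊕ Y) := .inr (.inl (Cell.clamp k j))

/-- The coefficient denoted by a symbol. -/
def cellValue : CNFSym ⊕ (Cell k ⊕ Y) → ℤ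
  | .inr (.inl c) => c
  | _ => 0

omit [Finite Y] in
theorem cellValue_cell {j : ℤ} (hj : |j| ≤ (k : ℤ)) :
    cellValue (cell j : CNFSym ⊕ (Cell k ⊕ Y)) = j := Cell.coe_clamp hj

/-- Add a literal to a coefficient. -/
def addLiteral (b : Bool) (a : CNFSym ⊕ (Cell k ⊕ Y)) : CNFSym ⊕ (Cell k ⊕ Y) :=
  cell (cellValue a + if b then 1 else -1)

/-- Count negative literals. -/
def countNeg (q : Cell k) (b : Bool) (_ : CNFSym ⊕ (Cell k ⊕ Y)) : Cell k :=
  if b then q else Cell.clamp k (q + 1)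

/-- Write the first layer of a network at the form with coefficients in `row` and constant `q`. -/
def emitForm (em : NetSym θ → CNFSym ⊕ (Cell k ⊕ Y)) {p : ℕ} (W₁ : Matrix (Fin p) (Fin 1) θr)
    (b₁ : Fin p → θr) (q : Cell k) : Code KA (Cell k ⊕ Y) Unit :=
  emitRows .row (List.ofFn fun i =>
    (fun a => [em (.weight (toWeight θ (cellValue a * W₁ i 0)))],
      [em (.weight (toWeight θ ((q : ℤ) * W₁ i 0 + b₁ i))), em .endNeuron]))

/-- The coefficients of a form as a word. -/
def formRow {m : ℕ} (f : Net.Form m) : List (CNFSym ⊕ (Cell k ⊕ Y)) :=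
  List.ofFn fun v => cell (f.1 v)

variable {s : Store KA (CNFSym ⊕ (Cell k ⊕ Y))}

theorem runs_emitForm (em : NetSym θ → CNFSym ⊕ (Cell k ⊕ Y)) {p m : ℕ}
    (W₁ : Matrix (Fin p) (Fin 1) θr) (b₁ : Fin p → θr) {f : Net.Form m}
    (hf : (∀ v, |f.1 v| ≤ (k : ℤ)) ∧ |f.2| ≤ (k : ℤ)) (hs : s.aux = []) (hrow : s.row = formRow f) :
    Runs (emitForm em W₁ b₁ (Cell.clamp k f.2)) ω s ()
      { s with net := ((Net.formWord W₁ b₁ f).map em).reverse ++ s.net }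
      (p * (14 * m + 10) + 2) := by
  have hget : s.get .row = formRow f := hrow
  refine (runs_emitRows (ω := ω) (s := s) (k := .row) (by decide) (by decide) hs 2 _ (by
    simp only [List.mem_ofFn, forall_exists_index, forall_apply_eq_imp_iff]
    intro i
    simp)).congr rfl ?_ ?_
  · rw [hget]
    simp only [Store.set, Store.get]
    congr 3
    rw [← List.flatten_ofFn_map, Net.formWord, List.map_flatten, List.map_ofFn]
    congr 1
    refine congrArg List.ofFn (funext fun i => ?_)
    simp only [Function.comp, List.map_append, List.map_cons, List.map_nil, List.map_ofFn,
      Cell.coe_clamp hf.2]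
    congr 1
    rw [formRow, ← List.flatten_ofFn_map]
    simp only [cellValue_cell (hf.1 _)]
    exact (List.flatten_ofFn_map (fun v => em (.weight (toWeight θ (f.1 v * W₁ i 0))))
      fun a => [a]).trans (List.flatMap_singleton' _)
  · rw [hget]
    simp only [formRow, List.length_ofFn]
    exact le_of_eq (by ring)

omit [Finite Y] in
-- Each remaining literal raises the counter by at most one. The slack in `hj` therefore keeps it
-- inside the finite set `Cell k`, and clamping never acts.
theorem scanCtl_countNeg (c : Clause) (j : ℤ) (hj : |j| + c.length ≤ (k : ℤ))
    (r : List (CNFSym ⊕ (Cell k ⊕ Y))) :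
    scanCtl (cell 0) addLiteral countNeg c (Cell.clamp k j) r = Cell.clamp k (j + c.negs) := by
  induction c generalizing j r with
  | nil => simp [scanCtl, Clause.negs]
  | cons l c ih =>
    have hn : Clause.negs (l :: c) = (if l.2 then 0 else 1) + Clause.negs c := by
      simp [Clause.negs]
    simp only [List.length_cons, Nat.cast_add, Nat.cast_one] at hj
    rw [scanCtl, countNeg, hn]
    split_ifs
    · rw [ih j (by omega)]
      simp
    · have hj' := abs_add_le j 1
      rw [abs_one] at hj'
      rw [Cell.coe_clamp (by omega), ih (j + 1) (by omega), add_assoc]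

omit [Finite Y] in
-- Coefficients are single symbols of a finite alphabet. The slack in `hg` ensures that no partial
-- sum leaves `Cell k`, so adding a literal in place is exact. All variables lie below `m`, so `row`
-- does not grow.
theorem scanRow_addLiteral {m : ℕ} (c : Clause) (hc : ∀ l ∈ c, l.1 < m) (g : ℕ → ℤ)
    (hg : ∀ v, |g v| + c.length ≤ (k : ℤ)) (r : List (CNFSym ⊕ (Cell k ⊕ Y)))
    (hr : r.length = m) (hr' : ∀ v, v < m → r.getD v (cell 0) = cell (g v)) :
    scanRow (cell 0) addLiteral c r = List.ofFn fun v : Fin m => cell (g v + c.coef v) := by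
  induction c generalizing g r with
  | nil =>
    refine List.ext_getElem (by simp [scanRow, hr]) fun i h1 h2 => ?_
    have hi : i < m := by simpa using h2
    have := hr' i hi
    simp only [scanRow, List.foldl_nil, List.getElem_ofFn, Clause.coef, List.map_nil, List.sum_nil,
      add_zero]
    rw [← this, List.getD_eq_getElem]
  | cons l c ih =>
    have hl := hc l (by simp)
    simp only [List.length_cons, Nat.cast_add, Nat.cast_one] at hg
    have hcoef : ∀ v, Clause.coef (l :: c) v =
        (if l.1 = v then (if l.2 then 1 else -1) else 0) + Clause.coef c v := by
      intro v
      simp [Clause.coef]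
    have habs : ∀ v, |g v + if l.1 = v then (if l.2 then 1 else -1) else 0| ≤ |g v| + 1 := by
      intro v
      refine (abs_add_le _ _).trans ?_
      gcongr
      split_ifs <;> simp
    have := ih (fun l hl => hc l (by simp [hl]))
      (fun v => g v + if l.1 = v then (if l.2 then 1 else -1) else 0)
      (fun v => by have := hg v; have := habs v; omega) (touch (cell 0) (addLiteral l.2) l.1 r)
      (by rw [length_touch, hr]; omega) (by
        intro v hv
        rw [getD_touch]
        split_ifs with h1 h2 h2 <;> try omega
        · subst h1
          rw [hr' l.1 hl, addLiteral, cellValue_cell (by have := hg l.1; omega)]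
          simp_all
        · subst h1
          rw [hr' l.1 hl, addLiteral, cellValue_cell (by have := hg l.1; omega)]
          simp_all
        · rw [hr' v hv, add_zero])
    simp only [add_assoc] at this
    simp only [hcoef]
    exact this

/-- Set all coefficients in `row` to zero. -/
def clearRow : Code KA (Cell k ⊕ Y) Unit :=
  (transfer .row .aux (fun _ => cell 0) fun _ => []).andThen (move .aux .row)

theorem runs_clearRow (hs : s.aux = []) :
    Runs clearRow ω s () { s with row := List.replicate s.row.length (cell 0) }
      (12 * s.row.length + 6) := by
  refine ((runs_transfer _ _ (by decide) (by decide) (by decide) 0 (by simp)).andThen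
    (runs_move (by decide) (by decide) (by decide))).congr rfl ?_ ?_
  · simp [Store.set, Store.get, hs, List.map_const']
  · simp [Store.set, Store.get, hs]; omega

/-- Write the two blocks of a clause. -/
def emitClause (em : NetSym θ → CNFSym ⊕ (Cell k ⊕ Y)) {p : ℕ} (W₁ : Matrix (Fin p) (Fin 1) θr)
    (b₁ : Fin p → θr) (q : Cell k) : Code KA (Cell k ⊕ Y) (Cell k) :=
  (emitForm em W₁ b₁ q).andThen <| clearRow.andThen <|
    (emitForm em W₁ b₁ (Cell.clamp k 1)).andThen (ret (Cell.clamp k 0))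

omit [Finite Y] in
theorem formRow_one (m : ℕ) :
    (formRow (Net.Form.one m) : List (CNFSym ⊕ (Cell k ⊕ Y))) = List.replicate m (cell 0) := by
  simp [formRow, Net.Form.one, List.ofFn_const]

theorem one_form_le (hk : 1 ≤ k) (m : ℕ) :
    (∀ v, |(Net.Form.one m).1 v| ≤ (k : ℤ)) ∧ |(Net.Form.one m).2| ≤ (k : ℤ) := by
  simp [Net.Form.one]; exact_mod_cast hk

theorem runs_emitClause (hk : 1 ≤ k) (em : NetSym θ → CNFSym ⊕ (Cell k ⊕ Y)) {p m : ℕ}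
    (W₁ : Matrix (Fin p) (Fin 1) θr) (b₁ : Fin p → θr) {f : Net.Form m}
    (hf : (∀ v, |f.1 v| ≤ (k : ℤ)) ∧ |f.2| ≤ (k : ℤ)) (hs : s.aux = []) (hrow : s.row = formRow f) :
    Runs (emitClause em W₁ b₁ (Cell.clamp k f.2)) ω s (Cell.clamp k 0)
      { s with
        row := List.replicate m (cell 0)
        net := ((Net.formWord W₁ b₁ f ++ Net.formWord W₁ b₁ (.one m)).map em).reverse ++ s.net }
      ((28 * p + 12) * (m + 1) + 2) := by
  have h1 := runs_emitForm (ω := ω) em W₁ b₁ hf hs hrow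
  have h2 := runs_clearRow (ω := ω)
    (s := { s with net := ((Net.formWord W₁ b₁ f).map em).reverse ++ s.net }) hs
  have hlen : s.row.length = m := by rw [hrow]; simp [formRow]
  simp only [hlen] at h2
  have h3 := runs_emitForm (ω := ω) em W₁ b₁ (one_form_le hk m)
    (s := { s with
      row := List.replicate m (cell 0)
      net := ((Net.formWord W₁ b₁ f).map em).reverse ++ s.net }) hs (formRow_one m).symm
  refine Runs.congr (h1.andThen (h2.andThen (h3.andThen (runs_ret _)))) rfl ?_ ?_
  · simp
  · nlinarith

/-- The end of a clause writes its block, zeroes `row`, and writes the constant block from the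
zeroed row. The next clause then starts from the same state of `row` and counter. -/
theorem runs_scan_emitClause (hk : 1 ≤ k) (em : NetSym θ → CNFSym ⊕ (Cell k ⊕ Y)) {p m : ℕ}
    (W₁ : Matrix (Fin p) (Fin 1) θr) (b₁ : Fin p → θr) {α : CNF}
    (hα : ∀ c ∈ α, c.length ≤ k ∧ ∀ l ∈ c, l.1 < m) (hs : s.aux = [])
    (hrow : s.row = List.replicate m (cell 0)) (hinp : s.inp = (encodeCNF α).map .inl) :
    Runs (scan (cell 0) addLiteral countNeg (emitClause em W₁ b₁) (Cell.clamp k 0)) ω s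
      (Cell.clamp k 0)
      { s with
        inp := []
        bak := ((encodeCNF α).map .inl).reverse ++ s.bak
        net := ((α.flatMap fun c => Net.formWord W₁ b₁ (Clause.form m c) ++
          Net.formWord W₁ b₁ (.one m)).map em).reverse ++ s.net }
      (12 * (encodeCNF α).length + α.length * ((28 * p + 12) * (m + 1) + 2) + 3) := by
  induction α generalizing s with
  | nil =>
    refine (runs_scan_nil (by simpa [encodeCNF] using hinp)).congr rfl ?_ (by simp)
    cases s
    simpa [encodeCNF] using hinp
  | cons c α ih =>
    have hc := hα c (by simp)
    have hck : (c.length : ℤ) ≤ k := by exact_mod_cast hc.1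
    have hctl := scanCtl_countNeg (Y := Y) c 0 (by simpa using hck) s.row
    rw [zero_add] at hctl
    have hr : scanRow (cell 0) addLiteral c s.row =
        (formRow (Clause.form m c) : List (CNFSym ⊕ (Cell k ⊕ Y))) := by
      rw [scanRow_addLiteral (m := m) c hc.2 (fun _ => 0) (by simpa using hck) s.row (by simp [hrow])
        (by intro v hv; simp [hrow, hv])]
      simp [formRow, Clause.form]
    set s₁ : Store KA (CNFSym ⊕ (Cell k ⊕ Y)) := { s with
      inp := (encodeCNF α).map .inl
      bak := ((c.flatMap encodeLiteral ++ [CNFSym.endClause]).map .inl).reverse ++ s.bak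
      row := scanRow (cell 0) addLiteral c s.row } with hs₁
    have h1 := runs_emitClause (ω := ω) hk em W₁ b₁ (f := Clause.form m c)
      ⟨fun v => (Clause.abs_coef_le c v).trans hck, (Clause.abs_negs_le c).trans hck⟩ (s := s₁) hs hr
    rw [show (Clause.form m c).2 = c.negs from rfl, ← hctl] at h1
    have h2 := ih (s := { s₁ with
      row := List.replicate m (cell 0)
      net := ((Net.formWord W₁ b₁ (Clause.form m c) ++ Net.formWord W₁ b₁ (.one m)).map
        em).reverse ++ s₁.net }) (fun c hc => hα c (by simp [hc])) hs rfl rfl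
    refine Runs.congr (runs_scan_clause (c := c) (w := (encodeCNF α).map .inl)
      (by simpa [encodeCNF] using hinp) hs h1 h2) rfl ?_ ?_
    · simp [encodeCNF, hrow, hs₁]
    · simp only [encodeCNF, List.flatMap_cons, List.length_append, List.length_cons]
      ring_nf
      omega

end Forms

end Code

namespace Code

/-! ### Measuring the formula -/

section Count

variable {KA X : Type} [DecidableEq KA] [Finite X] {ω : ℕ → Bool} {s : Store KA (CNFSym ⊕ X)}

/-- Pop up to `n` symbols; tell whether there were any. -/
def popMany (k : Reg) : ℕ → Code KA X Bool
  | 0 => ret false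
  | n + 1 => (pop k).bind fun o => (popMany k n).bind fun b => ret (o.isSome || b)

theorem runs_popMany (k : Reg) (n : ℕ) :
    Runs (popMany k n) ω s (decide (n ≠ 0 ∧ s.get k ≠ [])) (s.set k ((s.get k).drop n))
      (3 * n + 2) := by
  induction n generalizing s with
  | zero =>
    refine (runs_ret _).congr (by simp) (Store.eq_of_get (by simp) (by simp) fun k' => ?_) le_rfl
    rw [Store.get_set]
    split_ifs with h <;> simp [h]
  | succ n ih =>
    refine Runs.mono (T := 1 + (3 * n + 2 + 2)) ?_ (by omega)
    refine (runs_pop k).bind (ih.bind ((runs_ret _).congr ?_ ?_ le_rfl))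
    · rw [Store.get_set, if_pos rfl]
      cases s.get k <;> simp
    · refine Store.eq_of_get (by simp) (by simp) fun k' => ?_
      simp only [Store.get_set]
      split_ifs <;> simp

/-- One more unit of four inputs. -/
def bump (a₀ : CNFSym ⊕ X) : Code KA X Unit :=
  (push .thr (.inl .tick)).andThen <| (push .don a₀).andThen <| (push .don a₀).andThen <|
    (push .don a₀).andThen (push .don a₀)

omit [Finite X] in
theorem runs_bump (a₀ : CNFSym ⊕ X) :
    Runs (bump a₀) ω s () { s with
      thr := .inl .tick :: s.thr
      don := List.replicate 4 a₀ ++ s.don } 5 :=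
  (runs_push _ _).andThen <| (runs_push _ _).andThen <| (runs_push _ _).andThen <|
    (runs_push _ _).andThen (runs_push _ _)

/-- Count units of four symbols of `row` and `4 * C` symbols of `cnt`. -/
def countUnits (C : ℕ) (a₀ : CNFSym ⊕ X) : Code KA X Unit :=
  loop (S := Unit) (fun _ => (popMany .row 4).bind fun b => (popMany .cnt (4 * C)).bind fun b' =>
    if b || b' then (bump a₀).andThen (ret (.inl ())) else ret (.inr ())) ()

/-- Dividing simultaneously by 4 and by `4 * C` makes `h` the larger of the two rounded-up
quotients. Units of four inputs are used because there are `2 * ℓ` inputs and `ℓ = 2 * h` must be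
even. The last claim says that rounding costs at most three inputs when there are at most `C * n`
clauses. -/
theorem runs_countUnits {C : ℕ} (hC : 1 ≤ C) (a₀ : CNFSym ⊕ X) :
    ∃ h, (∀ ω, Runs (countUnits C a₀) ω s () { s with
        row := []
        cnt := []
        thr := List.replicate h (.inl .tick) ++ s.thr
        don := List.replicate (4 * h) a₀ ++ s.don } ((h + 1) * (12 * C + 30))) ∧
      s.row.length ≤ 4 * h ∧ s.cnt.length ≤ C * (4 * h) ∧
      ∀ n, s.row.length ≤ n → s.cnt.length ≤ C * n → 4 * h ≤ n + 3 := by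
  induction hN : s.row.length + s.cnt.length using Nat.strong_induction_on generalizing s with
  | _ N ih =>
    by_cases hz : N = 0
    · have h1 : s.row = [] := List.length_eq_zero_iff.1 (by omega)
      have h2 : s.cnt = [] := List.length_eq_zero_iff.1 (by omega)
      refine ⟨0, fun ω => Runs.loop_exit (Runs.mono (T := 14 + (3 * (4 * C) + 2 + 2)) ?_ (by omega)),
        by simp [h1], by simp [h2], by simp⟩
      refine (runs_popMany .row 4).bind ((runs_popMany .cnt (4 * C)).bind ?_)
      have h1' : s.get .row = [] := h1
      have h2' : (s.set .row []).get .cnt = [] := h2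
      simp only [h1', List.drop_nil, h2', ne_eq, not_true_eq_false, and_false, decide_false,
        Bool.or_false, Bool.false_eq_true, if_false]
      refine (runs_ret _).congr rfl ?_ le_rfl
      simp [Store.set]
    · have hC4 : 4 * C ≠ 0 := by omega
      obtain ⟨h, h1, h2, h3, h4⟩ := ih
        ((s.row.drop 4).length + (s.cnt.drop (4 * C)).length)
        (by simp only [List.length_drop]; omega) (s := { s with
          row := s.row.drop 4
          cnt := s.cnt.drop (4 * C)
          thr := .inl .tick :: s.thr
          don := List.replicate 4 a₀ ++ s.don }) rfl
      simp only [List.length_drop] at h2 h3 h4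
      refine ⟨h + 1, fun ω => Runs.congr
        (Runs.loop_again (T := 14 + (3 * (4 * C) + 2 + (5 + 2))) ?_ (h1 ω))
        rfl ?_ (by ring_nf; omega), by omega, by ring_nf at h3 ⊢; omega, fun n hn hn' => ?_⟩
      · refine (runs_popMany .row 4).bind ((runs_popMany .cnt (4 * C)).bind ?_)
        have hb : (decide (4 ≠ 0 ∧ s.get .row ≠ []) ||
            decide (4 * C ≠ 0 ∧ (s.set .row ((s.get .row).drop 4)).get .cnt ≠ [])) = true := by
          simp only [Bool.or_eq_true, decide_eq_true_eq]
          by_cases hr : s.row = []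
          · refine .inr ⟨hC4, fun hc => hz ?_⟩
            have hc' : s.cnt = [] := hc
            rw [← hN, hr, hc']
            rfl
          · exact .inl ⟨by norm_num, hr⟩
        rw [if_pos hb]
        exact (runs_bump a₀).andThen (runs_ret _)
      · simp only [← List.append_assoc, List.replicate_append_replicate, List.replicate_succ' (n := h),
          Nat.mul_add, Nat.mul_one]
        simp
      -- For `n < 4` the first unit already uses everything up, so the hypothesis is applied with 0
      -- in place of `n - 4`.
      · rcases Nat.lt_or_ge n 4 with hn4 | hn4
        · have hCn : C * n ≤ C * 3 := Nat.mul_le_mul_left _ (by omega)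
          have h5 := h4 0 (by omega) (by omega)
          rcases Nat.eq_zero_or_pos n with rfl | hn0
          · simp only [Nat.mul_zero] at hn'
            omega
          · omega
        · have := h4 (n - 4) (by omega) (by
            have e : C * n = C * (n - 4) + 4 * C := by
              obtain ⟨j, rfl⟩ := Nat.exists_eq_add_of_le hn4
              simp; ring
            omega)
          omega

/-- Scan the formula to find out the number of its variables and of its clauses. -/
def countClauses (a₀ : CNFSym ⊕ X) : Code KA X Unit :=
  scan a₀ (fun _ _ => a₀) (fun _ _ _ => ()) (fun _ => (push .cnt (.inl .tick)).andThen <|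
    (push .blk (.inl (.literal false))).andThen <| (push .blk (.inl (.literal true))).andThen <|
      ret ()) ()

/-- Signs of blocks that come in pairs. -/
def pairSigns (n : ℕ) : List (CNFSym ⊕ X) :=
  (List.replicate n [.inl (.literal true), .inl (.literal false)]).flatten

omit [Finite X] in
theorem length_scanRow (a₀ : CNFSym ⊕ X) (act : Bool → CNFSym ⊕ X → CNFSym ⊕ X) (c : Clause)
    (r : List (CNFSym ⊕ X)) :
    r.length ≤ (scanRow a₀ act c r).length ∧ (∀ l ∈ c, l.1 < (scanRow a₀ act c r).length) ∧
      ∀ n, r.length ≤ n → (∀ l ∈ c, l.1 < n) → (scanRow a₀ act c r).length ≤ n := by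
  induction c generalizing r with
  | nil => exact ⟨le_rfl, by simp, fun n h _ => h⟩
  | cons l c ih =>
    obtain ⟨h1, h2, h3⟩ := ih (touch a₀ (act l.2) l.1 r)
    rw [length_touch] at h1 h3
    change _ ≤ (scanRow a₀ act c (touch a₀ (act l.2) l.1 r)).length ∧
      (∀ x ∈ l :: c, x.1 < (scanRow a₀ act c (touch a₀ (act l.2) l.1 r)).length) ∧
      ∀ n, _ → _ → (scanRow a₀ act c (touch a₀ (act l.2) l.1 r)).length ≤ n
    simp only [List.mem_cons, forall_eq_or_imp]
    exact ⟨by omega, ⟨by omega, h2⟩, fun n hn hl => h3 n (by omega) hl.2⟩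

/-- Only the length of `row` matters: reading a variable lengthens it past the index. Each clause
leaves one mark in `cnt` and a pair of signs in `blk`, pushed in reverse so that the positive one is
on top. -/
theorem runs_countClauses (a₀ : CNFSym ⊕ X) {α : CNF} (hinp : s.inp = (encodeCNF α).map .inl)
    (hs : s.aux = []) :
    ∃ r : List (CNFSym ⊕ X), (∀ ω, Runs (countClauses a₀) ω s () { s with
        inp := []
        bak := ((encodeCNF α).map .inl).reverse ++ s.bak
        row := r
        cnt := List.replicate α.length (.inl .tick) ++ s.cnt
        blk := pairSigns α.length ++ s.blk } (12 * (encodeCNF α).length + 5 * α.length + 3)) ∧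
      s.row.length ≤ r.length ∧ (∀ c ∈ α, ∀ l ∈ c, l.1 < r.length) ∧
      ∀ n, s.row.length ≤ n → (∀ c ∈ α, ∀ l ∈ c, l.1 < n) → r.length ≤ n := by
  induction α generalizing s with
  | nil =>
    refine ⟨s.row, fun ω => ?_, le_rfl, by simp, fun n h _ => h⟩
    refine (runs_scan_nil (by simpa [encodeCNF] using hinp)).congr rfl ?_ (by simp)
    cases s
    simpa [encodeCNF, pairSigns] using hinp
  | cons c α ih =>
    set s₁ : Store KA (CNFSym ⊕ X) := { s with
      inp := (encodeCNF α).map .inl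
      bak := ((c.flatMap encodeLiteral ++ [CNFSym.endClause]).map .inl).reverse ++ s.bak
      row := scanRow a₀ (fun _ _ => a₀) c s.row } with hs₁
    obtain ⟨r, h1, h2, h3, h4⟩ := ih (s := { s₁ with
      cnt := .inl .tick :: s.cnt
      blk := .inl (.literal true) :: .inl (.literal false) :: s.blk }) rfl hs
    obtain ⟨e1, e2, e3⟩ := length_scanRow a₀ (fun _ _ => a₀) c s.row
    have h5 : ∀ ω, Runs ((push .cnt (.inl .tick)).andThen <|
        (push .blk (.inl (.literal false))).andThen <|
          (push .blk (.inl (.literal true))).andThen <| ret ()) ω s₁ () { s₁ with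
        cnt := .inl .tick :: s.cnt
        blk := .inl (.literal true) :: .inl (.literal false) :: s.blk } (1 + (1 + (1 + 2))) :=
      fun ω => (runs_push _ _).andThen <| (runs_push _ _).andThen <| (runs_push _ _).andThen <| runs_ret _
    refine ⟨r, fun ω => Runs.congr (runs_scan_clause (c := c) (w := (encodeCNF α).map .inl)
      (fin := fun _ => (push .cnt (.inl .tick)).andThen <|
        (push .blk (.inl (.literal false))).andThen <|
          (push .blk (.inl (.literal true))).andThen <| ret ())
      (by simpa [encodeCNF] using hinp) hs (h5 ω) (h1 ω)) rfl ?_ ?_, e1.trans h2, ?_, fun n hn hl => ?_⟩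
    · simp [encodeCNF, hs₁, pairSigns, List.replicate_succ', List.append_assoc]
    · simp [encodeCNF]; omega
    · simp only [List.mem_cons, forall_eq_or_imp]
      exact ⟨fun l hl => (e2 l hl).trans_le h2, h3⟩
    · simp only [List.mem_cons, forall_eq_or_imp] at hl
      exact h4 n (e3 n hn hl.1) hl.2

end Count

/-! ### Writing the whole network -/

section Write

variable {KA Y : Type} [DecidableEq KA] [Finite Y] {θr θ : Finset ℝ} [Inhabited θ] {k : ℕ}

/-- Write the network of a formula. -/
def writeNet (C : ℕ) (em : NetSym θ → CNFSym ⊕ (Cell k ⊕ Y)) {p : ℕ}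
    (W₁ : Matrix (Fin p) (Fin 1) θr) (b₁ : Fin p → θr) (rest : Net θr p) :
    Code KA (Cell k ⊕ Y) Unit :=
  (push .blk (.inl (.literal false))).andThen <| (push .blk (.inl (.literal true))).andThen <|
  (countClauses (cell 0)).andThen <| (move .bak .inp).andThen <|
  (countUnits C (cell 0)).andThen <| (bump (cell 0)).andThen <| (move .don .row).andThen <|
  (emitForm em W₁ b₁ (Cell.clamp k 1)).andThen <| (emitForm em W₁ b₁ (Cell.clamp k 1)).andThen <|
  (scan (cell 0) addLiteral countNeg (emitClause em W₁ b₁) (Cell.clamp k 0)).bind fun _ =>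
  (emit [em .endLayer]).andThen (parallelCode em W₁ b₁ rest rest)

omit [Finite Y] in
theorem pairSigns_eq_items {m : ℕ} (α : CNF) :
    (pairSigns (α.length + 1) : List (CNFSym ⊕ (Cell k ⊕ Y))) =
      (CNF.items m α).map fun f => .inl (.literal f.1) := by
  have h : ∀ α : CNF, (pairSigns α.length : List (CNFSym ⊕ (Cell k ⊕ Y))) =
      (α.flatMap fun c => [(true, Clause.form m c), (false, Net.Form.one m)]).map
        fun f => .inl (.literal f.1) := by
    intro α
    induction α with
    | nil => simp [pairSigns]
    | cons c α ih =>
      simp only [pairSigns] at ih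
      simp [pairSigns, List.replicate_succ, ih]
  have h' := h α
  simp only [pairSigns] at h'
  simp [pairSigns, CNF.items, List.replicate_succ, h']

/-- One unit beyond the count makes `h` positive and leaves room for the extra pair of blocks; this
is why 3 superfluous inputs become 7. No coin is flipped, so a machine called afterwards sees the
coins from the beginning. The word is left reversed, with its last symbol on top. -/
theorem exists_runs_writeNet (hk : 1 ≤ k) {C : ℕ} (hC : 1 ≤ C)
    (em : NetSym θ → CNFSym ⊕ (Cell k ⊕ Y)) {p : ℕ} (W₁ : Matrix (Fin p) (Fin 1) θr)
    (b₁ : Fin p → θr) (rest : Net θr p) :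
    ∃ a : ℕ, ∀ (α : CNF), (∀ c ∈ α, c.length ≤ k) → ∃ h, 1 ≤ h ∧
      (∀ c ∈ α, ∀ l ∈ c, l.1 < 2 * (2 * h)) ∧ α.length + 1 ≤ C * (2 * (2 * h)) ∧
      (∀ n, (∀ c ∈ α, ∀ l ∈ c, l.1 < n) → α.length ≤ C * n → 2 * (2 * h) ≤ n + 7) ∧
      ∀ ω, ∃ s' : Store KA (CNFSym ⊕ (Cell k ⊕ Y)),
        Runs (writeNet C em W₁ b₁ rest) ω (initStore KA (encodeCNF α)) () s'
          (a * ((encodeCNF α).length + α.length + h + 1) ^ 2) ∧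
        s'.ext = (fun _ => []) ∧ s'.aux = [] ∧ s'.ans = [] ∧ s'.coins = 0 ∧
        s'.thr = List.replicate h (.inl .tick) ∧
        s'.net = ((encodeNet (Net.ofForms θ (CNF.items (2 * (2 * h)) α) W₁ b₁ rest)).map
          em).reverse := by
  obtain ⟨a, ha⟩ := exists_runs_parallelCode (KA := KA) em W₁ b₁ rest rest
  -- The number of blocks plus one is at most twice the base of the square, which gives `4 * a`. The
  -- rest is a generous bound for the linear passes and the first layer.
  refine ⟨4 * a + 1000 * (p + C + 10), fun α hα => ?_⟩
  let s₀ : Store KA (CNFSym ⊕ (Cell k ⊕ Y)) := initStore KA (encodeCNF α)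
  let s₁ : Store KA (CNFSym ⊕ (Cell k ⊕ Y)) := { s₀ with blk := pairSigns 1 }
  obtain ⟨r, h1, -, hr1, hr2⟩ := runs_countClauses (s := s₁) (cell 0) (α := α) rfl rfl
  let s₂ : Store KA (CNFSym ⊕ (Cell k ⊕ Y)) := { s₁ with
    row := r
    cnt := List.replicate α.length (.inl .tick) ++ []
    blk := pairSigns α.length ++ pairSigns 1 }
  obtain ⟨h', h2, hh1, hh2, hh3⟩ := runs_countUnits (s := s₂) hC (cell 0)
  have hcnt : s₂.cnt.length = α.length := by simp [s₂]
  rw [hcnt] at hh2 hh3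
  have hm : 2 * (2 * (h' + 1)) = 4 * h' + 4 := by ring
  have hα' : ∀ c ∈ α, ∀ l ∈ c, l.1 < 2 * (2 * (h' + 1)) := fun c hc l hl => by
    have := hr1 c hc l hl
    have : r.length ≤ 4 * h' := hh1
    omega
  have hblk : (pairSigns α.length ++ pairSigns 1 : List (CNFSym ⊕ (Cell k ⊕ Y))) =
      pairSigns (α.length + 1) := by
    simp [pairSigns, List.replicate_succ']
  refine ⟨h' + 1, by omega, hα', ?_, fun n hn hn' => ?_, fun ω => ?_⟩
  · rw [hm, Nat.mul_add]
    omega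
  · have := hh3 n (hr2 n (Nat.zero_le _) hn) hn'
    omega
  set m := 2 * (2 * (h' + 1)) with hm'
  let s₃ : Store KA (CNFSym ⊕ (Cell k ⊕ Y)) := { s₂ with
    row := List.replicate m (cell 0)
    cnt := []
    thr := List.replicate (h' + 1) (.inl .tick) }
  let one : List (CNFSym ⊕ (Cell k ⊕ Y)) := ((Net.formWord W₁ b₁ (.one m)).map em).reverse
  let body : List (NetSym θ) := α.flatMap fun c => Net.formWord W₁ b₁ (Clause.form m c) ++
    Net.formWord W₁ b₁ (.one m)
  let s₄ : Store KA (CNFSym ⊕ (Cell k ⊕ Y)) := { s₃ with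
    inp := []
    bak := ((encodeCNF α).map .inl).reverse ++ []
    net := em .endLayer :: ((body.map em).reverse ++ (one ++ (one ++ []))) }
  have e1 : Runs (move .bak .inp) ω { s₂ with
      inp := []
      bak := ((encodeCNF α).map .inl).reverse ++ [] } () s₂ ((encodeCNF α).length * 6 + 3) := by
    refine (runs_move (by decide) (by decide) (by decide)).congr rfl ?_ ?_
    · simp [Store.set, Store.get, s₂, s₁, s₀, initStore]
    · simp [Store.get]
  have e2 := runs_bump (ω := ω) (cell 0) (s := { s₂ with
    row := []
    cnt := []
    thr := List.replicate h' (.inl .tick) ++ s₂.thr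
    don := List.replicate (4 * h') (cell 0) ++ s₂.don })
  have e3 : Runs (move .don .row) ω { s₂ with
      row := []
      cnt := []
      thr := .inl .tick :: (List.replicate h' (.inl .tick) ++ s₂.thr)
      don := List.replicate 4 (cell 0) ++ (List.replicate (4 * h') (cell 0) ++ s₂.don) } () s₃
      (m * 6 + 3) := by
    refine (runs_move (by decide) (by decide) (by decide)).congr rfl ?_ ?_
    · simp only [Store.set, Store.get, s₃, s₂, s₁, s₀, initStore, List.append_nil,
        List.replicate_append_replicate, List.reverse_replicate, ← List.replicate_succ, hm]
      rw [add_comm 4]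
    · simp [Store.get, s₂, s₁, s₀, initStore]
      omega
  have e4 := runs_emitForm (ω := ω) em W₁ b₁ (one_form_le hk m) (s := s₃) rfl (formRow_one m).symm
  have e5 := runs_emitForm (ω := ω) em W₁ b₁ (one_form_le hk m)
    (s := { s₃ with net := one ++ [] }) rfl (formRow_one m).symm
  have e6 := runs_scan_emitClause (ω := ω) hk em W₁ b₁ (α := α) (m := m)
    (s := { s₃ with net := one ++ (one ++ []) }) (fun c hc => ⟨hα c hc, hα' c hc⟩) rfl rfl
    rfl
  have e7 : Runs (emit [em .endLayer]) ω _ () s₄ 3 := runs_emit (ω := ω) (s := { s₃ with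
    inp := []
    bak := ((encodeCNF α).map .inl).reverse ++ []
    net := (body.map em).reverse ++ (one ++ (one ++ [])) }) [em .endLayer]
  have e8 := ha (CNF.items m α) ω s₄ rfl rfl (hblk.trans (pairSigns_eq_items α))
  refine ⟨_, Runs.mono ((runs_push _ _).andThen <| (runs_push _ _).andThen <| (h1 ω).andThen <|
    e1.andThen <| (h2 ω).andThen <| e2.andThen <| e3.andThen <| e4.andThen <| e5.andThen <|
    e6.bind <| e7.andThen e8) ?_, rfl, rfl, rfl, rfl, rfl, ?_⟩
  · rw [CNF.length_items]
    set N := (encodeCNF α).length + α.length + (h' + 1) + 1 with hN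
    have hN1 : N ≤ N ^ 2 := Nat.le_self_pow (by norm_num) _
    have hN2 : (2 * (α.length + 1) + 1) ^ 2 ≤ (2 * N) ^ 2 := Nat.pow_le_pow_left (by omega) 2
    have hN3 : a * (2 * (α.length + 1) + 1) ^ 2 ≤ a * (2 * N) ^ 2 := Nat.mul_le_mul_left _ hN2
    have hN4 : (28 * p + 12) * (α.length * (m + 1)) ≤ (28 * p + 12) * (5 * N ^ 2) := by
      rw [show 5 * N ^ 2 = N * (5 * N) by ring]
      exact Nat.mul_le_mul_left _ (Nat.mul_le_mul (by omega) (by omega))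
    have hN5 : p * (14 * m + 10) ≤ p * (66 * N ^ 2) := Nat.mul_le_mul_left _ (by omega)
    have hN6 : (h' + 1) * (12 * C + 30) ≤ N ^ 2 * (12 * C + 30) :=
      Nat.mul_le_mul_right _ (by omega)
    rw [show α.length * ((28 * p + 12) * (m + 1) + 2) =
      (28 * p + 12) * (α.length * (m + 1)) + 2 * α.length by ring]
    have hexp : (4 * a + 1000 * (p + C + 10)) * N ^ 2 = a * (2 * N) ^ 2 +
      (28 * p + 12) * (5 * N ^ 2) + 2 * (p * (66 * N ^ 2)) + N ^ 2 * (12 * C + 30) +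
        (728 * (p * N ^ 2) + 988 * (C * N ^ 2) + 9910 * N ^ 2) := by ring
    omega
  · rw [Net.encodeNet_ofForms]
    generalize encodeNet (Net.parallel θ (fun c => ((CNF.items m α).get c).1) W₁ b₁ rest rest) = E
    simp [s₄, body, one, CNF.items, List.flatMap_assoc]

end Write

end Code

/-! ### Stacks grow by at most one symbol per step -/

theorem Instr.length_exec_le {K Γ Λ : Type} [DecidableEq K] {ω : ℕ → Bool} {i : Instr K Γ Λ}
    {m m' : Memory K Γ} {l : Λ} (h : i.exec ω m = some (l, m')) (k : K) :
    (m'.stk k).length ≤ (m.stk k).length + 1 := by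
  cases i <;> simp only [exec, Option.some.injEq, Prod.mk.injEq, reduceCtorEq] at h
  all_goals
    obtain ⟨-, rfl⟩ := h
    simp only [Function.update_apply]
    try split_ifs with hk
    all_goals simp_all
  omega

theorem Routine.Path.length_le {K Γ E : Type} [DecidableEq K] {p : Routine K Γ E} {ω : ℕ → Bool}
    {l m e m' t} (h : p.Path ω l m e m' t) (k : K) :
    (m'.stk k).length ≤ (m.stk k).length + t := by
  induction h with
  | exit h => exact Instr.length_exec_le h k
  | next h _ ih =>
    have := Instr.length_exec_le h k
    omega

/-- The written word is no longer than the time spent writing it, so the size of the network needs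
no separate count. -/
theorem Code.Runs.length_net_le {KA X E : Type} [DecidableEq KA] {p : Code KA X E} {ω : ℕ → Bool}
    {s s' : Store KA (CNFSym ⊕ X)} {e : E} {T : ℕ} (h : Code.Runs p ω s e s' T) :
    s'.net.length ≤ s.net.length + T := by
  obtain ⟨t, ht, h⟩ := h
  have : s'.net.length ≤ s.net.length + t := h.length_le (.inr .net)
  omega

namespace ProbMachine

variable {ι ο : Type} (M : ProbMachine ι ο) (ω : ℕ → Bool)

theorem length_step_le (c : M.Cfg) (k : M.K) :
    ((M.step ω c).stk k).length ≤ (c.stk k).length + 1 := by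
  unfold step
  cases M.prog c.state <;> dsimp only
  · simp only [Function.update_apply]
    split_ifs with hk <;> simp_all
  · simp only [Function.update_apply]
    split_ifs with hk <;> simp_all; omega
  · omega
  · omega

theorem length_iterate_le (t : ℕ) (c : M.Cfg) (k : M.K) :
    (((M.step ω)^[t] c).stk k).length ≤ (c.stk k).length + t := by
  induction t with
  | zero => rfl
  | succ t ih =>
    rw [Function.iterate_succ_apply']
    have := M.length_step_le ω ((M.step ω)^[t] c) k
    omega

end ProbMachine

/-! ### Calling a machine -/

namespace Code

section Call

variable {ι ο X : Type} (A : ProbMachine ι ο) (emb : A.Γ → CNFSym ⊕ X)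
  (rd : CNFSym ⊕ X → Option A.Γ) {ω : ℕ → Bool}

/-- The instructions of `A`, on its own stacks. -/
def liftInstr {E : Type} : Instr A.K A.Γ A.Λ → Instr (A.K ⊕ Reg) (CNFSym ⊕ X) ((A.Λ ⊕ Unit) ⊕ E)
  | .push k a n => .push (.inl k) (emb a) (.inl (.inl n))
  | .pop k g => .pop (.inl k) fun o => .inl (.inl (g (o.bind rd)))
  | .flip g => .flip fun b => .inl (.inl (g b))
  | .halt => .push default default (.inl (.inr ()))

/-- Run `A` on its own stacks. -/
def call : Code A.K X Unit where
  Λ := A.Λ ⊕ Unit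
  start := .inl A.start
  prog
    | .inl l => liftInstr A emb rd (A.prog l)
    | .inr _ => .pop default fun _ => .inr ()

/-- The stacks and the coins of `A` within a store. -/
def withCfg (s : Store A.K (CNFSym ⊕ X)) (c : A.Cfg) : Store A.K (CNFSym ⊕ X) :=
  { s with
    ext := fun k => (c.stk k).map emb
    coins := c.coins }

theorem withCfg_update (s : Store A.K (CNFSym ⊕ X)) (c : A.Cfg) (l : A.Λ) (k : A.K)
    (w : List A.Γ) :
    (withCfg A emb s ⟨l, Function.update c.stk k w, c.coins⟩).toMemory =
      ⟨Function.update (withCfg A emb s c).toMemory.stk (.inl k) (w.map emb),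
        (withCfg A emb s c).toMemory.coins⟩ := by
  rw [← Store.toMemory_setExt]
  congr 1
  simp only [withCfg]
  congr 1
  funext k'
  by_cases h : k' = k
  · subst h
    simp
  · simp [h]

/-- Each step of `A` is one step of the simulation with the same coin, and halting becomes a push
undone by a pop. The time `t` need not be the first halting time, since a halted configuration stays
put. -/
theorem path_call (hrd : ∀ a, rd (emb a) = some a) (s : Store A.K (CNFSym ⊕ X)) (t : ℕ)
    (c : A.Cfg) (h : A.Halted ((A.step ω)^[t] c)) :
    ∃ t' ≤ t + 2, (call A emb rd).Path ω (.inl c.state) (withCfg A emb s c).toMemory ()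
      (withCfg A emb s ((A.step ω)^[t] c)).toMemory t' := by
  induction t generalizing c with
  | zero =>
    have h' : A.prog c.state = .halt := h
    refine ⟨2, by omega, .next (l' := (Sum.inr () : A.Λ ⊕ Unit))
      (m' := ⟨Function.update (withCfg A emb s c).toMemory.stk default
        (default :: (withCfg A emb s c).toMemory.stk default), (withCfg A emb s c).toMemory.coins⟩)
      ?_ (.exit ?_)⟩
    · simp only [call, h', liftInstr, Instr.exec]
    · simp [call, Instr.exec]
  | succ t ih =>
    by_cases hc : A.Halted c
    · have e : ∀ t, (A.step ω)^[t] c = c := fun t =>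
        Function.iterate_fixed (ProbMachine.step_of_halted hc) t
      obtain ⟨t', ht', h1⟩ := ih c (by rw [e]; exact hc)
      rw [e] at h1 ⊢
      exact ⟨t', by omega, h1⟩
    · rw [Function.iterate_succ_apply] at h ⊢
      obtain ⟨t', ht', h1⟩ := ih _ h
      refine ⟨t' + 1, by omega, .next ?_ h1⟩
      simp only [call]
      unfold ProbMachine.step
      cases hp : A.prog c.state with
      | push k a n =>
        dsimp only
        rw [withCfg_update]
        rfl
      | pop k g =>
        dsimp only
        rw [withCfg_update]
        simp only [liftInstr, Instr.exec, Option.some.injEq, Prod.mk.injEq, Sum.inl.injEq]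
        have hk : (withCfg A emb s c).toMemory.stk (.inl k) = (c.stk k).map emb := rfl
        rw [hk]
        refine ⟨?_, by rw [List.map_tail]⟩
        cases c.stk k <;> simp [hrd]
      | flip g => rfl
      | halt => exact absurd hp hc

theorem runs_call (hrd : ∀ a, rd (emb a) = some a) (s : Store A.K (CNFSym ⊕ X)) {t : ℕ}
    {x : List ι} (h : A.Halted (A.run x ω t)) :
    Runs (call A emb rd) ω (withCfg A emb s (A.init x)) () (withCfg A emb s (A.run x ω t))
      (t + 2) :=
  path_call A emb rd hrd s t (A.init x) h

/-- Move the contents of `net` to the input stack of `A`. -/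
def load [Finite X] : Code A.K X Unit :=
  loop (S := Unit) (fun _ => (pop .net).bind fun o => match o with
    | some a => andThen (Routine.push (.inl A.inStack) a) (ret (.inl ()))
    | none => ret (.inr ())) ()

theorem runs_pushExt {KA : Type} [DecidableEq KA] (k : KA) (a : CNFSym ⊕ X)
    (s : Store KA (CNFSym ⊕ X)) :
    Runs (Routine.push (.inl k) a) ω s ()
      { s with ext := Function.update s.ext k (a :: s.ext k) } 1 := by
  refine ⟨1, le_rfl, ?_⟩
  rw [Store.toMemory_setExt]
  exact Routine.path_push _ _ _

theorem runs_popExt {KA : Type} [DecidableEq KA] (k : KA) (s : Store KA (CNFSym ⊕ X)) :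
    Runs (Routine.pop (.inl k)) ω s (s.ext k).head?
      { s with ext := Function.update s.ext k (s.ext k).tail } 1 := by
  refine ⟨1, le_rfl, ?_⟩
  rw [Store.toMemory_setExt]
  exact Routine.path_pop _ _

/-- Unloading one stack onto another reverses it, which turns the reversed word in `net` into the
proper input of `A`. -/
theorem runs_load [Finite X] (s : Store A.K (CNFSym ⊕ X)) :
    Runs (load A) ω s ()
      { s with
        net := []
        ext := Function.update s.ext A.inStack (s.net.reverse ++ s.ext A.inStack) }
      (4 * s.net.length + 3) := by
  induction hn : s.net generalizing s with
  | nil =>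
    have h1 : s.get .net = [] := hn
    refine Runs.loop_exit (Runs.mono (T := 1 + 2) ((runs_pop _).bind ?_) (by simp))
    rw [h1]
    refine (runs_ret _).congr rfl ?_ le_rfl
    simp [Store.set]
  | cons a w ih =>
    have h1 : s.get .net = a :: w := hn
    refine Runs.congr (Runs.loop_again (T := 1 + (1 + 2)) (y := ()) ((runs_pop _).bind ?_)
      (ih (s := { s with
        net := w
        ext := Function.update s.ext A.inStack (a :: s.ext A.inStack) }) rfl)) rfl ?_ ?_
    · rw [h1]
      exact (runs_pushExt _ _ _).andThen (runs_ret _)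
    · simp
    · simp; omega

end Call

/-! ### Judging a number -/

/-- The number `0.b₁b₂…` has a digit `1` among the first `N` digits. -/
def fracVerdict : List NumSym → ℕ → Bool
  | .digit true :: _, _ + 1 => true
  | .digit false :: w, N + 1 => fracVerdict w N
  | _, _ => false

/-- The number is positive and has a digit `1` up to the `N`-th digit after the point. -/
def verdict : List NumSym → ℕ → Bool
  | .digit true :: _, _ => true
  | .digit false :: w, N => verdict w N
  | .point :: w, N => fracVerdict w N
  | _, _ => false

theorem fracValue_nonneg (fp : List Bool) : 0 ≤ fracValue fp := by
  induction fp with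
  | nil => simp [fracValue]
  | cons b l ih => rw [fracValue]; split_ifs <;> positivity

theorem fracValue_le_one (fp : List Bool) : fracValue fp ≤ 1 := by
  induction fp with
  | nil => simp [fracValue]
  | cons b l ih => rw [fracValue]; split_ifs <;> linarith

theorem fracVerdict_spec (fp : List Bool) (N : ℕ) :
    (fracVerdict (fp.map .digit) N = true → (1 / 2 : ℝ) ^ N ≤ fracValue fp) ∧
      (fracVerdict (fp.map .digit) N = false → fracValue fp ≤ (1 / 2 : ℝ) ^ N) := by
  induction fp generalizing N with
  | nil =>
    refine ⟨by simp [fracVerdict], fun _ => ?_⟩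
    simp [fracValue]
  | cons b l ih =>
    have h0 := fracValue_nonneg l
    cases N with
    | zero =>
      refine ⟨by simp [fracVerdict], fun _ => ?_⟩
      simpa using fracValue_le_one (b :: l)
    | succ N =>
      have hN : (1 / 2 : ℝ) ^ N ≤ 1 := pow_le_one₀ (by norm_num) (by norm_num)
      cases b with
      | true =>
        refine ⟨fun _ => ?_, by simp [fracVerdict]⟩
        rw [fracValue, pow_succ, if_pos rfl]
        linarith
      | false =>
        simp only [List.map_cons, fracVerdict, fracValue, pow_succ, Bool.false_eq_true, if_false]
        exact ⟨fun h => by linarith [(ih N).1 h], fun h => by linarith [(ih N).2 h]⟩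

theorem foldl_digits_le (ip : List Bool) (v : ℝ) (hv : 0 ≤ v) :
    v ≤ ip.foldl (fun v b => 2 * v + (if b then 1 else 0)) v := by
  induction ip generalizing v with
  | nil => rfl
  | cons b l ih =>
    rw [List.foldl_cons]
    have h : v ≤ 2 * v + (if b then 1 else 0 : ℝ) := by split_ifs <;> linarith
    exact h.trans (ih _ (hv.trans h))

/-- A digit 1 up to place `N` after the point contributes at least `2 ^ -N`; without one, the tail
contributes at most this much. Negative numerals have value at most 0. Non-strict bounds suffice
because the approximation error is strictly below the threshold. -/
theorem verdict_spec (neg : Bool) (ip fp : List Bool) (N : ℕ) :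
    (verdict (numeral neg ip fp) N = true → (1 / 2 : ℝ) ^ N ≤ numeralValue neg ip fp) ∧
      (verdict (numeral neg ip fp) N = false → numeralValue neg ip fp ≤ (1 / 2 : ℝ) ^ N) := by
  have h0 := fracValue_nonneg fp
  have hN : (1 / 2 : ℝ) ^ N ≤ 1 := pow_le_one₀ (by norm_num) (by norm_num)
  cases neg with
  | true =>
    refine ⟨by simp [numeral, verdict], fun _ => ?_⟩
    have h1 := foldl_digits_le ip 0 le_rfl
    have h2 : (0 : ℝ) ≤ (1 / 2) ^ N := by positivity
    simp only [numeralValue, if_true]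
    linarith
  | false =>
    simp only [numeral, numeralValue, Bool.false_eq_true, if_false, List.nil_append, one_mul]
    induction ip with
    | nil => simpa [verdict] using fracVerdict_spec fp N
    | cons b l ih =>
      cases b with
      | true =>
        refine ⟨fun _ => ?_, by simp [verdict]⟩
        have h1 := foldl_digits_le l 1 (by norm_num)
        simp only [List.foldl_cons, if_true, mul_zero, zero_add]
        linarith
      | false => simpa [verdict] using ih

section Judge

variable {ι X : Type} [Finite X] (A : ProbMachine ι NumSym) (emb : A.Γ → CNFSym ⊕ X)
  (rd : CNFSym ⊕ X → Option A.Γ) {ω : ℕ → Bool}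

/-- Read a symbol of the output of `A`. -/
def judgeSym {F : Type} (f : Option NumSym → Code A.K X F) : Code A.K X F :=
  bind (Routine.pop (.inl A.outStack)) fun o => f ((o.bind rd).map A.outSym)

/-- Judge the output of `A`, up to as many digits after the point as there are symbols in `thr`. -/
def judge : Bool → Code A.K X Bool :=
  loop (S := Bool) fun
    | false => judgeSym A rd fun
      | some (.digit true) => ret (.inr true)
      | some (.digit false) => ret (.inl false)
      | some .point => ret (.inl true)
      | _ => ret (.inr false)
    | true => (pop .thr).bind fun
      | none => ret (.inr false)
      | some _ => judgeSym A rd fun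
        | some (.digit true) => ret (.inr true)
        | some (.digit false) => ret (.inl true)
        | _ => ret (.inr false)

theorem runs_judgeSym (hrd : ∀ a, rd (emb a) = some a) {F : Type}
    {f : Option NumSym → Code A.K X F} {s s' : Store A.K (CNFSym ⊕ X)} {w : List A.Γ}
    (hw : s.ext A.outStack = w.map emb) {e : F} {T : ℕ}
    (h : Runs (f (w.map A.outSym).head?) ω
      { s with ext := Function.update s.ext A.outStack (w.tail.map emb) } e s' T) :
    Runs (judgeSym A rd f) ω s e s' (1 + T) := by
  refine (runs_popExt _ _).bind ?_
  rw [hw]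
  convert h using 2
  · cases w <;> simp [hrd]
  · simp

theorem runs_judge_frac (hrd : ∀ a, rd (emb a) = some a) {s : Store A.K (CNFSym ⊕ X)}
    {w : List A.Γ} (hw : s.ext A.outStack = w.map emb) :
    ∃ s', Runs (judge A rd true) ω s (fracVerdict (w.map A.outSym) s.thr.length) s'
      (4 * w.length + 4) ∧ s'.ans = s.ans := by
  induction w generalizing s with
  | nil =>
    cases hthr : s.thr with
    | nil =>
      refine ⟨{ s with thr := [] },
        Runs.loop_exit (Runs.mono (T := 1 + 2) ((runs_pop _).bind ?_) (by simp)), rfl⟩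
      rw [show s.get .thr = [] from hthr]
      exact runs_ret _
    | cons a l =>
      refine ⟨{ s with
          thr := l
          ext := Function.update s.ext A.outStack [] },
        Runs.loop_exit (Runs.mono (T := 1 + (1 + 2)) ((runs_pop _).bind ?_) (by simp)), rfl⟩
      rw [show s.get .thr = a :: l from hthr]
      exact runs_judgeSym A emb rd hrd (s := { s with thr := l }) (w := []) hw (runs_ret _)
  | cons b w ih =>
    cases hthr : s.thr with
    | nil =>
      have hv : fracVerdict ((b :: w).map A.outSym) 0 = false := by
        simp [fracVerdict]
      refine ⟨{ s with thr := [] },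
        Runs.loop_exit (Runs.mono (T := 1 + 2) ((runs_pop _).bind ?_) (by simp)), rfl⟩
      rw [show s.get .thr = [] from hthr, List.length_nil, hv]
      exact runs_ret _
    | cons a l =>
      obtain ⟨s', h1, h2⟩ := ih (s := { s with
        thr := l
        ext := Function.update s.ext A.outStack (w.map emb) }) (by simp)
      have key : ∀ {e : Bool ⊕ Bool}, Runs (match some (A.outSym b) with
            | some (.digit true) => ret (.inr true)
            | some (.digit false) => ret (.inl true)
            | _ => ret (.inr false)) ω { s with
              thr := l
              ext := Function.update s.ext A.outStack (w.map emb) } e { s with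
              thr := l
              ext := Function.update s.ext A.outStack (w.map emb) } 2 → Runs ((pop .thr).bind fun
            | none => ret (.inr false)
            | some _ => judgeSym A rd fun
              | some (.digit true) => ret (.inr true)
              | some (.digit false) => ret (.inl true)
              | _ => ret (.inr false)) ω s e { s with
              thr := l
              ext := Function.update s.ext A.outStack (w.map emb) } (1 + (1 + 2)) := by
        intro e h
        refine (runs_pop _).bind ?_
        rw [show s.get .thr = a :: l from hthr]
        exact runs_judgeSym A emb rd hrd (s := { s with thr := l }) (w := b :: w) hw h
      have hT : 4 ≤ 4 * (b :: w).length + 4 := by simp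
      cases hb : A.outSym b with
      | digit x =>
        rw [hb] at key
        cases x with
        | true =>
          simp only [List.map_cons, hb, List.length_cons, fracVerdict]
          exact ⟨_, Runs.loop_exit ((key (runs_ret _)).mono hT), rfl⟩
        | false =>
          simp only [List.map_cons, hb, List.length_cons, fracVerdict]
          exact ⟨s', Runs.mono (Runs.loop_again (key (runs_ret _)) h1) (by omega), h2⟩
      | minus =>
        rw [hb] at key
        simp only [List.map_cons, hb, List.length_cons, fracVerdict]
        exact ⟨_, Runs.loop_exit ((key (runs_ret _)).mono hT), rfl⟩
      | point =>
        rw [hb] at key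
        simp only [List.map_cons, hb, List.length_cons, fracVerdict]
        exact ⟨_, Runs.loop_exit ((key (runs_ret _)).mono hT), rfl⟩

theorem runs_judge (hrd : ∀ a, rd (emb a) = some a) {s : Store A.K (CNFSym ⊕ X)}
    {w : List A.Γ} (hw : s.ext A.outStack = w.map emb) :
    ∃ s', Runs (judge A rd false) ω s (verdict (w.map A.outSym) s.thr.length) s'
      (4 * w.length + 4) ∧ s'.ans = s.ans := by
  induction w generalizing s with
  | nil =>
    exact ⟨_, Runs.loop_exit (Runs.mono (T := 1 + 2)
      (runs_judgeSym A emb rd hrd hw (runs_ret _)) (by simp)), rfl⟩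
  | cons b w ih =>
    have key {e : Bool ⊕ Bool} := runs_judgeSym (ω := ω) A emb rd hrd hw (e := e)
      (f := fun
        | some (.digit true) => ret (.inr true)
        | some (.digit false) => ret (.inl false)
        | some .point => ret (.inl true)
        | _ => ret (.inr false)) (T := 2) (s' := { s with
          ext := Function.update s.ext A.outStack (w.map emb) })
    simp only [List.map_cons, List.head?_cons, List.tail_cons] at key
    have hT : 3 ≤ 4 * (b :: w).length + 4 := by omega
    cases hb : A.outSym b with
    | digit x =>
      rw [hb] at key
      cases x with
      | true =>
        simp only [List.map_cons, hb, verdict]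
        exact ⟨_, Runs.loop_exit ((key (runs_ret _)).mono hT), rfl⟩
      | false =>
        obtain ⟨s', h1, h2⟩ := ih (s := { s with
          ext := Function.update s.ext A.outStack (w.map emb) }) (by simp)
        simp only [List.map_cons, hb, verdict]
        exact ⟨s', Runs.mono (Runs.loop_again (key (runs_ret _)) h1) (by simp; omega), h2⟩
    | minus =>
      rw [hb] at key
      simp only [List.map_cons, hb, verdict]
      exact ⟨_, Runs.loop_exit ((key (runs_ret _)).mono hT), rfl⟩
    | point =>
      obtain ⟨s', h1, h2⟩ := runs_judge_frac (ω := ω) A emb rd hrd (s := { s with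
        ext := Function.update s.ext A.outStack (w.map emb) }) (w := w) (by simp)
      rw [hb] at key
      simp only [List.map_cons, hb, verdict]
      exact ⟨s', Runs.mono (Runs.loop_again (key (runs_ret _)) h1) (by simp; omega), h2⟩

end Judge

end Code

/-! ### Deciding satisfiability with an approximation algorithm -/

namespace Code

section Decide

variable {θr θ : Finset ℝ} [Inhabited θ] {k : ℕ} (A : ProbMachine (NetSym θ) NumSym)

/-- The symbol of `A` that is written as a symbol of the calling machine. -/
def innerSym : CNFSym ⊕ (Cell k ⊕ A.Γ) → Option A.Γ
  | .inr (.inr a) => some a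
  | _ => none

/-- Write the network of a formula, call `A`, and judge the result. -/
def decideByNet (C : ℕ) {p : ℕ} (W₁ : Matrix (Fin p) (Fin 1) θr) (b₁ : Fin p → θr)
    (rest : Net θr p) : Code A.K (Cell k ⊕ A.Γ) Bool :=
  (writeNet C (fun x => .inr (.inr (A.inSym x))) W₁ b₁ rest).andThen <| (load A).andThen <|
    (push .thr (.inl .tick)).andThen <|
      (call A (fun a => .inr (.inr a)) (innerSym A)).andThen (judge A (innerSym A) false)

theorem exists_runs_decideByNet (hk : 1 ≤ k) {C : ℕ} (hC : 1 ≤ C) {p : ℕ}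
    (W₁ : Matrix (Fin p) (Fin 1) θr) (b₁ : Fin p → θr) (rest : Net θr p) :
    ∃ a : ℕ, ∀ (α : CNF), (∀ c ∈ α, c.length ≤ k) → ∃ h, 1 ≤ h ∧
      (∀ c ∈ α, ∀ l ∈ c, l.1 < 2 * (2 * h)) ∧ α.length + 1 ≤ C * (2 * (2 * h)) ∧
      (∀ n, (∀ c ∈ α, ∀ l ∈ c, l.1 < n) → α.length ≤ C * n → 2 * (2 * h) ≤ n + 7) ∧
      ∀ ω t, A.Halted (A.run
          (encodeNet (Net.ofForms θ (CNF.items (2 * (2 * h)) α) W₁ b₁ rest)) ω t) →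
        ∃ s' : Store A.K (CNFSym ⊕ (Cell k ⊕ A.Γ)),
          Runs (decideByNet A C W₁ b₁ rest) ω (initStore A.K (encodeCNF α))
            (verdict (((A.run (encodeNet (Net.ofForms θ (CNF.items (2 * (2 * h)) α) W₁ b₁ rest))
              ω t).stk A.outStack).map A.outSym) (h + 1)) s'
            (a * ((encodeCNF α).length + α.length + h + 1) ^ 2 + 5 * t) ∧
          s'.ans = [] := by
  obtain ⟨a, ha⟩ := exists_runs_writeNet (KA := A.K) (Y := A.Γ) hk hC
    (fun x => .inr (.inr (A.inSym x))) W₁ b₁ rest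
  refine ⟨9 * a + 10, fun α hα => ?_⟩
  obtain ⟨h, h1, h2, h3, h4, h5⟩ := ha α hα
  refine ⟨h, h1, h2, h3, h4, fun ω t ht => ?_⟩
  set x := encodeNet (Net.ofForms θ (CNF.items (2 * (2 * h)) α) W₁ b₁ rest) with hx
  set N := (encodeCNF α).length + α.length + h + 1 with hN
  obtain ⟨s₁, hr, hext, -, hans, hcoins, hthr, hnet⟩ := h5 ω
  let emb : A.Γ → CNFSym ⊕ (Cell k ⊕ A.Γ) := fun a => .inr (.inr a)
  let s₂ : Store A.K (CNFSym ⊕ (Cell k ⊕ A.Γ)) := { s₁ with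
    net := []
    thr := .inl .tick :: s₁.thr }
  -- The writing time bounds the input of `A`, hence also the cost of loading it and, together with
  -- `t`, the length of the output.
  have hlen : x.length ≤ a * N ^ 2 := by
    have := hr.length_net_le
    rw [hnet] at this
    simpa [initStore] using this
  have e1 : Runs (load A) ω s₁ () { s₁ with
      net := []
      ext := fun k => ((A.init x).stk k).map emb } (4 * (a * N ^ 2) + 3) := by
    refine (runs_load A s₁).congr rfl ?_ ?_
    · congr 1
      rw [hnet, hext]
      funext k'
      by_cases hk' : k' = A.inStack
      · subst hk'
        simp [ProbMachine.init, emb]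
      · simp [ProbMachine.init, hk']
    · rw [hnet]
      simp only [List.length_reverse, List.length_map]
      omega
  -- The extra mark makes the threshold `2 ^ -(h + 1)`, half of the gap. The store now matches the
  -- initial configuration of `A`, whose coin counter is zero; `hcoins` is needed here.
  have e2 : Runs (push .thr (.inl .tick)) ω { s₁ with
      net := []
      ext := fun k => ((A.init x).stk k).map emb } () (withCfg A emb s₂ (A.init x)) 1 := by
    refine (runs_push _ _).congr rfl ?_ le_rfl
    simp [withCfg, Store.set, Store.get, s₂, ProbMachine.init, hcoins]
  have e3 := runs_call A emb (innerSym A) (fun _ => rfl) s₂ ht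
  obtain ⟨s', e4, hs'⟩ := runs_judge (ω := ω) A emb (innerSym A) (fun _ => rfl)
    (s := withCfg A emb s₂ (A.run x ω t)) (w := (A.run x ω t).stk A.outStack) rfl
  have hout : ((A.run x ω t).stk A.outStack).length ≤ x.length + t := by
    refine (A.length_iterate_le ω t (A.init x) A.outStack).trans ?_
    have : ((A.init x).stk A.outStack).length ≤ x.length := by
      by_cases ho : A.outStack = A.inStack <;> simp [ProbMachine.init, ho]
    omega
  have hthr' : (withCfg A emb s₂ (A.run x ω t)).thr.length = h + 1 := by
    simp [withCfg, s₂, hthr]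
  rw [hthr'] at e4
  refine ⟨s', Runs.mono (hr.andThen <| e1.andThen <| e2.andThen <| e3.andThen e4) ?_, ?_⟩
  · have hN1 : 1 ≤ N ^ 2 := Nat.one_le_pow _ _ (by omega)
    have : (9 * a + 10) * N ^ 2 = 9 * (a * N ^ 2) + 10 * N ^ 2 := by ring
    omega
  · rw [hs']
    exact hans

end Decide

end Code

/-- Turns a bound on the running time into an actual halting time. The constant in `RunsInExpTime`
may be negative, whence the maximum with 0. -/
theorem ProbMachine.exists_halted_le {ι ο : Type} {M : ProbMachine ι ο} {x : List ι}
    {ω : ℕ → Bool} {b : ℝ} (h : ((M.time x ω : ℕ∞) : ℝ≥0∞) ≤ ENNReal.ofReal b) :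
    ∃ t : ℕ, M.Halted (M.run x ω t) ∧ (t : ℝ) ≤ max b 0 := by
  have htop : M.time x ω ≠ ⊤ := by
    intro h'
    rw [h'] at h
    simp at h
  obtain ⟨T, hT⟩ := ENat.ne_top_iff_exists.1 htop
  have hlt : M.time x ω < ((T + 1 : ℕ) : ℕ∞) := by
    rw [← hT]
    exact_mod_cast Nat.lt_succ_self T
  unfold ProbMachine.time at hlt
  simp only [iInf_lt_iff] at hlt
  obtain ⟨t, ht, htT⟩ := hlt
  refine ⟨t, ht, ?_⟩
  have h1 : t ≤ T := Nat.lt_succ_iff.1 (by exact_mod_cast htT)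
  rw [← hT] at h
  have h2 : ((T : ℕ) : ℝ≥0∞) ≤ ENNReal.ofReal b := by simpa using h
  have h3 : (T : ℝ) ≤ max b 0 := by
    rw [← ENNReal.ofReal_natCast] at h2
    rcases le_total 0 b with hb | hb
    · rw [max_eq_left hb]
      exact (ENNReal.ofReal_le_ofReal_iff hb).1 h2
    · rw [ENNReal.ofReal_of_nonpos hb, nonpos_iff_eq_zero, ENNReal.ofReal_eq_zero] at h2
      exact h2.trans (le_max_right _ _)
  exact (Nat.cast_le.2 h1).trans h3

/-! ### The reduction -/

section Main

variable {k C : ℕ} {σ : ℝ → ℝ} {wr Lr : ℕ} {θr θ : Finset ℝ} [Inhabited θ]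

/-- The `2 * (α.length + 1)` blocks fit into the width because the factor 2 is at most `k`. The
realization is a value of `r` at every real input, hence in `[0,1]`. -/
theorem ofForms_mem_mvmClass (hk : 2 ≤ k) {p : ℕ} {W₁ : Matrix (Fin p) (Fin 1) θr}
    {b₁ : Fin p → θr} {rest : Net θr p} (hΨ : Net.layer W₁ b₁ rest ∈ netClass 1 wr Lr θr)
    {r : ℝ → ℝ} (hr_mem : ∀ x, r x ∈ Set.Icc (0 : ℝ) 1)
    (hr_net : ∀ x : ℝ, (Net.layer W₁ b₁ rest).realize σ (fun _ => x) = r x)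
    (hθ : cnfWeights k θr ⊆ (θ : Set ℝ)) {α : CNF} (hα : ∀ c ∈ α, c.length ≤ k) {ℓ n : ℕ}
    (hℓ : 1 ≤ ℓ) (hn : ℓ ≤ n) (hC : α.length + 1 ≤ C * (2 * ℓ)) :
    (⟨ℓ, Net.ofForms θ (CNF.items (2 * ℓ) α) W₁ b₁ rest⟩ : Σ ℓ : ℕ, Net θ (2 * ℓ)) ∈
      mvmClass σ k C wr Lr θ n := by
  obtain ⟨⟨⟨-, hwr⟩, hw⟩, hdepth⟩ := hΨ
  have hC0 : 1 ≤ C := by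
    rcases Nat.eq_zero_or_pos C with rfl | h
    · omega
    · exact h
  refine ⟨hℓ, hn, ⟨Net.widthLE_ofForms (m := 2 * ℓ) W₁ b₁ (by omega) ?_ ?_ ?_ hw, ?_⟩, fun x _ => ?_⟩
  · calc 2 * ℓ ≤ 2 * n := by omega
      _ ≤ C * (2 * n) * wr * k := by
        rw [mul_assoc, mul_comm C, mul_assoc]
        refine Nat.le_mul_of_pos_right _ ?_
        have : 0 < k := by omega
        positivity
  · rw [CNF.length_items]
    omega
  · rw [CNF.length_items]
    calc 2 * (α.length + 1) * wr ≤ k * (C * (2 * n)) * wr := by gcongr; exact hC.trans (by gcongr)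
      _ = C * (2 * n) * wr * k := by ring
  · have : rest.depth + 1 ≤ Lr := hdepth
    rw [Net.depth_ofForms]
    have : 1 ≤ rest.depth := by cases rest <;> simp [Net.depth]
    omega
  · dsimp only
    rw [Net.realize_ofForms hθ (by omega) _ (CNF.items_le (by omega) hα) (CNF.sum_sign_items _ _),
      hr_net]
    exact hr_mem _

/-- With `ℓ = 2 * h` the gap `√(2 ^ -ℓ)` equals `2 ^ -h`, a number with a finite binary expansion.
-/
theorem mvmRatio_ofForms (hk : 1 ≤ k) {p : ℕ} {W₁ : Matrix (Fin p) (Fin 1) θr}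
    {b₁ : Fin p → θr} {rest : Net θr p} {r : ℝ → ℝ}
    (hr_net : ∀ x : ℝ, (Net.layer W₁ b₁ rest).realize σ (fun _ => x) = r x)
    (hr_zero : ∀ x, x ≤ 0 → r x = 0) (hr_one : ∀ x, 1 ≤ x → r x = 1)
    (hθ : cnfWeights k θr ⊆ (θ : Set ℝ)) {α : CNF} (hα : ∀ c ∈ α, c.length ≤ k) {h d : ℕ}
    (hd : 2 * h ≤ d) (hα' : ∀ c ∈ α, ∀ l ∈ c, l.1 < 2 * (2 * h)) :
    (¬ α.Satisfiable → mvmRatio (netMatrix σ d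
      (Net.ofForms θ (CNF.items (2 * (2 * h)) α) W₁ b₁ rest)) = 0) ∧
    (α.Satisfiable → (1 / 2 : ℝ) ^ h ≤ mvmRatio (netMatrix σ d
      (Net.ofForms θ (CNF.items (2 * (2 * h)) α) W₁ b₁ rest))) := by
  have key : ∀ x : ℕ → Bool, (Net.ofForms θ (CNF.items (2 * (2 * h)) α) W₁ b₁ rest).realize σ
      (fun p => if x p then 1 else 0) = if ∀ c ∈ α, ∃ l ∈ c, x l.1 = l.2 then 1 else 0 := by
    intro x
    rw [Net.realize_ofForms hθ hk _ (CNF.items_le hk hα) (CNF.sum_sign_items _ _), hr_net]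
    simp only [hr_net]
    exact CNF.step_sum_items hα' hr_zero hr_one x
  have := mvmRatio_netMatrix hd (Net.ofForms θ (CNF.items (2 * (2 * h)) α) W₁ b₁ rest)
    (fun x => ∀ c ∈ α, ∃ l ∈ c, x l.1 = l.2) (fun x hx => by rw [key, if_pos hx])
    fun x hx => by rw [key, if_neg hx]
  refine ⟨this.1, fun hs => le_trans (le_of_eq ?_) (this.2 hs)⟩
  symm
  rw [Real.sqrt_eq_iff_mul_self_eq (by positivity) (by positivity)]
  rw [pow_mul', one_div, inv_pow, sq, mul_inv]

/-- The part `1 - s + δ` of the exponent is nonnegative, so the tolerance is at most half of `2 ^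
(-ℓ / 2)` with `ℓ = 2 * h`. -/
theorem rpow_tolerance_le {s δ : ℝ} (hs : s ≤ 1 + δ) (h : ℕ) :
    (2 : ℝ) ^ (-(1 / 2 + 1 - s + δ) * ((2 * h : ℕ) : ℝ)) / 2 ≤ (1 / 2 : ℝ) ^ (h + 1) := by
  have h1 : (1 / 2 : ℝ) ^ h = (2 : ℝ) ^ (-(h : ℝ)) := by
    rw [Real.rpow_neg (by norm_num), Real.rpow_natCast, one_div, inv_pow]
  rw [pow_succ, h1, mul_one_div]
  gcongr
  · norm_num
  · have h2 : (0 : ℝ) ≤ h := Nat.cast_nonneg h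
    push_cast
    nlinarith

theorem two_mul_sTilde_le (hk : 2 ≤ k) (hC : 1 ≤ C) {p : ℕ} {W₁ : Matrix (Fin p) (Fin 1) θr}
    {b₁ : Fin p → θr} {rest : Net θr p} (hΨ : Net.layer W₁ b₁ rest ∈ netClass 1 wr Lr θr)
    {r : ℝ → ℝ} (hr_mem : ∀ x, r x ∈ Set.Icc (0 : ℝ) 1)
    (hr_zero : ∀ x, x ≤ 0 → r x = 0) (hr_one : ∀ x, 1 ≤ x → r x = 1)
    (hr_net : ∀ x : ℝ, (Net.layer W₁ b₁ rest).realize σ (fun _ => x) = r x)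
    (hθ : cnfWeights k θr ⊆ (θ : Set ℝ)) {δ : ℝ} (hδ : 0 < δ) {d : ℕ → ℕ} (hd : ∀ n, n ≤ d n)
    {A : ProbMachine (NetSym θ) NumSym}
    (hA : ∀ n : ℕ, 1 ≤ n →
      ∀ Φ ∈ mvmClass σ k C wr Lr θ n \ mvmClass σ k C wr Lr θ (n - 1),
        Approximates A (encodeNet Φ.2) (mvmRatio (netMatrix σ (d n) Φ.2))
          ((2 : ℝ) ^ (-(1 / 2 + 1 - sTilde k C + δ) * (n : ℝ)) / 2))
    {t : ℝ} (ht : 0 < t)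
    (hT : A.RunsInExpTime
      (fun n => (fun Φ : (Σ ℓ : ℕ, Net θ (2 * ℓ)) => encodeNet Φ.2) '' mvmClass σ k C wr Lr θ n)
      t) :
    2 * sTilde k C ≤ t := by
  obtain ⟨a, ha⟩ := Code.exists_runs_decideByNet A (k := k) (by omega) hC W₁ b₁ rest
  obtain ⟨c, hc⟩ := hT
  obtain ⟨n₀, hn₀⟩ := eventually_atTop.1 hc
  -- The time bound is known only for large `n`, but a network of small index belongs to all later
  -- classes too. This gives halting on every formula, as a decision algorithm requires.
  have hhalt : ∀ (α : CNF), (∀ c ∈ α, c.length ≤ k) → ∀ (h : ℕ), 1 ≤ h →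
      α.length + 1 ≤ C * (2 * (2 * h)) → ∀ n, n₀ ≤ n → 2 * h ≤ n → ∀ ω, ∃ τ : ℕ,
      A.Halted (A.run (encodeNet (Net.ofForms θ (CNF.items (2 * (2 * h)) α) W₁ b₁ rest)) ω τ) ∧
        (τ : ℝ) ≤ max c 0 * (2 : ℝ) ^ (t * (n : ℝ)) := by
    intro α hα h h1 h2 n hn hn' ω
    have hmem := ofForms_mem_mvmClass hk hΨ hr_mem hr_net hθ hα (by omega : 1 ≤ 2 * h) hn' h2
    have hle : A.time (encodeNet (Net.ofForms θ (CNF.items (2 * (2 * h)) α) W₁ b₁ rest)) ω ≤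
        A.worstTime ((fun Φ : (Σ ℓ : ℕ, Net θ (2 * ℓ)) => encodeNet Φ.2) ''
          mvmClass σ k C wr Lr θ n) :=
      le_iSup₂_of_le _ (Set.mem_image_of_mem _ hmem) (le_iSup (fun ω => A.time _ ω) ω)
    obtain ⟨τ, h3, h4⟩ := ProbMachine.exists_halted_le
      ((ENat.toENNReal_le.2 hle).trans (hn₀ n hn))
    refine ⟨τ, h3, h4.trans (max_le ?_ (by positivity))⟩
    gcongr
    exact le_max_left _ _
  have happrox : ∀ (α : CNF), (∀ c ∈ α, c.length ≤ k) → ∀ b : Bool,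
      (b = true ↔ α.Satisfiable) →
      2 / 3 ≤ coinMeasure {ω | Code.Yields (Code.decideByNet (k := k) A C W₁ b₁ rest) ω α b} := by
    intro α hα b hb
    obtain ⟨h, h1, h2, h3, -, h5⟩ := ha α hα
    have hmem := ofForms_mem_mvmClass hk hΨ hr_mem hr_net hθ hα (by omega : 1 ≤ 2 * h) le_rfl h3
    -- The network has `2 * (2 * h)` inputs, so it enters the classes exactly at index `2 * h`.
    have h6 := hA (2 * h) (by omega) _ ⟨hmem, fun hmem' => by
      have : 2 * h ≤ 2 * h - 1 := hmem'.2.1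
      omega⟩
    obtain ⟨hu, hs⟩ := mvmRatio_ofForms (σ := σ) (θ := θ) (by omega) hr_net hr_zero hr_one hθ hα
      (hd (2 * h)) h2
    refine h6.trans (measure_mono ?_)
    rintro ω ⟨neg, ip, fp, ⟨τ, h7, h8⟩, h9⟩
    obtain ⟨s', h10, h11⟩ := h5 ω τ h7
    dsimp only at h8
    rw [h8] at h10
    have h12 := h9.trans_le (rpow_tolerance_le (sTilde_le_one_add k C hδ) h)
    obtain ⟨v1, v2⟩ := Code.verdict_spec neg ip fp (h + 1)
    have hbv : Code.verdict (numeral neg ip fp) (h + 1) = b := by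
      rw [abs_lt] at h12
      cases b with
      | false =>
        rw [hu (by rw [← hb]; simp)] at h12
        by_contra hv
        linarith [v1 (by simpa using hv)]
      | true =>
        have h13 := hs (hb.1 rfl)
        have h14 : (1 / 2 : ℝ) ^ h = 2 * (1 / 2 : ℝ) ^ (h + 1) := by ring
        by_contra hv
        linarith [v2 (by simpa using hv)]
    rw [hbv] at h10
    exact ⟨s', _, h10, h11⟩
  suffices hle : sTilde k C ≤ t / 2 by linarith
  refine sTilde_le (by positivity) (M := Code.decider k (Code.decideByNet (k := k) A C W₁ b₁ rest))
    (Code.decidesKSAT_decider (fun α hα ω => ?_) (fun α hα hs => happrox α hα true (by simpa))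
      fun α hα hs => happrox α hα false (by simpa))
    (Code.runsInExpTime_decider
      (B := fun n => 10 * (C * n * (k * (n + 1) + 1)) + 7 +
        a * (C * n * (k * (n + 1) + 1) + C * n + (n + 7) + 1) ^ 2 +
        5 * ⌊max c 0 * (2 : ℝ) ^ (t * (max n₀ ((n + 7) / 2) : ℕ))⌋₊)
      -- The summand 1 pays for the polynomial part. A call costs five times the running time of
      -- `A`, at an index at most `(n + 7) / 2` for large `n`, and the shift by 7 gives the last
      -- factor.
      (c := 1 + 5 * max c 0 * (2 : ℝ) ^ (t * (7 / 2)))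
      (fun n α hα ω => ?_) ?_)
  · obtain ⟨h, h1, h2, h3, -, h5⟩ := ha α hα
    obtain ⟨τ, h6, -⟩ := hhalt α hα h h1 h3 (max n₀ (2 * h)) (le_max_left _ _) (le_max_right _ _) ω
    obtain ⟨s', h7, h8⟩ := h5 ω τ h6
    exact ⟨_, s', _, h7, h8⟩
  · have hα' : ∀ c ∈ α, c.length ≤ k := fun c hc => (hα.1 c hc).1
    obtain ⟨h, h1, h2, h3, h4, h5⟩ := ha α hα'
    have hh := h4 n (fun c hc => (hα.1 c hc).2) hα.2
    obtain ⟨τ, h6, h7⟩ := hhalt α hα' h h1 h3 (max n₀ ((n + 7) / 2)) (le_max_left _ _)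
      (le_max_of_le_right (by omega)) ω
    obtain ⟨s', h8, h9⟩ := h5 ω τ h6
    have hL := Code.length_encodeCNF_le hα
    refine ⟨_, s', _, h8, h9, ?_⟩
    have h10 : τ ≤ ⌊max c 0 * (2 : ℝ) ^ (t * (max n₀ ((n + 7) / 2) : ℕ))⌋₊ := Nat.le_floor h7
    have h11 : a * ((encodeCNF α).length + α.length + h + 1) ^ 2 ≤
        a * (C * n * (k * (n + 1) + 1) + C * n + (n + 7) + 1) ^ 2 :=
      Nat.mul_le_mul_left _ (Nat.pow_le_pow_left (by
        have := hα.2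
        omega) 2)
    omega
  · set D := 10 * C * (k + 1) + 7 + a * (C * (k + 1) + C + 8) ^ 2 with hD
    filter_upwards [eventually_mul_pow_le D 4 (u := t / 2) (by positivity),
      eventually_ge_atTop (2 * n₀)] with n hn hn'
    have hpoly : 10 * (C * n * (k * (n + 1) + 1)) + 7 +
        a * (C * n * (k * (n + 1) + 1) + C * n + (n + 7) + 1) ^ 2 ≤ D * (n + 1) ^ 4 := by
      have e1 : n * (k * (n + 1) + 1) ≤ (k + 1) * (n + 1) ^ 2 := by nlinarith
      have e2 : C * n * (k * (n + 1) + 1) ≤ C * (k + 1) * (n + 1) ^ 2 := by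
        rw [mul_assoc, mul_assoc]
        exact Nat.mul_le_mul_left _ e1
      have e3 : (n + 1) ^ 2 ≤ (n + 1) ^ 4 := Nat.pow_le_pow_right (by omega) (by omega)
      have e4 : n + 1 ≤ (n + 1) ^ 2 := Nat.le_self_pow (by norm_num) _
      have e5 : C * n + (n + 7) + 1 ≤ (C + 8) * (n + 1) ^ 2 := by nlinarith
      have e6 : a * (C * n * (k * (n + 1) + 1) + C * n + (n + 7) + 1) ^ 2 ≤
          a * ((C * (k + 1) + C + 8) * (n + 1) ^ 2) ^ 2 :=
        -- The word is quadratic in `n` and the writing time is quadratic in the word, which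
        -- accounts for the fourth power.
        Nat.mul_le_mul_left _ (Nat.pow_le_pow_left (by
          calc _ ≤ C * (k + 1) * (n + 1) ^ 2 + (C + 8) * (n + 1) ^ 2 := by omega
            _ = _ := by ring) 2)
      calc _ ≤ 10 * (C * (k + 1) * (n + 1) ^ 4) + 7 * (n + 1) ^ 4 +
            a * ((C * (k + 1) + C + 8) * (n + 1) ^ 2) ^ 2 := by
            have e7 := Nat.mul_le_mul_left (C * (k + 1)) e3
            omega
        _ = _ := by rw [hD]; ring
    have hmax : max n₀ ((n + 7) / 2) = (n + 7) / 2 := max_eq_right (by omega)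
    rw [hmax]
    push_cast [Nat.cast_add]
    have hfl : ((⌊max c 0 * (2 : ℝ) ^ (t * ((n + 7) / 2 : ℕ))⌋₊ : ℕ) : ℝ) ≤
        max c 0 * ((2 : ℝ) ^ (t * (7 / 2)) * (2 : ℝ) ^ (t / 2 * (n : ℝ))) := by
      refine (Nat.floor_le (by positivity)).trans ?_
      rw [← Real.rpow_add (by norm_num)]
      gcongr
      · norm_num
      · have : (((n + 7) / 2 : ℕ) : ℝ) ≤ ((n : ℝ) + 7) / 2 := by
          refine Nat.cast_div_le.trans ?_
          push_cast
          rfl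
        nlinarith
    have hpoly' : ((10 * (C * n * (k * (n + 1) + 1)) + 7 +
        a * (C * n * (k * (n + 1) + 1) + C * n + (n + 7) + 1) ^ 2 : ℕ) : ℝ) ≤
        (D : ℝ) * ((n : ℝ) + 1) ^ 4 := by exact_mod_cast hpoly
    push_cast at hpoly' hfl ⊢
    linarith

end Main

end

theorem theorem5p2 (k C : ℕ) (hk : 1 ≤ k) (hC : 1 ≤ C)
    (σ : ℝ → ℝ) (wr Lr : ℕ) (θr : Finset ℝ) (Ψ : Net θr 1) (hΨ : Ψ ∈ netClass 1 wr Lr θr)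
    (r : ℝ → ℝ) (hr_cont : Continuous r) (hr_mem : ∀ x, r x ∈ Set.Icc (0 : ℝ) 1)
    (η : ℝ) (hη : 0 < η) (hη' : η < 1 / 2)
    (hr_zero : ∀ x, x ≤ 1 / 2 → r x = 0) (hr_one : ∀ x, 1 - η ≤ x → r x = 1)
    (hr_net : ∀ x : ℝ, Ψ.realize σ (fun _ => x) = r x)
    (θ : Finset ℝ) (hθ : cnfWeights k θr ⊆ (θ : Set ℝ))
    (δ : ℝ) (hδ : 0 < δ) (d : ℕ → ℕ) (hd : ∀ n, n ≤ d n)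
    (A : ProbMachine (NetSym θ) NumSym)
    (hA : ∀ n : ℕ, 1 ≤ n →
      ∀ Φ ∈ mvmClass σ k C wr Lr θ n \ mvmClass σ k C wr Lr θ (n - 1),
        Approximates A (encodeNet Φ.2) (mvmRatio (netMatrix σ (d n) Φ.2))
          ((2 : ℝ) ^ (-(1 / 2 + 1 - sTilde k C + δ) * (n : ℝ)) / 2))
    (t : ℝ) (ht : 0 < t)
    (hT : A.RunsInExpTime
      (fun n => (fun Φ : (Σ ℓ : ℕ, Net θ (2 * ℓ)) => encodeNet Φ.2) '' mvmClass σ k C wr Lr θ n) t) :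
    2 * sTilde k C ≤ t := by
  rcases hk.eq_or_lt with rfl | hk
  · linarith [sTilde_one_le C (half_pos ht)]
  · have : Inhabited θ := ⟨⟨0, Net.zero_mem_of hθ⟩⟩
    cases Ψ with
    | last W b =>
      -- A network with one layer is affine. Vanishing at 0 and at -1 it would vanish at 1 as well,
      -- where `r` is 1.
      have e0 := hr_net 0
      have e1 := hr_net (-1)
      have e2 := hr_net 1
      rw [hr_zero _ (by norm_num)] at e0 e1
      rw [hr_one _ (by linarith)] at e2
      simp only [Net.realize, Finset.univ_unique, Finset.sum_singleton] at e0 e1 e2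
      linarith
    | layer W₁ b₁ rest =>
      exact two_mul_sTilde_le hk hC hΨ hr_mem (fun x hx => hr_zero x (by linarith))
        (fun x hx => hr_one x (by linarith)) hr_net hθ hδ hd hA ht hT
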